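/- Let $k$ be a commutative ring, $A$ and $U$ unital associative $k$-algebras, and let $U$ be a left bialgebroid over $A$ with structure map $\eta : A\otimes_k A^{op}\to U$, source $s(a)=\eta(a\otimes 1)$, target $t(a)=\eta(1\otimes a)$, coproduct $\Delta(u)=u_{(1)}\otimes_A u_{(2)}$ and counit $\varepsilon : U\to A$. Write $a\triangleright u=s(a)u$, $u\triangleleft a=t(a)u$, $a\blacktriangleright u=u\,t(a)$; $A$ is a left $U$-module by $u\cdot a=\varepsilon(u\,s(a))$. Here $U\otimes_A U$ is formed with $(u\triangleleft a)\otimes v=u\otimes(a\triangleright v)$. For $p\ge 0$ let $C^p(U,A)$ be the $k$-module of right $A$-linear maps $(U^{\otimes_{A^{op}}p})_{\triangleleft}\to A$, where $(\ldots,a\blacktriangleright u^i,u^{i+1},\ldots)=(\ldots,u^i,u^{i+1}\triangleleft a,\ldots)$ and $A$ acts on the first factor (so $C^0(U,A)=A$). For $\varphi\in C^p(U,A)$, $\psi\in C^q(U,A)$ put $$\delta\varphi(u^1,\ldots,u^{p+1})=u^1\cdot\varphi(u^2,\ldots,u^{p+1})+\sum_{i=1}^{p}(-1)^i\varphi(u^1,\ldots,u^iu^{i+1},\ldots,u^{p+1})+(-1)^{p+1}\varphi(u^1,\ldots,\varepsilon(u^{p+1})\blacktriangleright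 u^p),$$ $$(\varphi\smallsmile\psi)(u^1,\ldots,u^{p+q})=\varphi(u^1,\ldots,u^{p-1},\psi(u^{p+1},\ldots,u^{p+q})\blacktriangleright u^p),$$ $$D_\psi(u^1,\ldots,u^q)=\psi(u^1_{(1)},\ldots,u^q_{(1)})\triangleright u^1_{(2)}\cdots u^q_{(2)},$$ $$(\varphi\circ_i\psi)(u^1,\ldots,u^{p+q-1})=\varphi(u^1,\ldots,u^{i-1},D_\psi(u^i,\ldots,u^{i+q-1}),u^{i+q},\ldots,u^{p+q-1})\quad(1\le i\le p),$$ $$\varphi\,\bar\circ\,\psi=(-1)^{(p-1)(q-1)}\sum_{i=1}^{p}(-1)^{(q-1)(i-1)}\varphi\circ_i\psi,\qquad \{\varphi,\psi\}=\varphi\,\bar\circ\,\psi-(-1)^{(p-1)(q-1)}\psi\,\bar\circ\,\varphi .$$ For $p=0$, $\varphi=a\in A$, this is read as $\delta a(u)=u\cdot a-a\,\varepsilon(u)$, $a\smallsmile\psi=a\,\psi$, $a\,\bar\circ\,\psi=0$; moreover $D_a=s(a)$ for $a\in C^0(U,A)$, and the bracket of two elements of $C^0(U,A)$ is zero. Then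 these formulas are well defined: $D_\varphi$ does not depend on the expressions chosen for the coproducts, and $\delta$, $\smallsmile$, $\circ_i$ take cochains to cochains, with $\delta\delta=0$. The cup product $\smallsmile$ and the bracket $\{\cdot,\cdot\}$ of cocycles are cocycles and induce operations on $H^\bullet(U,A)=H^\bullet(C^\bullet(U,A),\delta)$ which make it a Gerstenhaber algebra over $k$: $\smallsmile$ is an associative product $H^p\otimes_k H^q\to H^{p+q}$ with unit the class of $1\in A=C^0(U,A)$ and $\alpha\smallsmile\beta=(-1)^{pq}\beta\smallsmile\alpha$ for $\alpha\in H^p$, $\beta\in H^q$; $\{\cdot,\cdot\}: H^p\otimes_k H^q\to H^{p+q-1}$ (with $H^{-1}=0$) is a graded Lie bracket when $H^p$ is given the degree $p-1$; and for $\gamma\in H^r$, $\alpha\in H^p$, $\beta\in H^q$ $$\{\gamma,\alpha\smallsmile\beta\}=\{\gamma,\alpha\}\smallsmile\beta+(-1)^{(r-1)p}\,\alpha\smallsmile\{\gamma,\beta\}.$$ If moreover $U$ is a left Hopf algebroid, i.e. the Galois map ${}_{\blacktriangleright}U\otimes_{A^{op}}U_{\triangleleft}\to U\otimes_A U$, $u\otimes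 v\mapsto u_{(1)}\otimes u_{(2)}v$, is bijective, and the right $A$-module $U_{\triangleleft}$ is projective, then $(H^\bullet(U,A),\smallsmile)$ is isomorphic, as a graded $k$-algebra, to $\mathrm{Ext}^\bullet_U(A,A)$ with the Yoneda product. -/

import Mathlib

open scoped TensorProduct
open CategoryTheory

universe v u

section BaseMaps

variable {k : Type v} {A U : Type u} [CommRing k] [Ring A] [Algebra k A] [Ring U] [Algebra k U]

/-- The source map `s(a) = η(a ⊗ 1)`. -/
def srcMap (η : A ⊗[k] Aᵐᵒᵖ →ₐ[k] U) (a : A) : U := η (a ⊗ₜ[k] 1)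

/-- The target map `t(a) = η(1 ⊗ a)`. -/
def tgtMap (η : A ⊗[k] Aᵐᵒᵖ →ₐ[k] U) (a : A) : U := η (1 ⊗ₜ[k] MulOpposite.op a)

/-- The relations `(u ◁ a) ⊗ v = u ⊗ (a ▷ v)`, that is `t(a)u ⊗ v = u ⊗ s(a)v`,
which define `U ⊗_A U` as a quotient of `U ⊗_k U`. -/
def relA (η : A ⊗[k] Aᵐᵒᵖ →ₐ[k] U) : Submodule k (U ⊗[k] U) :=
  Submodule.span k {z | ∃ (a : A) (u w : U),
    z = (tgtMap η a * u) ⊗ₜ[k] w - u ⊗ₜ[k] (srcMap η a * w)}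

/-- The `k`-module `U ⊗_A U`. -/
abbrev TensA (η : A ⊗[k] Aᵐᵒᵖ →ₐ[k] U) : Type u := (U ⊗[k] U) ⧸ relA η

/-- The class of `u ⊗ w` in `U ⊗_A U`. -/
def tmulA (η : A ⊗[k] Aᵐᵒᵖ →ₐ[k] U) (u w : U) : TensA η := (relA η).mkQ (u ⊗ₜ[k] w)

/-- `z = ∑ⱼ xⱼ ⊗_A yⱼ` in `U ⊗_A U`. -/
def IsRep (η : A ⊗[k] Aᵐᵒᵖ →ₐ[k] U) (z : TensA η) {n : ℕ} (x y : Fin n → U) : Prop :=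
  z = ∑ j, tmulA η (x j) (y j)

/-- The relations which define `U ⊗_A U ⊗_A U` as a quotient of `U ⊗_k U ⊗_k U`. -/
def relAA (η : A ⊗[k] Aᵐᵒᵖ →ₐ[k] U) : Submodule k (U ⊗[k] (U ⊗[k] U)) :=
  Submodule.span k
    ({z | ∃ (a : A) (u w r : U),
      z = (tgtMap η a * u) ⊗ₜ[k] (w ⊗ₜ[k] r) - u ⊗ₜ[k] ((srcMap η a * w) ⊗ₜ[k] r)} ∪
     {z | ∃ (a : A) (u w r : U),
      z = u ⊗ₜ[k] ((tgtMap η a * w) ⊗ₜ[k] r) - u ⊗ₜ[k] (w ⊗ₜ[k] (srcMap η a * r))})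

/-- The class of `u ⊗ w ⊗ r` in `U ⊗_A U ⊗_A U`. -/
def tmulAA (η : A ⊗[k] Aᵐᵒᵖ →ₐ[k] U) (u w r : U) : (U ⊗[k] (U ⊗[k] U)) ⧸ relAA η :=
  (relAA η).mkQ (u ⊗ₜ[k] (w ⊗ₜ[k] r))

end BaseMaps

/-- A left bialgebroid structure on `U` over `A` (with ground ring `k`): a `k`-algebra map
`η : A ⊗ Aᵒᵖ → U`, and an `A`-coring structure on `U` (with the bimodule structure
`a ▷ u ◁ b = s(a)t(b)u`) whose coproduct takes values in the Sweedler-Takeuchi product and is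
multiplicative, and whose counit makes `A` a left `U`-module by `u · a = ε(u s(a))`.
All axioms on the coproduct are written in Sweedler notation, that is, in terms of arbitrary
expressions `Δ(u) = ∑ⱼ xⱼ ⊗_A yⱼ`. -/
structure LeftBialgebroid (k : Type v) (A U : Type u) [CommRing k] [Ring A] [Algebra k A]
    [Ring U] [Algebra k U] where
  /-- the `Aᵉ`-ring structure -/
  η : A ⊗[k] Aᵐᵒᵖ →ₐ[k] U
  /-- the coproduct -/
  Δ : U →ₗ[k] TensA η
  /-- the counit -/
  ε : U →ₗ[k] A
  comul_bimod : ∀ (a b : A) (u : U) (n : ℕ) (x y : Fin n → U), IsRep η (Δ u) x y →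
    IsRep η (Δ (srcMap η a * tgtMap η b * u))
      (fun j => srcMap η a * x j) (fun j => tgtMap η b * y j)
  counit_bimod : ∀ (a b : A) (u : U), ε (srcMap η a * tgtMap η b * u) = a * ε u * b
  coassoc : ∀ (u : U) (n : ℕ) (x y : Fin n → U), IsRep η (Δ u) x y →
    ∀ (m l : Fin n → ℕ) (x₁ x₂ : ∀ j, Fin (m j) → U) (y₁ y₂ : ∀ j, Fin (l j) → U),
      (∀ j, IsRep η (Δ (x j)) (x₁ j) (x₂ j)) → (∀ j, IsRep η (Δ (y j)) (y₁ j) (y₂ j)) →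
      ∑ j, ∑ i, tmulAA η (x₁ j i) (x₂ j i) (y j) = ∑ j, ∑ i, tmulAA η (x j) (y₁ j i) (y₂ j i)
  counit_left : ∀ (u : U) (n : ℕ) (x y : Fin n → U), IsRep η (Δ u) x y →
    ∑ j, srcMap η (ε (x j)) * y j = u
  counit_right : ∀ (u : U) (n : ℕ) (x y : Fin n → U), IsRep η (Δ u) x y →
    ∑ j, tgtMap η (ε (y j)) * x j = u
  takeuchi : ∀ (u : U) (a : A) (n : ℕ) (x y : Fin n → U), IsRep η (Δ u) x y →
    ∑ j, tmulA η (x j * tgtMap η a) (y j) = ∑ j, tmulA η (x j) (y j * srcMap η a)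
  comul_one : Δ 1 = tmulA η 1 1
  comul_mul : ∀ (u w : U) (n m : ℕ) (x y : Fin n → U) (x' y' : Fin m → U),
    IsRep η (Δ u) x y → IsRep η (Δ w) x' y' →
    Δ (u * w) = ∑ j, ∑ i, tmulA η (x j * x' i) (y j * y' i)
  counit_one : ε 1 = 1
  counit_mul_src : ∀ u w : U, ε (u * w) = ε (u * srcMap η (ε w))
  counit_mul_tgt : ∀ u w : U, ε (u * w) = ε (u * tgtMap η (ε w))

/-- The sign `(-1)ⁿ` for an integer `n`. -/
def sgn (n : ℤ) : ℤ := (n.negOnePow : ℤ)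

/-- A Gerstenhaber algebra structure over `k` on `V = ⨁_{p ≥ 0} V p`: a unital associative graded
commutative product, and a graded Lie bracket of degree `-1` (an element of `V p` has degree
`p - 1` for the bracket) such that every `{c, ·}` is a graded derivation of the product.
The bracket of two elements of `V 0` has degree `-1`, hence vanishes.
Identities between elements of `V p` and `V p'` with `p = p'` non-definitionally are written
in the direct sum. -/
structure GerstenhaberAlgebra (k : Type v) [CommRing k] (V : ℕ → Type u)
    [∀ n, AddCommGroup (V n)] [∀ n, Module k (V n)] where
  /-- the unit -/
  one : V 0
  /-- the product -/
  cup : ∀ p q : ℕ, V p →ₗ[k] V q →ₗ[k] V (p + q)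
  /-- the bracket -/
  bracket : ∀ p q : ℕ, V p →ₗ[k] V q →ₗ[k] V (p + q - 1)
  cup_assoc : ∀ (p q r : ℕ) (a : V p) (b : V q) (c : V r),
    DirectSum.of V _ (cup (p + q) r (cup p q a b) c) =
      DirectSum.of V _ (cup p (q + r) a (cup q r b c))
  one_cup : ∀ (p : ℕ) (a : V p), DirectSum.of V _ (cup 0 p one a) = DirectSum.of V p a
  cup_one : ∀ (p : ℕ) (a : V p), DirectSum.of V _ (cup p 0 a one) = DirectSum.of V p a
  cup_comm : ∀ (p q : ℕ) (a : V p) (b : V q),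
    DirectSum.of V _ (cup p q a b) = sgn (p * q) • DirectSum.of V _ (cup q p b a)
  bracket_zero_zero : bracket 0 0 = 0
  bracket_antisymm : ∀ (p q : ℕ) (a : V p) (b : V q),
    DirectSum.of V _ (bracket p q a b) =
      -(sgn (((p : ℤ) - 1) * ((q : ℤ) - 1)) • DirectSum.of V _ (bracket q p b a))
  jacobi : ∀ (p q r : ℕ) (a : V p) (b : V q) (c : V r),
    DirectSum.of V _ (bracket p (q + r - 1) a (bracket q r b c)) =
      DirectSum.of V _ (bracket (p + q - 1) r (bracket p q a b) c) +
        sgn (((p : ℤ) - 1) * ((q : ℤ) - 1)) •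
          DirectSum.of V _ (bracket q (p + r - 1) b (bracket p r a c))
  /-- part of the definition of a graded Lie algebra over a ring in which `2` is not invertible -/
  bracket_self : ∀ (p : ℕ) (a : V p), Odd p → bracket p p a a = 0
  /-- part of the definition of a graded Lie algebra over a ring in which `3` is not invertible -/
  jacobi_self : ∀ (p : ℕ) (a : V p), Even p → bracket p (p + p - 1) a (bracket p p a a) = 0
  leibniz : ∀ (r p q : ℕ) (c : V r) (a : V p) (b : V q),
    DirectSum.of V _ (bracket r (p + q) c (cup p q a b)) =
      DirectSum.of V _ (cup (r + p - 1) q (bracket r p c a) b) +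
        sgn (((r : ℤ) - 1) * p) • DirectSum.of V _ (cup p (r + q - 1) a (bracket r q c b))

namespace LeftBialgebroid

variable {k : Type v} {A U : Type u} [CommRing k] [Ring A] [Algebra k A] [Ring U] [Algebra k U]
  (B : LeftBialgebroid k A U)

/-- The source map of a bialgebroid. -/
def s (a : A) : U := srcMap B.η a

/-- The target map of a bialgebroid. -/
def t (a : A) : U := tgtMap B.η a

theorem s_add (a b : A) : B.s (a + b) = B.s a + B.s b := by
  simp [s, srcMap, TensorProduct.add_tmul]

theorem s_zero : B.s 0 = 0 := by
  simp [s, srcMap]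

theorem s_one : B.s 1 = 1 := map_one B.η

theorem t_one : B.t 1 = 1 := map_one B.η

theorem s_smul (c : k) (a : A) : B.s (c • a) = c • B.s a := by
  simp only [s, srcMap, ← TensorProduct.smul_tmul', map_smul]

/-- The left action `u · a = ε(u s(a))` of `U` on `A`. -/
def act (u : U) (a : A) : A := B.ε (u * B.s a)

theorem one_act (a : A) : B.act 1 a = a := by
  have h : B.ε (B.s a * B.t 1 * 1) = a * B.ε 1 * 1 := B.counit_bimod a 1 1
  rw [t_one, B.counit_one, mul_one, mul_one, mul_one, mul_one] at h
  rw [act, one_mul, h]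

theorem mul_act (u w : U) (a : A) : B.act (u * w) a = B.act u (B.act w a) := by
  unfold act
  rw [mul_assoc]
  exact B.counit_mul_src u (w * B.s a)

theorem act_zero (u : U) : B.act u 0 = 0 := by simp [act, s_zero]

theorem act_add (u : U) (a b : A) : B.act u (a + b) = B.act u a + B.act u b := by
  simp [act, s_add, mul_add]

theorem add_act (u w : U) (a : A) : B.act (u + w) a = B.act u a + B.act w a := by
  simp [act, add_mul]

theorem zero_act (a : A) : B.act 0 a = 0 := by simp [act]

theorem act_smul (u : U) (c : k) (a : A) : B.act u (c • a) = c • B.act u a := by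
  simp [act, s_smul]

/-! ### Cochains -/

/-- `f(u¹, …, uᵖ)` is a `p`-cochain of `U` with values in `A`, that is, it is a right `A`-linear map
`(U^{⊗_{Aᵒᵖ} p})_◁ → A`, given as a multilinear map which is balanced with respect to
`(…, a ▸ uⁱ, uⁱ⁺¹, …) = (…, uⁱ, uⁱ⁺¹ ◁ a, …)` where `a ▸ u = u t(a)` and `u ◁ a = t(a)u`.
For `p = 0` this is an element of `A`. -/
structure IsCochain {p : ℕ} (f : (Fin p → U) → A) : Prop where
  map_add : ∀ (u : Fin p → U) (i : Fin p) (x y : U),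
    f (Function.update u i (x + y)) = f (Function.update u i x) + f (Function.update u i y)
  map_smul : ∀ (u : Fin p → U) (i : Fin p) (c : k) (x : U),
    f (Function.update u i (c • x)) = c • f (Function.update u i x)
  balanced : ∀ (u : Fin p → U) (i j : Fin p) (a : A), (j : ℕ) = i + 1 →
    f (Function.update u i (u i * B.t a)) = f (Function.update u j (B.t a * u j))
  map_right : ∀ (u : Fin p → U) (i : Fin p) (a : A), (i : ℕ) = 0 →
    f (Function.update u i (B.t a * u i)) = f u * a

/-- The `k`-module `Cᵖ(U, A)` of `p`-cochains. -/
def cochains (p : ℕ) : Submodule k ((Fin p → U) → A) where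
  carrier := {f | B.IsCochain f}
  zero_mem' := ⟨by simp, by simp, by simp, by simp⟩
  add_mem' {f g} hf hg :=
    ⟨fun u i x y => by simp only [Pi.add_apply, hf.map_add, hg.map_add]; abel,
     fun u i c x => by simp only [Pi.add_apply, hf.map_smul, hg.map_smul, smul_add],
     fun u i j a h => by simp only [Pi.add_apply, hf.balanced u i j a h, hg.balanced u i j a h],
     fun u i a h => by simp only [Pi.add_apply, hf.map_right u i a h, hg.map_right u i a h,
      add_mul]⟩
  smul_mem' c f hf :=
    ⟨fun u i x y => by simp only [Pi.smul_apply, hf.map_add, smul_add],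
     fun u i d x => by simp only [Pi.smul_apply, hf.map_smul, smul_comm c d],
     fun u i j a h => by simp only [Pi.smul_apply, hf.balanced u i j a h],
     fun u i a h => by simp only [Pi.smul_apply, hf.map_right u i a h, smul_mul_assoc]⟩

/-- `φ(u¹, …, uᵖ⁻¹, a ▸ uᵖ)` where `a ▸ u = u t(a)`; for `p = 0` this is `φ a`, as
`φ ∈ C⁰(U, A) = A` stands for the right `A`-linear map `a ↦ φ a`. -/
def lastAct : (p : ℕ) → ((Fin p → U) → A) → (Fin p → U) → A → A
  | 0, f, u, a => f u * a
  | p + 1, f, u, a => f (Function.update u (Fin.last p) (u (Fin.last p) * B.t a))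

/-- The coboundary map
`δφ(u¹, …, uᵖ⁺¹) = u¹ · φ(u², …, uᵖ⁺¹) + ∑ᵢ (-1)ⁱ φ(u¹, …, uⁱuⁱ⁺¹, …, uᵖ⁺¹)
  + (-1)ᵖ⁺¹ φ(u¹, …, ε(uᵖ⁺¹) ▸ uᵖ)`
where `u · a = ε(u s(a))`. -/
def δ (p : ℕ) : ((Fin p → U) → A) →ₗ[k] ((Fin (p + 1) → U) → A) where
  toFun f u := B.act (u 0) (f (Fin.tail u))
    + ∑ i : Fin p, sgn (i + 1) • f (Fin.contractNth i.castSucc (· * ·) u)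
    + sgn (p + 1) • B.lastAct p f (Fin.init u) (B.ε (u (Fin.last p)))
  map_add' f g := by
    have h : ∀ u a, B.lastAct p (f + g) u a = B.lastAct p f u a + B.lastAct p g u a := by
      intro u a
      cases p <;> simp [lastAct, add_mul]
    funext u
    simp only [Pi.add_apply, h, act_add, smul_add, Finset.sum_add_distrib]
    abel
  map_smul' c f := by
    have h : ∀ u a, B.lastAct p (c • f) u a = c • B.lastAct p f u a := by
      intro u a
      cases p <;> simp [lastAct]
    funext u
    simp only [Pi.smul_apply, h, act_smul, smul_add, Finset.smul_sum,
      RingHom.id_apply, smul_comm c]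

/-! ### Cohomology -/

/-- The `k`-module of `p`-cocycles. -/
def cocycles (p : ℕ) : Submodule k ((Fin p → U) → A) := B.cochains p ⊓ LinearMap.ker (B.δ p)

/-- The `k`-module of `p`-coboundaries. -/
def coboundaries : (p : ℕ) → Submodule k ((Fin p → U) → A)
  | 0 => ⊥
  | p + 1 => (B.cochains p).map (B.δ p)

/-- The cohomology `Hᵖ(U, A)`. -/
abbrev H (p : ℕ) : Type u := B.cocycles p ⧸ (B.coboundaries p).submoduleOf (B.cocycles p)

/-- The cohomology class of a cocycle. -/
def cls {p : ℕ} (f : (Fin p → U) → A) (hf : f ∈ B.cocycles p) : B.H p :=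
  Submodule.Quotient.mk ⟨f, hf⟩

/-! ### The cup product and the Gerstenhaber bracket of cochains -/

/-- The cup product
`(φ ⌣ ψ)(u¹, …, uᵖ⁺ᵠ) = φ(u¹, …, uᵖ⁻¹, ψ(uᵖ⁺¹, …, uᵖ⁺ᵠ) ▸ uᵖ)`. -/
def cup {p q : ℕ} (f : (Fin p → U) → A) (g : (Fin q → U) → A) : (Fin (p + q) → U) → A :=
  fun u => B.lastAct p f (fun i => u (Fin.castAdd q i)) (g fun i => u (Fin.natAdd p i))

theorem exists_rep (u : U) : ∃ (n : ℕ) (x y : Fin n → U), IsRep B.η (B.Δ u) x y := by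
  obtain ⟨z, hz⟩ := (relA B.η).mkQ_surjective (B.Δ u)
  obtain ⟨S, hS⟩ := TensorProduct.exists_finset z
  refine ⟨S.card, fun j => (S.equivFin.symm j).1.1, fun j => (S.equivFin.symm j).1.2, ?_⟩
  unfold IsRep tmulA
  rw [← hz, ← map_sum, hS]
  congr 1
  rw [Equiv.sum_comp S.equivFin.symm (fun i : S => i.1.1 ⊗ₜ[k] i.1.2)]
  exact (Finset.sum_coe_sort S (fun i => i.1 ⊗ₜ[k] i.2)).symm

/-- The number of terms of a chosen expression `Δ(u) = ∑ⱼ u₍₁₎ⱼ ⊗_A u₍₂₎ⱼ`. -/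
noncomputable def swLen (u : U) : ℕ := (B.exists_rep u).choose

/-- The first legs of a chosen expression `Δ(u) = ∑ⱼ u₍₁₎ⱼ ⊗_A u₍₂₎ⱼ`. -/
noncomputable def sw₁ (u : U) : Fin (B.swLen u) → U := (B.exists_rep u).choose_spec.choose

/-- The second legs of a chosen expression `Δ(u) = ∑ⱼ u₍₁₎ⱼ ⊗_A u₍₂₎ⱼ`. -/
noncomputable def sw₂ (u : U) : Fin (B.swLen u) → U :=
  (B.exists_rep u).choose_spec.choose_spec.choose

/-- The expression `∑ φ(x¹, …, xᵖ) ▷ y¹ ⋯ yᵖ` where `∑ⱼ xⁱⱼ ⊗ yⁱⱼ` are finite families of elementary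
tensors and `a ▷ u = s(a)u`. -/
def opDAux {p : ℕ} (f : (Fin p → U) → A) (n : Fin p → ℕ) (x y : ∀ i, Fin (n i) → U) : U :=
  ∑ j : (∀ i, Fin (n i)), B.s (f fun i => x i (j i)) * (List.ofFn fun i => y i (j i)).prod

/-- The operator `D_φ(u¹, …, uᵖ) = φ(u¹₍₁₎, …, uᵖ₍₁₎) ▷ u¹₍₂₎ ⋯ uᵖ₍₂₎`. For a cochain `φ`, the value
does not depend on the chosen expressions of the coproducts. -/
noncomputable def opD {p : ℕ} (f : (Fin p → U) → A) (u : Fin p → U) : U :=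
  B.opDAux f (fun i => B.swLen (u i)) (fun i => B.sw₁ (u i)) (fun i => B.sw₂ (u i))

/-- The Gerstenhaber product `∘ᵢ`:
`(u¹, …, uᵖ⁺ᵠ⁻¹) ↦ φ(u¹, …, uⁱ⁻¹, D_ψ(uⁱ, …, uⁱ⁺ᵠ⁻¹), uⁱ⁺ᵠ, …, uᵖ⁺ᵠ⁻¹)`;
here the position `i` is counted from `0`. -/
noncomputable def circ {p q : ℕ} (i : Fin p) (f : (Fin p → U) → A) (g : (Fin q → U) → A) :
    (Fin (p + q - 1) → U) → A :=
  fun u => f fun j =>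
    if h : j < i then u ⟨j, by omega⟩
    else if h' : j = i then B.opD g fun l : Fin q => u ⟨i + l, by omega⟩
    else u ⟨j + q - 1, by omega⟩

/-- `φ ∘̄ ψ = (-1)^{|p||q|} ∑_{i=1}^{p} (-1)^{|q||i|} φ ∘ᵢ ψ` with `|n| = n - 1`. -/
noncomputable def circBar {p q : ℕ} (f : (Fin p → U) → A) (g : (Fin q → U) → A) :
    (Fin (p + q - 1) → U) → A :=
  sgn (((p : ℤ) - 1) * ((q : ℤ) - 1)) •
    ∑ i : Fin p, sgn (((q : ℤ) - 1) * (i : ℤ)) • B.circ i f g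

/-- The Gerstenhaber bracket `{φ, ψ} = φ ∘̄ ψ - (-1)^{|p||q|} ψ ∘̄ φ`. -/
noncomputable def bracket {p q : ℕ} (f : (Fin p → U) → A) (g : (Fin q → U) → A) :
    (Fin (p + q - 1) → U) → A :=
  B.circBar f g - sgn (((p : ℤ) - 1) * ((q : ℤ) - 1)) •
    fun u => B.circBar g f (fun j => u (Fin.cast (by omega) j))

/-! ### Left Hopf algebroids and Ext -/

/-- The relations `u t(a) ⊗ w = u ⊗ t(a) w` which define `▸U ⊗_{Aᵒᵖ} U◁` as a quotient of
`U ⊗_k U`. -/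
def relAop : Submodule k (U ⊗[k] U) :=
  Submodule.span k {z | ∃ (a : A) (u w : U),
    z = (u * B.t a) ⊗ₜ[k] w - u ⊗ₜ[k] (B.t a * w)}

/-- Right multiplication by `1 ⊗ w` on `U ⊗_A U`. -/
def mulRightSnd (w : U) : TensA B.η →ₗ[k] TensA B.η :=
  (relA B.η).mapQ (relA B.η) (TensorProduct.map LinearMap.id (LinearMap.mulRight k w)) (by
    unfold relA
    rw [Submodule.span_le]
    rintro _ ⟨a, x, y, rfl⟩
    refine Submodule.subset_span ⟨a, x, y * w, ?_⟩
    simp [mul_assoc])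

theorem mulRightSnd_tmulA (w x y : U) :
    B.mulRightSnd w (tmulA B.η x y) = tmulA B.η x (y * w) := by
  simp [mulRightSnd, tmulA]

/-- The map `U ⊗_k U → U ⊗_A U`, `u ⊗ w ↦ u₍₁₎ ⊗_A u₍₂₎ w`. -/
def galoisAux : U ⊗[k] U →ₗ[k] TensA B.η :=
  TensorProduct.lift
    (LinearMap.mk₂ k (fun u w => B.mulRightSnd w (B.Δ u))
      (fun x y w => by simp) (fun c x w => by simp)
      (fun u w w' => by
        obtain ⟨n, x, y, h⟩ := B.exists_rep u
        rw [h]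
        simp only [map_sum, mulRightSnd_tmulA, ← Finset.sum_add_distrib]
        simp [mul_add, tmulA, TensorProduct.tmul_add])
      (fun c u w => by
        obtain ⟨n, x, y, h⟩ := B.exists_rep u
        rw [h]
        simp only [map_sum, mulRightSnd_tmulA, Finset.smul_sum]
        simp [tmulA, TensorProduct.tmul_smul]))

theorem relAop_le_ker : B.relAop ≤ LinearMap.ker B.galoisAux := by
  unfold relAop
  rw [Submodule.span_le]
  rintro _ ⟨a, u, w, rfl⟩
  obtain ⟨n, x, y, h⟩ := B.exists_rep u
  have h1 : IsRep B.η (B.Δ 1) (fun _ : Fin 1 => 1) (fun _ => 1) := by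
    simp [IsRep, B.comul_one]
  have h2 := B.comul_bimod 1 a 1 1 _ _ h1
  have hs : srcMap B.η (1 : A) = 1 := B.s_one
  simp only [hs, one_mul, mul_one] at h2
  have h3 := B.comul_mul u _ _ _ _ _ _ _ h h2
  change B.galoisAux _ = 0
  rw [map_sub, sub_eq_zero]
  simp only [galoisAux, TensorProduct.lift.tmul, LinearMap.mk₂_apply]
  change B.mulRightSnd w (B.Δ (u * tgtMap B.η a)) = B.mulRightSnd (tgtMap B.η a * w) (B.Δ u)
  rw [h3, h]
  simp [mulRightSnd_tmulA, mul_assoc]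

/-- The Galois map `β : ▸U ⊗_{Aᵒᵖ} U◁ → U ⊗_A U`, `u ⊗ w ↦ u₍₁₎ ⊗_A u₍₂₎ w`. -/
def galois : ((U ⊗[k] U) ⧸ B.relAop) →ₗ[k] TensA B.η :=
  B.relAop.liftQ B.galoisAux B.relAop_le_ker

/-- A left bialgebroid is a left Hopf algebroid (a `×_A`-Hopf algebra) if its Galois map is
bijective. -/
def IsLeftHopf : Prop := Function.Bijective B.galois

/-- The target map as a ring homomorphism from the opposite ring of `A`. -/
def tgtHom : Aᵐᵒᵖ →+* U :=
  (B.η.comp (Algebra.TensorProduct.includeRight : Aᵐᵒᵖ →ₐ[k] A ⊗[k] Aᵐᵒᵖ)).toRingHom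

/-- The right `A`-module `U◁`, where `u ◁ a = t(a)u`, is projective. -/
def IsRightProjective : Prop :=
  letI : Module Aᵐᵒᵖ U := Module.compHom U B.tgtHom
  Module.Projective Aᵐᵒᵖ U

/-- The base algebra `A`, to be considered as a left `U`-module. -/
@[nolint unusedArguments]
def Base (_B : LeftBialgebroid k A U) : Type u := A

instance : AddCommGroup B.Base := inferInstanceAs (AddCommGroup A)

/-- The left `U`-module structure `u · a = ε(u s(a))` on `A`. -/
instance : Module U B.Base where
  smul u a := B.act u a
  one_smul a := B.one_act a
  mul_smul u w a := B.mul_act u w a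
  smul_zero u := B.act_zero u
  smul_add u a b := B.act_add u a b
  add_smul u w a := B.add_act u w a
  zero_smul a := B.zero_act a

/-- `A` as an object of the category of left `U`-modules. -/
abbrev unitObj : ModuleCat.{u} U := ModuleCat.of U B.Base

/-- `Extᵖ_U(A, A)` in the category of left `U`-modules. -/
abbrev ExtAA (p : ℕ) : Type u := Abelian.Ext.{u} B.unitObj B.unitObj p

end LeftBialgebroid

open scoped ModuleCat.Algebra

set_option linter.unusedSectionVars false
set_option linter.unusedSimpArgs false

/-! The map `φ ↦ D_φ` embeds the cochains `C(U, A)` into the multiadditive functions on `U` with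
values in `U`, that is, into the Hochschild cochains of the plain ring `U`. It is injective because
`ε(D_φ) = φ` (`IsLCochain.ε_lD`). Its image contains the identity `D_ε` and is closed under
insertion, braces and products of values: `D_{φ ∘ᵢ ψ} = D_φ ∘ᵢ D_ψ`, and similarly for `φ{ψ, χ}` and
`φ ⌣ ψ` (`IsLCochain.lD_wcirc`, `IsLCochain.lD_brace₂`, `IsLCochain.lD_lcup`). All of this rests on
`Δ(D_ψ(w)) = D_ψ(w₍₁₎) ⊗ w₍₂₎` (`IsLCochain.contr_expand`), which comes from coassociativity,
multiplicativity of `Δ` and the Takeuchi condition.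

Under this embedding `δ` becomes the Hochschild differential `{μ, ·}`, where `μ` is the
multiplication of `U` (`IsCochain.δ_eq`, `hdelta_eq_gbr`). What remains is Gerstenhaber's calculus
for a ring: the pre-Lie identity gives the Jacobi identity (`gbr_jacobi`), the composition `f ∘ g`
is a homotopy for graded commutativity (`hdelta_gcirc`), and the brace `c{a, b}` is a homotopy for
the Leibniz rule (`hdelta_brace₂`). Cochains are treated as functions on lists which vanish on lists
of the wrong length, so that all compositions are sums over all splittings of a list.

For `Ext`, the iterated induced modules `Q (n + 1)` form a bar resolution of `Q 0 = A`, with the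
contraction `q ↦ 1 ⊗ q`. They are projective over `U` when `U◁` is projective over `A`. Cochains of
degree `p` are `U`-linear maps `Q (p + 1) → A`, cocycles are maps out of the syzygy `K p`, and
dimension shifting identifies their classes with `Ext`. A cocycle `f` lifts to the chain map `id ⊗ ⋯
⊗ id ⊗ f`, so the Yoneda product of `f` and `g` is represented by `g ⌣ f`. Graded commutativity
turns this into `(-1)^{pq} f ⌣ g`, and the sign is absorbed by rescaling degree `p` with
`(-1)^{p(p-1)/2}`. -/

/-! ### Signs. -/

theorem sgn_add (a b : ℤ) : sgn (a + b) = sgn a * sgn b := by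
  simp [sgn, Int.negOnePow_add]

theorem sgn_zero : sgn 0 = 1 := by simp [sgn]

theorem sgn_one : sgn 1 = -1 := by simp [sgn]

theorem sgn_mul_self (a : ℤ) : sgn a * sgn a = 1 := by
  rw [← sgn_add, sgn, Int.negOnePow_even _ ⟨a, rfl⟩]; rfl

theorem sgn_eq_ite (a : ℤ) : sgn a = if Even a then 1 else -1 := by
  split_ifs with h
  · simp [sgn, Int.negOnePow_even a h]
  · simp [sgn, Int.negOnePow_odd a (Int.not_even_iff_odd.mp h)]

theorem sgn_congr {a b : ℤ} (h : Even (a - b)) : sgn a = sgn b := by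
  rw [sgn_eq_ite, sgn_eq_ite]
  rw [Int.even_sub] at h
  simp [h]

/-! ### Sums over the splittings of a list. -/

section SplitSum

variable {V M N : Type*} [AddCommGroup M] [AddCommGroup N]

/-- The sum of `F a b` over all splittings `w = a ++ b`. -/
def splitSum : List V → (List V → List V → M) → M
  | [], F => F [] []
  | x :: w, F => F [] (x :: w) + splitSum w fun a b => F (x :: a) b

@[simp] theorem splitSum_nil (F : List V → List V → M) : splitSum [] F = F [] [] := rfl

theorem splitSum_cons (x : V) (w : List V) (F : List V → List V → M) :
    splitSum (x :: w) F = F [] (x :: w) + splitSum w fun a b => F (x :: a) b := rfl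

theorem splitSum_congr {w : List V} {F G : List V → List V → M}
    (h : ∀ a b, a ++ b = w → F a b = G a b) : splitSum w F = splitSum w G := by
  induction w generalizing F G with
  | nil => exact h _ _ rfl
  | cons x w ih =>
    rw [splitSum_cons, splitSum_cons, h [] _ rfl, ih fun a b hab => h _ _ (by simp [hab])]

theorem splitSum_add (w : List V) (F G : List V → List V → M) :
    (splitSum w fun a b => F a b + G a b) = splitSum w F + splitSum w G := by
  induction w generalizing F G with
  | nil => rfl
  | cons x w ih => simp only [splitSum_cons, ih]; abel

theorem map_splitSum (f : M →+ N) (w : List V) (F : List V → List V → M) :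
    f (splitSum w F) = splitSum w fun a b => f (F a b) := by
  induction w generalizing F with
  | nil => rfl
  | cons x w ih => simp only [splitSum_cons, map_add, ih]

@[simp] theorem splitSum_zero (w : List V) : (splitSum w fun _ _ => (0 : M)) = 0 := by
  induction w with
  | nil => rfl
  | cons x w ih => simp [splitSum_cons, ih]

theorem splitSum_eq_zero {w : List V} {F : List V → List V → M}
    (h : ∀ a b, a ++ b = w → F a b = 0) : splitSum w F = 0 := by
  rw [splitSum_congr h, splitSum_zero]

theorem smul_splitSum (n : ℤ) (w : List V) (F : List V → List V → M) :
    n • splitSum w F = splitSum w fun a b => n • F a b :=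
  map_splitSum (DistribSMul.toAddMonoidHom M n) w F

theorem splitSum_comm (w w' : List V) (F : List V → List V → List V → List V → M) :
    (splitSum w fun a b => splitSum w' fun c d => F a b c d) =
      splitSum w' fun c d => splitSum w fun a b => F a b c d := by
  induction w generalizing F with
  | nil => rfl
  | cons x w ih => simp only [splitSum_cons, ih, splitSum_add]

/-- Coassociativity of deconcatenation: both sides run over the splittings of `w` into three pieces.
-/
theorem splitSum_assoc (w : List V) (G : List V → List V → List V → M) :
    (splitSum w fun a b => splitSum a fun c d => G c d b) =
      splitSum w fun c e => splitSum e fun d b => G c d b := by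
  induction w generalizing G with
  | nil => rfl
  | cons x w ih =>
    simp only [splitSum_cons, splitSum_nil, splitSum_add, ih]
    abel

/-- The summand may also depend on the joined piece `a = c ++ d`; signs do so through the length of
`a`. -/
theorem splitSum_assoc' (w : List V) (G : List V → List V → List V → List V → M) :
    (splitSum w fun a b => splitSum a fun c d => G a c d b) =
      splitSum w fun c e => splitSum e fun d b => G (c ++ d) c d b := by
  rw [← splitSum_assoc w fun c d b => G (c ++ d) c d b]
  exact splitSum_congr fun a b _ => splitSum_congr fun c d h => by rw [h]

/-- The cut falls either before or after the marked entry `x`. Applied to an inserted value, this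
produces the case distinctions in all composition formulas below. -/
theorem splitSum_append_cons (a c : List V) (x : V) (F : List V → List V → M) :
    splitSum (a ++ x :: c) F = (splitSum a fun a₁ a₂ => F a₁ (a₂ ++ x :: c)) +
      splitSum c fun c₁ c₂ => F (a ++ x :: c₁) c₂ := by
  induction a generalizing F with
  | nil => simp [splitSum_cons]
  | cons y a ih => simp [splitSum_cons, ih, add_assoc]

/-- A splitting of the first piece is moved to the front, which brings nested sums to the normal
form of successive splittings. The two following lemmas do the same at greater depth. -/
theorem splitSum_refine₃ (w : List V) (G : List V → List V → List V → List V → List V → M) :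
    (splitSum w fun a r => splitSum r fun b c => splitSum a fun x y => G a x y b c) =
      splitSum w fun x e => splitSum e fun y r => splitSum r fun b c => G (x ++ y) x y b c :=
  (splitSum_congr fun _ _ _ => splitSum_comm _ _ _).trans
    (splitSum_assoc' w fun a x y r => splitSum r fun b c => G a x y b c)

theorem splitSum_refine₄ (w : List V)
    (G : List V → List V → List V → List V → List V → List V → M) :
    (splitSum w fun a r => splitSum r fun b r => splitSum r fun c d =>
      splitSum a fun x y => G a x y b c d) =
      splitSum w fun x r => splitSum r fun y r => splitSum r fun b r => splitSum r fun c d =>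
        G (x ++ y) x y b c d := by
  refine (splitSum_congr fun a r _ => ?_).trans (splitSum_assoc' w fun a x y r =>
    splitSum r fun b r => splitSum r fun c d => G a x y b c d)
  exact (splitSum_congr fun c r _ => splitSum_comm _ _ _).trans (splitSum_comm _ _ _)

theorem splitSum_refine₅ (w : List V)
    (G : List V → List V → List V → List V → List V → List V → List V → M) :
    (splitSum w fun a r => splitSum r fun b r => splitSum r fun c r => splitSum r fun d e =>
      splitSum a fun x y => G a x y b c d e) =
      splitSum w fun x r => splitSum r fun y r => splitSum r fun b r => splitSum r fun c r =>
        splitSum r fun d e => G (x ++ y) x y b c d e := by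
  refine (splitSum_congr fun a r _ => ?_).trans (splitSum_assoc' w fun a x y r =>
    splitSum r fun b r => splitSum r fun c r => splitSum r fun d e => G a x y b c d e)
  refine (splitSum_congr fun b r _ => ?_).trans (splitSum_comm _ _ _)
  exact (splitSum_congr fun c r _ => splitSum_comm _ _ _).trans (splitSum_comm _ _ _)

end SplitSum

/-! ### Compositions and braces of multiadditive functions. -/

section Braces

variable {V M : Type*} [AddCommGroup V] [AddCommGroup M]

/-- A function on lists is additive in every entry. -/
def MultiAdd (f : List V → M) : Prop :=
  ∀ a c x y, f (a ++ (x + y) :: c) = f (a ++ x :: c) + f (a ++ y :: c)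

/-- The additive map `x ↦ f (a ++ x :: c)`. -/
def MultiAdd.hom {f : List V → M} (hf : MultiAdd f) (a c : List V) : V →+ M :=
  AddMonoidHom.mk' (fun x => f (a ++ x :: c)) (hf a c)

theorem MultiAdd.map_zero {f : List V → M} (hf : MultiAdd f) (a c : List V) :
    f (a ++ 0 :: c) = 0 := (hf.hom a c).map_zero

theorem MultiAdd.map_smul {f : List V → M} (hf : MultiAdd f) (a c : List V) (n : ℤ) (x : V) :
    f (a ++ (n • x) :: c) = n • f (a ++ x :: c) := (hf.hom a c).map_zsmul n x

theorem MultiAdd.map_splitSum {f : List V → M} (hf : MultiAdd f) (a c w : List V)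
    (G : List V → List V → V) :
    f (a ++ splitSum w G :: c) = splitSum w fun x y => f (a ++ G x y :: c) :=
  _root_.map_splitSum (hf.hom a c) w G

theorem MultiAdd.tail {f : List V → M} (hf : MultiAdd f) (a : List V) (z : V) :
    MultiAdd fun l => f (a ++ z :: l) := by
  intro b c x y
  simpa using hf (a ++ z :: b) c x y

/-- `f` is homogeneous of degree `d`, that is, it vanishes on the lists of length `≠ d + 1`. -/
def Homog (d : ℤ) (f : List V → M) : Prop := ∀ w, (w.length : ℤ) ≠ d + 1 → f w = 0

/-- The composition `∑ θ(|a|) f(a, g(b), c)` over all splittings of the argument into `a, b, c`. -/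
def wcirc (θ : ℕ → ℤ) (f : List V → M) (g : List V → V) (w : List V) : M :=
  splitSum w fun a r => splitSum r fun b c => θ a.length • f (a ++ g b :: c)

/-- Gerstenhaber's composition `f ∘ g` with `g` of degree `d`. -/
def gcirc (f : List V → M) (d : ℤ) (g : List V → V) : List V → M :=
  wcirc (fun n => sgn (d * n)) f g


theorem gcirc_apply {V M : Type*} [AddCommGroup M] (f : List V → M) (d : ℤ) (g : List V → V) (w : List V) :
    gcirc f d g w =
      splitSum w fun a r => splitSum r fun b c => sgn (d * a.length) • f (a ++ g b :: c) := rfl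

/-- The brace `f{g, h}` with `g` of degree `d` and `h` of degree `e`. -/
def brace₂ (f : List V → M) (d : ℤ) (g : List V → V) (e : ℤ) (h : List V → V) (w : List V) : M :=
  splitSum w fun a r => splitSum r fun b r => splitSum r fun a' r => splitSum r fun b' c =>
    sgn (d * a.length + e * (a.length + b.length + a'.length)) •
      f (a ++ g b :: (a' ++ h b' :: c))

/-- The brace `f{g, h, k}` with `g`, `h`, `k` of degrees `d`, `e`, `m`. -/
def brace₃ (f : List V → M) (d : ℤ) (g : List V → V) (e : ℤ) (h : List V → V)
    (m : ℤ) (k : List V → V) (w : List V) : M :=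
  splitSum w fun a r => splitSum r fun b r => splitSum r fun a' r => splitSum r fun b' r =>
    splitSum r fun a'' r => splitSum r fun b'' c =>
      sgn (d * a.length + e * (a.length + b.length + a'.length) +
        m * (a.length + b.length + a'.length + b'.length + a''.length)) •
      f (a ++ g b :: (a' ++ h b' :: (a'' ++ k b'' :: c)))

/-- Exchange of signs inside a value of a multiadditive function which involves `h b`. -/
theorem sgn_smul_congr {e : ℤ} {h : List V → V} (hh : Homog e h) {b : List V}
    {F : V → M} (hF : F 0 = 0) {m n : ℤ}
    (hmn : (b.length : ℤ) = e + 1 → Even (m - n)) :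
    sgn m • F (h b) = sgn n • F (h b) := by
  by_cases hb : (b.length : ℤ) = e + 1
  · rw [sgn_congr (hmn hb)]
  · rw [hh b hb, hF, smul_zero, smul_zero]

/-- The value of `h` lands among the arguments of `g`, to the right of `g`, or to its left. -/
theorem gcirc_gcirc {f : List V → M} (hf : MultiAdd f) (d : ℤ) (g : List V → V)
    {e : ℤ} {h : List V → V} (hh : Homog e h) (w : List V) :
    gcirc (gcirc f d g) e h w = gcirc f (d + e) (gcirc g e h) w + brace₂ f d g e h w +
      sgn (d * e) • brace₂ f e h d g w := by
  simp only [gcirc_apply, brace₂, hf.map_splitSum, hf.map_smul, smul_splitSum, smul_smul, ← sgn_add,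
    splitSum_append_cons, splitSum_add, smul_add, splitSum_assoc', splitSum_refine₃,
    List.append_assoc, List.cons_append, List.length_append, List.length_cons, Nat.cast_add,
    Nat.cast_one]
  rw [add_comm (splitSum w _) (splitSum w _)]
  congr 1
  congr 1
  · refine splitSum_congr fun _ _ _ => splitSum_congr fun _ _ _ => splitSum_congr fun _ _ _ =>
      splitSum_congr fun _ _ _ => ?_
    congr 2; ring
  · refine splitSum_congr fun _ _ _ => splitSum_congr fun _ _ _ => splitSum_congr fun _ _ _ =>
      splitSum_congr fun _ _ _ => ?_
    congr 2; ring
  · refine splitSum_congr fun a _ _ => splitSum_congr fun b _ _ => splitSum_congr fun a' _ _ =>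
      splitSum_congr fun b' c _ => ?_
    -- The value `h b` counts as one entry in the iterated composition and as `e + 1` entries in the
    -- brace; the difference gives the sign `(-1)^{de}`.
    refine sgn_smul_congr hh (F := fun z => f (a ++ z :: (a' ++ g b' :: c))) (hf.map_zero _ _)
      fun hb => ?_
    exact ⟨-(d * e), by rw [hb]; ring⟩

/-- Exchange of signs inside a value of a multiadditive function which involves `h b`, `k c`. -/
theorem sgn_smul_congr₂ {d e : ℤ} {h k : List V → V} (hh : Homog d h) (hk : Homog e k)
    {b c : List V} {F : V → V → M} (hF : ∀ z, F 0 z = 0) (hF' : ∀ z, F z 0 = 0) {m n : ℤ}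
    (hmn : (b.length : ℤ) = d + 1 → (c.length : ℤ) = e + 1 → Even (m - n)) :
    sgn m • F (h b) (k c) = sgn n • F (h b) (k c) := by
  by_cases hb : (b.length : ℤ) = d + 1
  · exact sgn_smul_congr hk (F := F (h b)) (hF' _) (hmn hb)
  · rw [hh b hb, hF, smul_zero, smul_zero]

/-- The five terms are the positions of `k`: to the right of `h`, inside `h`, between `g` and `h`,
inside `g`, to the left of `g`. -/
theorem gcirc_brace₂ {f : List V → M} (hf : MultiAdd f) (d : ℤ) {g : List V → V}
    (hg : MultiAdd g) (e : ℤ) (h : List V → V) {m : ℤ} {k : List V → V} (hk : Homog m k) :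
    gcirc (brace₂ f d g e h) m k =
      brace₃ f d g e h m k +
      brace₂ f d g (e + m) (gcirc h m k) +
      sgn (m * e) • brace₃ f d g m k e h +
      sgn (m * e) • brace₂ f (d + m) (gcirc g m k) e h +
      sgn (m * (d + e)) • brace₃ f m k d g e h := by
  funext w
  simp only [Pi.add_apply, Pi.smul_apply, gcirc_apply, brace₂, brace₃, hf.map_splitSum, hf.map_smul,
    (hf.tail _ _).map_splitSum, (hf.tail _ _).map_smul, smul_splitSum,
    smul_smul, ← sgn_add, splitSum_append_cons, splitSum_add, smul_add, splitSum_assoc',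
    splitSum_refine₃, splitSum_refine₄, List.append_assoc, List.cons_append,
    List.length_append, List.length_cons, Nat.cast_add, Nat.cast_one]
  refine congr_arg₂ _ (congr_arg₂ _ (congr_arg₂ _ (congr_arg₂ _ ?_ ?_) ?_) ?_) ?_
  · refine splitSum_congr fun _ _ _ => splitSum_congr fun _ _ _ => splitSum_congr fun _ _ _ => splitSum_congr fun _ _ _ => splitSum_congr fun _ _ _ =>
      splitSum_congr fun _ _ _ => ?_
    exact congrArg (fun s => sgn s • _) (by ring)
  · refine splitSum_congr fun _ _ _ => splitSum_congr fun _ _ _ => splitSum_congr fun _ _ _ => splitSum_congr fun _ _ _ => splitSum_congr fun _ _ _ =>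
      splitSum_congr fun _ _ _ => ?_
    exact congrArg (fun s => sgn s • _) (by ring)
  · refine splitSum_congr fun x _ _ => splitSum_congr fun y _ _ => splitSum_congr fun u _ _ => splitSum_congr fun v _ _ => splitSum_congr fun a _ _ =>
      splitSum_congr fun b c _ => ?_
    refine sgn_smul_congr hk (b := v) (F := fun z => f (x ++ g y :: (u ++ z :: (a ++ h b :: c))))
      ((hf.tail x (g y)).map_zero u _) fun hb => ?_
    exact ⟨-(m * e), by rw [hb]; ring⟩
  · refine splitSum_congr fun x _ _ => splitSum_congr fun y _ _ => splitSum_congr fun u _ _ => splitSum_congr fun v _ _ => splitSum_congr fun a _ _ =>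
      splitSum_congr fun b c _ => ?_
    refine sgn_smul_congr hk (b := u) (F := fun z => f (x ++ g (y ++ z :: v) :: (a ++ h b :: c)))
      (by simp only [hg.map_zero, hf.map_zero]) fun hb => ?_
    exact ⟨-(m * e), by rw [hb]; ring⟩
  · refine splitSum_congr fun x _ _ => splitSum_congr fun y _ _ => splitSum_congr fun u _ _ => splitSum_congr fun v _ _ => splitSum_congr fun a _ _ =>
      splitSum_congr fun b c _ => ?_
    refine sgn_smul_congr hk (b := y) (F := fun z => f (x ++ z :: (u ++ g v :: (a ++ h b :: c))))
      (hf.map_zero x _) fun hb => ?_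
    exact ⟨-(m * (d + e)), by rw [hb]; ring⟩

/-- Each of `h` and `k` is to the right of `g`, inside it, or to its left, and `h` precedes `k`.
This leaves six cases. -/
theorem brace₂_gcirc {f : List V → M} (hf : MultiAdd f) (d : ℤ) (g : List V → V)
    {e : ℤ} {h : List V → V} (hh : Homog e h) {m : ℤ} {k : List V → V} (hk : Homog m k) :
    brace₂ (gcirc f d g) e h m k =
      brace₃ f d g e h m k +
      (brace₂ f (d + e) (gcirc g e h) m k +
        gcirc f (d + e + m) (brace₂ g e h m k)) +
      (sgn (d * e) • brace₃ f e h d g m k +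
        sgn (d * e) • brace₂ f e h (d + m) (gcirc g m k) +
      sgn (d * (e + m)) • brace₃ f e h m k d g) := by
  funext w
  simp only [Pi.add_apply, Pi.smul_apply, gcirc_apply, brace₂, brace₃, hf.map_splitSum, hf.map_smul,
    (hf.tail _ _).map_splitSum, (hf.tail _ _).map_smul, smul_splitSum,
    smul_smul, ← sgn_add, splitSum_append_cons, splitSum_add, smul_add, splitSum_assoc',
    splitSum_refine₃, splitSum_refine₄, splitSum_refine₅, List.append_assoc, List.cons_append,
    List.length_append, List.length_cons, Nat.cast_add, Nat.cast_one]
  refine congr_arg₂ _ (congr_arg₂ _ ?_ (congr_arg₂ _ ?_ ?_))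
    (congr_arg₂ _ (congr_arg₂ _ ?_ ?_) ?_)
  · refine splitSum_congr fun _ _ _ => splitSum_congr fun _ _ _ => splitSum_congr fun _ _ _ => splitSum_congr fun _ _ _ => splitSum_congr fun _ _ _ =>
      splitSum_congr fun _ _ _ => ?_
    exact congrArg (fun s => sgn s • _) (by ring)
  · refine splitSum_congr fun _ _ _ => splitSum_congr fun _ _ _ => splitSum_congr fun _ _ _ => splitSum_congr fun _ _ _ => splitSum_congr fun _ _ _ =>
      splitSum_congr fun _ _ _ => ?_
    exact congrArg (fun s => sgn s • _) (by ring)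
  · refine splitSum_congr fun _ _ _ => splitSum_congr fun _ _ _ => splitSum_congr fun _ _ _ => splitSum_congr fun _ _ _ => splitSum_congr fun _ _ _ =>
      splitSum_congr fun _ _ _ => ?_
    exact congrArg (fun s => sgn s • _) (by ring)
  · refine splitSum_congr fun x _ _ => splitSum_congr fun y _ _ => splitSum_congr fun u _ _ => splitSum_congr fun v _ _ => splitSum_congr fun a _ _ =>
      splitSum_congr fun b c _ => ?_
    refine sgn_smul_congr hh (b := y) (F := fun z => f (x ++ z :: (u ++ g v :: (a ++ k b :: c))))
      (hf.map_zero x _) fun hb => ?_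
    exact ⟨-(d * e), by rw [hb]; ring⟩
  · refine splitSum_congr fun x _ _ => splitSum_congr fun y _ _ => splitSum_congr fun u _ _ => splitSum_congr fun v _ _ => splitSum_congr fun a _ _ =>
      splitSum_congr fun b c _ => ?_
    refine sgn_smul_congr hh (b := y) (F := fun z => f (x ++ z :: (u ++ g (v ++ k a :: b) :: c)))
      (hf.map_zero x _) fun hb => ?_
    exact ⟨-(d * e), by rw [hb]; ring⟩
  · refine splitSum_congr fun x _ _ => splitSum_congr fun y _ _ => splitSum_congr fun u _ _ => splitSum_congr fun v _ _ => splitSum_congr fun a _ _ =>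
      splitSum_congr fun b c _ => ?_
    refine sgn_smul_congr₂ hh hk (b := y) (c := v)
      (F := fun z z' => f (x ++ z :: (u ++ z' :: (a ++ g b :: c))))
      (fun _ => hf.map_zero x _) (fun z => (hf.tail x z).map_zero u _) fun hb hc => ?_
    exact ⟨-(d * (e + m)), by rw [hb, hc]; ring⟩

end Braces

theorem sgn_eq_or (a : ℤ) : sgn a = 1 ∨ sgn a = -1 := by
  rw [sgn_eq_ite]; split_ifs <;> simp

theorem sgn_mul_self' (a : ℤ) : sgn (a * a) = sgn a :=
  sgn_congr (by simp only [Int.even_sub, Int.even_mul]; tauto)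

/-! ### Bilinearity, the pre-Lie identity and the graded Lie bracket. -/

section BraceLinear

variable {V M : Type*} [AddCommGroup V] [AddCommGroup M]

theorem Homog.add {d : ℤ} {f g : List V → M} (hf : Homog d f) (hg : Homog d g) :
    Homog d (f + g) := fun w hw => by simp [hf w hw, hg w hw]

theorem Homog.zsmul {d : ℤ} {f : List V → M} (hf : Homog d f) (n : ℤ) :
    Homog d (n • f) := fun w hw => by simp [hf w hw]

theorem Homog.eq_zero {d : ℤ} {f : List V → M} (hf : Homog d f) (hd : d + 1 < 0) : f = 0 := by
  funext w
  exact hf w (by omega)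

theorem gcirc_add_left (f f' : List V → M) (d : ℤ) (g : List V → V) :
    gcirc (f + f') d g = gcirc f d g + gcirc f' d g := by
  funext w
  simp [gcirc_apply, splitSum_add]

theorem gcirc_smul_left (n : ℤ) (f : List V → M) (d : ℤ) (g : List V → V) :
    gcirc (n • f) d g = n • gcirc f d g := by
  funext w
  simp only [gcirc_apply, Pi.smul_apply, smul_splitSum, smul_comm n]

theorem gcirc_sub_left (f f' : List V → M) (d : ℤ) (g : List V → V) :
    gcirc (f - f') d g = gcirc f d g - gcirc f' d g := by
  have := gcirc_add_left f ((-1 : ℤ) • f') d g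
  rw [gcirc_smul_left] at this
  simpa [sub_eq_add_neg] using this

theorem gcirc_zero_left (d : ℤ) (g : List V → V) : gcirc (0 : List V → M) d g = 0 := by
  funext w
  simp [gcirc_apply]

theorem gcirc_add_right {f : List V → M} (hf : MultiAdd f) (d : ℤ) (g g' : List V → V) :
    gcirc f d (g + g') = gcirc f d g + gcirc f d g' := by
  funext w
  simp [gcirc_apply, splitSum_add, hf _ _ _ _]

theorem gcirc_smul_right {f : List V → M} (hf : MultiAdd f) (d : ℤ) (n : ℤ) (g : List V → V) :
    gcirc f d (n • g) = n • gcirc f d g := by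
  funext w
  simp only [gcirc_apply, Pi.smul_apply, smul_splitSum, hf.map_smul, smul_comm n]

theorem gcirc_sub_right {f : List V → M} (hf : MultiAdd f) (d : ℤ) (g g' : List V → V) :
    gcirc f d (g - g') = gcirc f d g - gcirc f d g' := by
  have := gcirc_add_right hf d g ((-1 : ℤ) • g')
  rw [gcirc_smul_right hf] at this
  simpa [sub_eq_add_neg] using this

theorem gcirc_zero_right {f : List V → M} (hf : MultiAdd f) (d : ℤ) : gcirc f d 0 = 0 := by
  simpa using gcirc_smul_right hf d 0 0

theorem Homog.wcirc (θ : ℕ → ℤ) {f : List V → M} (hf : MultiAdd f) {d e : ℤ} (hfd : Homog d f)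
    {g : List V → V} (hg : Homog e g) : Homog (d + e) (wcirc θ f g) := by
  intro w hw
  refine splitSum_eq_zero fun a r h => splitSum_eq_zero fun b c h' => ?_
  subst h'; subst h
  by_cases hb : (b.length : ℤ) = e + 1
  · rw [hfd, smul_zero]
    simp at hw ⊢
    omega
  · rw [hg b hb, hf.map_zero, smul_zero]

/-- The bracket `{f, g}` of elements of degrees `d` and `e`. -/
def gbr (d : ℤ) (f : List V → V) (e : ℤ) (g : List V → V) : List V → V :=
  sgn (d * e) • gcirc f e g - gcirc g d f

theorem gbr_antisymm (d : ℤ) (f : List V → V) (e : ℤ) (g : List V → V) :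
    gbr d f e g = -(sgn (d * e) • gbr e g d f) := by
  rw [gbr, gbr, smul_sub, smul_smul, mul_comm e d, sgn_mul_self, one_smul]
  abel

theorem gbr_self {d : ℤ} (hd : Even d) (f : List V → V) : gbr d f d f = 0 := by
  rw [gbr, sgn_mul_self', sgn_eq_ite, if_pos hd, one_smul, sub_self]

/-- The pre-Lie identity. -/
theorem gcirc_gcirc' {f : List V → M} (hf : MultiAdd f) {d : ℤ} {g : List V → V}
    (hg : Homog d g) {e : ℤ} {h : List V → V} (hh : Homog e h) :
    gcirc (gcirc f d g) e h - gcirc f (d + e) (gcirc g e h) =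
      sgn (d * e) • (gcirc (gcirc f e h) d g - gcirc f (d + e) (gcirc h d g)) := by
  funext w
  simp only [Pi.sub_apply, Pi.smul_apply]
  -- Both associators consist of `f{g, h}` and `f{h, g}` only, and these are exchanged with the sign
  -- `(-1)^{de}`.
  rw [gcirc_gcirc hf d g hh, gcirc_gcirc hf e h hg, mul_comm e d, add_comm e d]
  rcases sgn_eq_or (d * e) with h1 | h1 <;> rw [h1] <;> simp <;> abel

/-- The twelve double compositions cancel by the pre-Lie identity, used once with each of `f`, `g`,
`h` as the outer function. The rest is a check of signs. -/
theorem gbr_jacobi {d e m : ℤ} {f g h : List V → V} (hf : MultiAdd f) (hg : MultiAdd g)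
    (hh : MultiAdd h) (hfd : Homog d f) (hge : Homog e g) (hhm : Homog m h) :
    gbr d f (e + m) (gbr e g m h) = gbr (d + e) (gbr d f e g) m h +
      sgn (d * e) • gbr e g (d + m) (gbr d f m h) := by
  have h1 := gcirc_gcirc' hf hge hhm
  have h2 := gcirc_gcirc' hg hfd hhm
  have h3 := gcirc_gcirc' hh hfd hge
  rw [sub_eq_iff_eq_add] at h1 h2 h3
  simp only [gbr, gcirc_sub_left, gcirc_sub_right hf, gcirc_sub_right hg, gcirc_sub_right hh,
    gcirc_smul_left, gcirc_smul_right hf, gcirc_smul_right hg, gcirc_smul_right hh, h1, h2, h3,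
    mul_add, add_mul, sgn_add, mul_comm e d]
  rcases sgn_eq_or (d * e) with h4 | h4 <;> rcases sgn_eq_or (d * m) with h5 | h5 <;>
  rcases sgn_eq_or (e * m) with h6 | h6 <;> simp only [h4, h5, h6] <;> simp <;> abel

/-- For odd `d` the pre-Lie identity with three equal entries gives `2 (f ∘ f) ∘ f = 2 f ∘ (f ∘ f)`.
The double bracket is exactly the difference of these two sides, so no division by `3` occurs. -/
theorem gbr_gbr_self {d : ℤ} (hd : Odd d) {f : List V → V} (hf : MultiAdd f) (hfd : Homog d f) :
    gbr d f (d + d) (gbr d f d f) = 0 := by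
  have h1 := gcirc_gcirc' hf hfd hfd
  have h2 : sgn d = -1 := by rw [sgn_eq_ite, if_neg (Int.not_even_iff_odd.mpr hd)]
  rw [sgn_mul_self', h2, sub_eq_iff_eq_add] at h1
  simp only [gbr, gcirc_sub_left, gcirc_sub_right hf, gcirc_smul_left, gcirc_smul_right hf,
    sgn_mul_self', h2, mul_add, sgn_add]
  generalize gcirc (gcirc f d f) d f = X at h1 ⊢
  generalize gcirc f (d + d) (gcirc f d f) = Y at h1 ⊢
  have h3 : X + X = Y + Y := by
    nth_rewrite 1 [h1]
    simp only [neg_smul, one_smul]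
    abel
  simp only [neg_smul, one_smul, mul_neg, mul_one, neg_neg]
  rw [← sub_eq_zero] at h3
  rw [← h3]
  abel

theorem brace₂_add_left (f f' : List V → M) (d : ℤ) (g : List V → V) (e : ℤ) (h : List V → V) :
    brace₂ (f + f') d g e h = brace₂ f d g e h + brace₂ f' d g e h := by
  funext w
  simp [brace₂, splitSum_add]

theorem brace₂_smul_left (n : ℤ) (f : List V → M) (d : ℤ) (g : List V → V) (e : ℤ)
    (h : List V → V) : brace₂ (n • f) d g e h = n • brace₂ f d g e h := by
  funext w
  simp only [brace₂, Pi.smul_apply, smul_splitSum, smul_comm n]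

theorem brace₂_smul_mid {f : List V → M} (hf : MultiAdd f) (d n : ℤ) (g : List V → V) (e : ℤ)
    (h : List V → V) : brace₂ f d (n • g) e h = n • brace₂ f d g e h := by
  funext w
  simp only [brace₂, Pi.smul_apply, smul_splitSum, hf.map_smul, smul_comm n]

theorem brace₂_smul_right {f : List V → M} (hf : MultiAdd f) (d : ℤ) (g : List V → V) (e n : ℤ)
    (h : List V → V) : brace₂ f d g e (n • h) = n • brace₂ f d g e h := by
  funext w
  simp only [brace₂, Pi.smul_apply, smul_splitSum, (hf.tail _ _).map_smul, smul_comm n]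

end BraceLinear

/-! ### The Hochschild complex of a ring, with its homotopies. -/

section Hochschild

variable {R : Type*} [Ring R]

/-- The cup product of two functions on lists. -/
def lcup (f g : List R → R) (w : List R) : R := splitSum w fun a b => f a * g b

/-- The identity, as a function on lists of length one. -/
def lid : List R → R
  | [x] => x
  | _ => 0

/-- The multiplication, as a function on lists of length two. -/
def lmul : List R → R := lcup lid lid

theorem multiAdd_lid : MultiAdd (lid : List R → R) := by
  intro a c x y
  rcases a with _ | ⟨a0, _ | ⟨a1, a⟩⟩ <;> rcases c with _ | ⟨c0, c⟩ <;> simp [lid]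

theorem homog_lid : Homog 0 (lid : List R → R) := by
  intro w hw
  rcases w with _ | ⟨a0, _ | ⟨a1, a⟩⟩ <;> simp [lid] at hw ⊢

theorem MultiAdd.lcup {f g : List R → R} (hf : MultiAdd f) (hg : MultiAdd g) :
    MultiAdd (lcup f g) := by
  intro a c x y
  simp only [_root_.lcup, splitSum_append_cons, hf _ _ _ _, hg _ _ _ _, mul_add, add_mul,
    splitSum_add]
  abel

theorem Homog.lcup {d e : ℤ} {f g : List R → R} (hf : Homog d f) (hg : Homog e g) :
    Homog (d + e + 1) (lcup f g) := by
  intro w hw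
  refine splitSum_eq_zero fun a b h => ?_
  subst h
  by_cases ha : (a.length : ℤ) = d + 1
  · rw [hg b (by simp at hw; omega), mul_zero]
  · rw [hf a ha, zero_mul]

theorem multiAdd_lmul : MultiAdd (lmul : List R → R) := multiAdd_lid.lcup multiAdd_lid

theorem homog_lmul : Homog 1 (lmul : List R → R) := homog_lid.lcup homog_lid

theorem lcup_assoc (f g h : List R → R) : lcup (lcup f g) h = lcup f (lcup g h) := by
  funext w
  have h1 : ∀ (r : R) (v : List R) (F : List R → List R → R),
      r * splitSum v F = splitSum v fun a b => r * F a b :=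
    fun r v F => map_splitSum (AddMonoidHom.mulLeft r) v F
  have h2 : ∀ (r : R) (v : List R) (F : List R → List R → R),
      splitSum v F * r = splitSum v fun a b => F a b * r :=
    fun r v F => map_splitSum (AddMonoidHom.mulRight r) v F
  simp only [lcup, h1, h2, splitSum_assoc', mul_assoc]

theorem lcup_add_left (f f' g : List R → R) : lcup (f + f') g = lcup f g + lcup f' g := by
  funext w
  simp [lcup, add_mul, splitSum_add]

theorem lcup_add_right (f g g' : List R → R) : lcup f (g + g') = lcup f g + lcup f g' := by
  funext w
  simp [lcup, mul_add, splitSum_add]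

theorem lcup_smul_left (n : ℤ) (f g : List R → R) : lcup (n • f) g = n • lcup f g := by
  funext w
  simp only [lcup, Pi.smul_apply, smul_splitSum, smul_mul_assoc]

theorem lcup_smul_right (n : ℤ) (f g : List R → R) : lcup f (n • g) = n • lcup f g := by
  funext w
  simp only [lcup, Pi.smul_apply, smul_splitSum, mul_smul_comm]

theorem lcup_sub_left (f f' g : List R → R) : lcup (f - f') g = lcup f g - lcup f' g := by
  have := lcup_add_left f ((-1 : ℤ) • f') g
  rw [lcup_smul_left] at this
  simpa [sub_eq_add_neg] using this

theorem lcup_sub_right (f g g' : List R → R) : lcup f (g - g') = lcup f g - lcup f g' := by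
  have := lcup_add_right f g ((-1 : ℤ) • g')
  rw [lcup_smul_right] at this
  simpa [sub_eq_add_neg] using this

theorem lcup_zero_left (g : List R → R) : lcup 0 g = 0 := by
  funext w
  simp [lcup]

theorem lcup_zero_right (g : List R → R) : lcup g 0 = 0 := by
  funext w
  simp [lcup]

/-- Exchange of signs in front of a product. -/
theorem sgn_smul_mul_congr {d : ℤ} {f : List R → R} (hf : Homog d f) {a : List R} (r : R)
    {m n : ℤ} (hmn : (a.length : ℤ) = d + 1 → Even (m - n)) :
    sgn m • (f a * r) = sgn n • (f a * r) := by
  by_cases ha : (a.length : ℤ) = d + 1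
  · rw [sgn_congr (hmn ha)]
  · rw [hf a ha, zero_mul, smul_zero, smul_zero]

theorem mul_splitSum {V : Type*} (r : R) (v : List V) (F : List V → List V → R) :
    r * splitSum v F = splitSum v fun a b => r * F a b :=
  map_splitSum (AddMonoidHom.mulLeft r) v F

theorem splitSum_mul {V : Type*} (v : List V) (F : List V → List V → R) (r : R) :
    splitSum v F * r = splitSum v fun a b => F a b * r :=
  map_splitSum (AddMonoidHom.mulRight r) v F

/-- The inserted value lies in one of the two factors. Thus `· ∘ h` is strictly a graded derivation
of the cup product; for `c ∘ ·` this holds only up to the homotopy of `hdelta_brace₂`. -/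
theorem gcirc_lcup {d : ℤ} {f : List R → R} (hf : Homog d f) (g : List R → R) (e : ℤ)
    (h : List R → R) :
    gcirc (lcup f g) e h =
      sgn (e * (d + 1)) • lcup f (gcirc g e h) + lcup (gcirc f e h) g := by
  funext w
  simp only [Pi.add_apply, Pi.smul_apply, gcirc_apply, lcup, mul_splitSum, splitSum_mul,
    smul_splitSum, smul_smul, ← sgn_add, splitSum_append_cons, splitSum_add, smul_add,
    splitSum_assoc', splitSum_refine₃, List.append_assoc, List.cons_append,
    List.length_append, List.length_cons, Nat.cast_add, Nat.cast_one, smul_mul_assoc,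
    mul_smul_comm]
  congr 1
  refine splitSum_congr fun a _ _ => splitSum_congr fun b _ _ => splitSum_congr fun a' _ _ => ?_
  refine sgn_smul_mul_congr hf _ fun ha => ?_
  rw [ha]
  exact ⟨0, by ring⟩

/-- Both values lie in the second factor, one lies in each, or both lie in the first. -/
theorem brace₂_lcup {d : ℤ} {f : List R → R} (hfa : MultiAdd f) (hf : Homog d f) (g : List R → R)
    {e : ℤ} {h : List R → R} (hh : Homog e h) (m : ℤ) (k : List R → R) :
    brace₂ (lcup f g) e h m k =
      sgn ((e + m) * (d + 1)) • lcup f (brace₂ g e h m k) +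
      sgn (m * (d + 1 + e)) • lcup (gcirc f e h) (gcirc g m k) +
      lcup (brace₂ f e h m k) g := by
  funext w
  simp only [Pi.add_apply, Pi.smul_apply, gcirc_apply, brace₂, lcup, mul_splitSum, splitSum_mul,
    smul_splitSum, smul_smul, ← sgn_add, splitSum_append_cons, splitSum_add, smul_add,
    splitSum_assoc', splitSum_refine₃, splitSum_refine₄, splitSum_refine₅, List.append_assoc, List.cons_append,
    List.length_append, List.length_cons, Nat.cast_add, Nat.cast_one, smul_mul_assoc,
    mul_smul_comm]
  rw [← add_assoc]
  refine congr_arg₂ _ (congr_arg₂ _ ?_ ?_) rfl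
  · refine splitSum_congr fun a _ _ => splitSum_congr fun b _ _ => splitSum_congr fun a' _ _ =>
      splitSum_congr fun b' _ _ => splitSum_congr fun b'' c _ => ?_
    refine sgn_smul_mul_congr hf _ fun ha => ?_
    rw [ha]
    exact ⟨0, by ring⟩
  · refine splitSum_congr fun a _ _ => splitSum_congr fun b _ _ => splitSum_congr fun a' _ _ =>
      splitSum_congr fun b' _ _ => splitSum_congr fun b'' c _ => ?_
    by_cases ha : ((a ++ h b :: a').length : ℤ) = d + 1
    · refine sgn_smul_congr hh (b := b) (F := fun z => f (a ++ z :: a') * g (b' ++ k b'' :: c))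
        (by simp only [hfa.map_zero, zero_mul]) fun hb => ?_
      simp only [List.length_append, List.length_cons, Nat.cast_add, Nat.cast_one] at ha
      rw [hb, ← ha]
      exact ⟨0, by ring⟩
    · rw [hf _ ha, zero_mul, smul_zero, smul_zero]

theorem splitSum_lid (h : List R → R) (w : List R) :
    (splitSum w fun b c => lid (h b :: c)) = h w := by
  induction w generalizing h with
  | nil => rfl
  | cons x w ih =>
    rw [splitSum_cons, ih fun b => h (x :: b), homog_lid (h [] :: x :: w) (by simp; omega), zero_add]

theorem gcirc_lid (d : ℤ) (h : List R → R) : gcirc lid d h = h := by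
  funext w
  rw [gcirc_apply]
  cases w with
  | nil => simp [lid, sgn_zero]
  | cons x w =>
    rw [splitSum_cons, splitSum_eq_zero (w := w), add_zero]
    · simpa [sgn_zero] using splitSum_lid h (x :: w)
    · refine fun a b _ => splitSum_eq_zero fun b c _ => ?_
      rw [homog_lid, smul_zero]
      simp
      omega

theorem brace₂_lid (d e : ℤ) (g h : List R → R) : brace₂ lid d g e h = 0 := by
  funext w
  refine splitSum_eq_zero fun a _ _ => splitSum_eq_zero fun b _ _ => splitSum_eq_zero fun a' _ _ =>
    splitSum_eq_zero fun b' c _ => ?_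
  rw [homog_lid, smul_zero]
  simp
  omega

/-- The Hochschild coboundary of a function of degree `d`. -/
def hdelta (d : ℤ) (f : List R → R) : List R → R :=
  lcup lid f + sgn d • lcup f lid - gcirc f 1 lmul

theorem gcirc_lmul (d : ℤ) (f : List R → R) :
    gcirc lmul d f = lcup f lid + sgn d • lcup lid f := by
  rw [lmul, gcirc_lcup homog_lid, gcirc_lid, add_comm]
  simp

/-- With this form, the derivation property of the differential for the bracket (`hdelta_gbr`) is an
instance of the Jacobi identity. -/
theorem hdelta_eq_gbr (d : ℤ) (f : List R → R) : hdelta d f = gbr 1 lmul d f := by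
  rw [hdelta, gbr, gcirc_lmul, one_mul, smul_add, smul_smul, sgn_mul_self, one_smul,
    add_comm (lcup lid f)]

theorem gcirc_lmul_lmul : gcirc (lmul : List R → R) 1 lmul = 0 := by
  rw [gcirc_lmul, lmul, lcup_assoc, sgn_one]
  simp

/-- Associativity is `μ ∘ μ = 0`, and the two remaining terms `f{μ, μ}` cancel because `μ` has odd
degree. -/
theorem gcirc_one_lmul_lmul {f : List R → R} (hf : MultiAdd f) :
    gcirc (gcirc f 1 lmul) 1 lmul = 0 := by
  funext w
  rw [gcirc_gcirc hf 1 lmul homog_lmul, gcirc_lmul_lmul, gcirc_zero_right hf]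
  simp [sgn_one]

/-- Expanding directly avoids the division by `2` which a deduction from the Jacobi identity would
need. -/
theorem hdelta_hdelta {d : ℤ} {f : List R → R} (hf : MultiAdd f) (hfd : Homog d f) :
    hdelta (d + 1) (hdelta d f) = 0 := by
  have h0 := gcirc_one_lmul_lmul hf
  rw [lmul] at h0
  simp only [hdelta, gcirc_sub_left, gcirc_add_left, gcirc_smul_left,
    gcirc_lcup homog_lid, gcirc_lcup hfd, gcirc_lid, lcup_sub_left, lcup_sub_right, lcup_add_left,
    lcup_add_right, lcup_smul_left, lcup_smul_right, lcup_assoc, lmul, mul_add, sgn_add, one_mul,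
    sgn_one, sgn_zero, zero_add, h0]
  rcases sgn_eq_or d with h | h <;> simp only [h] <;> simp <;> abel

theorem hdelta_lcup {d e : ℤ} {f g : List R → R} (hf : Homog d f) :
    hdelta (d + e + 1) (lcup f g) =
      lcup (hdelta d f) g + sgn (d + 1) • lcup f (hdelta e g) := by
  simp only [hdelta, gcirc_lcup hf, lcup_sub_left, lcup_sub_right, lcup_add_left,
    lcup_add_right, lcup_smul_left, lcup_smul_right, lcup_assoc, mul_add, sgn_add, one_mul,
    sgn_one]
  rcases sgn_eq_or d with h | h <;> rcases sgn_eq_or e with h' | h' <;> simp only [h, h'] <;>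
    simp <;> abel

theorem hdelta_add (d : ℤ) (f g : List R → R) : hdelta d (f + g) = hdelta d f + hdelta d g := by
  simp only [hdelta, lcup_add_left, lcup_add_right, gcirc_add_left, smul_add]
  abel

theorem hdelta_smul (d n : ℤ) (f : List R → R) : hdelta d (n • f) = n • hdelta d f := by
  simp only [hdelta, lcup_smul_left, lcup_smul_right, gcirc_smul_left, smul_add, smul_sub,
    smul_comm n]

theorem hdelta_zero (d : ℤ) : hdelta d (0 : List R → R) = 0 := by
  simpa using hdelta_smul d 0 (0 : List R → R)

theorem hdelta_gbr {d e : ℤ} {f g : List R → R} (hf : MultiAdd f) (hg : MultiAdd g)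
    (hfd : Homog d f) (hge : Homog e g) :
    hdelta (d + e) (gbr d f e g) =
      gbr (d + 1) (hdelta d f) e g + sgn d • gbr d f (e + 1) (hdelta e g) := by
  simp only [hdelta_eq_gbr]
  rw [gbr_jacobi multiAdd_lmul hf hg homog_lmul hfd hge, one_mul, add_comm 1 d, add_comm 1 e]

/-- The compositions `(f ∘ g) ∘ μ` and `(f ∘ μ) ∘ g` share the braces `f{g, μ}` and `f{μ, g}`. What
is left inside `f`, namely `g ∘ μ` and `μ ∘ g`, assembles to the coboundary of `g`. -/
theorem gcirc_gcirc_lmul {e : ℤ} {f g : List R → R} (hf : MultiAdd f) (hge : Homog e g) :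
    gcirc (gcirc f e g) 1 lmul =
      sgn e • gcirc (gcirc f 1 lmul) e g - gcirc f (e + 1) (hdelta e g) := by
  funext w
  simp only [Pi.sub_apply, Pi.smul_apply]
  rw [gcirc_gcirc hf e g homog_lmul, gcirc_gcirc hf 1 lmul hge, gcirc_lmul]
  simp only [hdelta, gcirc_sub_right hf, gcirc_add_right hf, gcirc_smul_right hf, Pi.sub_apply,
    Pi.add_apply, Pi.smul_apply, one_mul, mul_one, add_comm 1 e]
  rcases sgn_eq_or e with h | h <;> simp only [h] <;> simp <;> abel

/-- The composition `f ∘ g` of cocycles is a homotopy for the graded commutativity of the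
cup product. -/
theorem hdelta_gcirc {d e : ℤ} {f g : List R → R} (hf : MultiAdd f) (hfd : Homog d f)
    (hge : Homog e g) (hdf : hdelta d f = 0) (hdg : hdelta e g = 0) :
    hdelta (d + e) (gcirc f e g) =
      -(sgn e • (lcup g f + sgn (d + e * (d + 1)) • lcup f g)) := by
  have h1 : gcirc f 1 lmul = lcup lid f + sgn d • lcup f lid := by
    rw [hdelta, sub_eq_zero] at hdf
    exact hdf.symm
  -- The cocycle condition has turned `f ∘ μ` into cup products with `lid`. As `lid ∘ g = g`,
  -- composing them with `g` creates the cup products of `f` and `g`.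
  rw [hdelta, gcirc_gcirc_lmul hf hge, hdg, h1, gcirc_zero_right hf]
  simp only [gcirc_add_left, gcirc_smul_left, gcirc_lcup homog_lid, gcirc_lcup hfd, gcirc_lid,
    mul_add, sgn_add, zero_add, mul_one]
  rcases sgn_eq_or d with h | h <;> rcases sgn_eq_or e with h' | h' <;>
    rcases sgn_eq_or (e * d) with h'' | h'' <;> simp only [h, h', h''] <;> simp <;> abel

/-- A cocycle commutes with `μ` up to sign. In this form, `a ∘ μ` can be exchanged for `μ ∘ a`
inside a brace. -/
theorem hdelta_eq_zero_iff (d : ℤ) (f : List R → R) :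
    hdelta d f = 0 ↔ gcirc f 1 lmul = sgn d • gcirc lmul d f := by
  rw [hdelta, sub_eq_zero, gcirc_lmul, smul_add, smul_smul, sgn_mul_self, one_smul,
    add_comm (sgn d • _), eq_comm]

/-- Each factor `lid` of `μ` has a single slot, so only the case with one value in each factor
survives. This exhibits the cup product as a brace of `μ`. -/
theorem brace₂_lmul {d : ℤ} {f : List R → R} (hf : Homog d f) (e : ℤ) (g : List R → R) :
    brace₂ lmul d f e g = sgn (e * (1 + d)) • lcup f g := by
  rw [lmul, brace₂_lcup multiAdd_lid homog_lid _ hf]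
  simp [brace₂_lid, lcup_zero_left, lcup_zero_right, gcirc_lid]

/-- The brace `c{a, b}` of cocycles is a homotopy for the Leibniz rule. -/
theorem hdelta_brace₂ {m d e : ℤ} {c a b : List R → R} (hc : MultiAdd c) (ha : MultiAdd a)
    (hcm : Homog m c) (had : Homog d a) (hbe : Homog e b)
    (hdc : hdelta m c = 0) (hda : hdelta d a = 0) (hdb : hdelta e b = 0) :
    hdelta (m + d + e) (brace₂ c d a e b) =
      (sgn (d + e + e * (d + 1))) • (gcirc c (d + e + 1) (lcup a b) - lcup a (gcirc c e b)
        - sgn (m * (e + 1)) • lcup (gcirc c d a) b) := by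
  have h3 : gcirc c 1 lmul = lcup lid c + sgn m • lcup c lid := by
    rw [hdelta, sub_eq_zero] at hdc
    exact hdc.symm
  -- The expansions of `c{a, b} ∘ μ` and `(c ∘ μ){a, b}` contain the same triple braces, which
  -- cancel. The terms with `a ∘ μ` and `b ∘ μ` cancel against those with `μ ∘ a` and `μ ∘ b`, as
  -- `a` and `b` are cocycles.
  have h4 : gcirc (brace₂ c d a e b) 1 lmul = sgn (d + e) •
      (brace₂ (gcirc c 1 lmul) d a e b - gcirc c (1 + d + e) (brace₂ lmul d a e b)) := by
    rw [gcirc_brace₂ hc d ha e b homog_lmul, brace₂_gcirc hc 1 lmul had hbe,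
      (hdelta_eq_zero_iff d a).mp hda, (hdelta_eq_zero_iff e b).mp hdb,
      brace₂_smul_mid hc, brace₂_smul_right hc, add_comm 1 d, add_comm 1 e, sgn_add]
    simp only [one_mul, sgn_add]
    rcases sgn_eq_or d with h | h <;> rcases sgn_eq_or e with h' | h' <;> simp only [h, h'] <;>
      simp <;> abel
  rw [hdelta, h4, brace₂_lmul had, h3, brace₂_add_left, brace₂_smul_left,
    brace₂_lcup multiAdd_lid homog_lid _ had, brace₂_lcup hc hcm _ had, gcirc_lid, gcirc_lid,
    brace₂_lid, lcup_zero_left, lcup_zero_right, gcirc_smul_right hc,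
    add_assoc 1 d e, add_comm 1 (d + e)]
  simp only [mul_add, sgn_add, zero_add, mul_one, add_mul, mul_comm d e, mul_comm e m]
  rcases sgn_eq_or d with h | h <;> rcases sgn_eq_or e with h' | h' <;>
    rcases sgn_eq_or (e * d) with h₁ | h₁ <;> rcases sgn_eq_or m with h₂ | h₂ <;>
    rcases sgn_eq_or (m * e) with h₃ | h₃ <;>
    simp only [h, h', h₁, h₂, h₃] <;> simp <;> abel

end Hochschild

/-! ### Sweedler calculus in a left bialgebroid, and the operator `D`. -/

namespace LeftBialgebroid

variable {k : Type v} {A U : Type u} [CommRing k] [Ring A] [Algebra k A] [Ring U] [Algebra k U]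
  (B : LeftBialgebroid k A U)

theorem s_mul (a b : A) : B.s (a * b) = B.s a * B.s b := by
  simp [s, srcMap, ← map_mul]

theorem t_mul (a b : A) : B.t (a * b) = B.t b * B.t a := by
  simp [t, tgtMap, ← map_mul]

theorem s_mul_t (a b : A) : B.s a * B.t b = B.t b * B.s a := by
  simp [s, t, srcMap, tgtMap, ← map_mul]

theorem t_add (a b : A) : B.t (a + b) = B.t a + B.t b := by
  simp [t, tgtMap, TensorProduct.tmul_add]

theorem t_smul (c : k) (a : A) : B.t (c • a) = c • B.t a := by
  simp only [t, tgtMap, MulOpposite.op_smul, TensorProduct.tmul_smul, map_smul]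

theorem smul_eq_s_mul (c : k) (u : U) : c • u = B.s (c • 1) * u := by
  rw [s_smul, s_one, smul_mul_assoc, one_mul]

theorem smul_eq_t_mul (c : k) (u : U) : c • u = B.t (c • 1) * u := by
  rw [t_smul, t_one, smul_mul_assoc, one_mul]

theorem ε_s_mul (a : A) (u : U) : B.ε (B.s a * u) = a * B.ε u := by
  have h : B.ε (B.s a * B.t 1 * u) = a * B.ε u * 1 := B.counit_bimod a 1 u
  rwa [t_one, mul_one, mul_one] at h

theorem ε_t_mul (a : A) (u : U) : B.ε (B.t a * u) = B.ε u * a := by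
  have h : B.ε (B.s 1 * B.t a * u) = 1 * B.ε u * a := B.counit_bimod 1 a u
  rwa [s_one, one_mul, one_mul] at h

theorem ε_s (a : A) : B.ε (B.s a) = a := by
  simpa [B.counit_one] using B.ε_s_mul a 1

theorem ε_t (a : A) : B.ε (B.t a) = a := by
  simpa [B.counit_one] using B.ε_t_mul a 1

theorem ε_mul_s (u : U) (a : A) : B.ε (u * B.s a) = B.ε (u * B.t a) := by
  have h : B.ε (u * B.s a) = B.ε (u * B.t (B.ε (B.s a))) := B.counit_mul_tgt u (B.s a)
  rwa [ε_s] at h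

theorem ε_mul (u w : U) : B.ε (u * w) = B.ε (u * B.t (B.ε w)) := B.counit_mul_tgt u w

theorem ε_mul_eq_act (u w : U) : B.ε (u * w) = B.act u (B.ε w) := B.counit_mul_src u w

/-! ### Contraction with the coproduct -/

section Contr

variable {M : Type*} [AddCommGroup M]

/-- A biadditive map which factors over `U ⊗_A U`. -/
structure IsBal (R : U → U → M) : Prop where
  add_left : ∀ x x' y, R (x + x') y = R x y + R x' y
  add_right : ∀ x y y', R x (y + y') = R x y + R x y'
  bal : ∀ a x y, R (B.t a * x) y = R x (B.s a * y)

variable {B}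

/-- Balancing over `k` is a case of balancing over `A`, since `c • u = t(c • 1) u = s(c • 1) u`.
Hence Sweedler sums can be evaluated on additive maps into any abelian group. -/
theorem IsBal.exists_lift {R : U → U → M} (hR : B.IsBal R) :
    ∃ L : TensA B.η →+ M, ∀ x y, L (tmulA B.η x y) = R x y := by
  let F : U →+ U →+ M := AddMonoidHom.mk' (fun x => AddMonoidHom.mk' (R x) (hR.add_right x))
    fun x x' => by ext y; exact hR.add_left x x' y
  let L₀ : U ⊗[k] U →+ M := TensorProduct.liftAddHom F fun c x y => by
    change R (c • x) y = R x (c • y)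
    rw [B.smul_eq_t_mul, B.smul_eq_s_mul, hR.bal]
  have hL₀ : ∀ x y, L₀ (x ⊗ₜ y) = R x y := fun x y => rfl
  -- The relations form a `k`-span but `L₀` is only additive, so the induction has to carry all
  -- multiples `c • z`.
  have hker : ∀ z ∈ relA B.η, ∀ c : k, L₀ (c • z) = 0 := by
    intro z hz
    induction hz using Submodule.span_induction with
    | mem z h =>
      obtain ⟨a, u, w, rfl⟩ := h
      intro c
      rw [smul_sub, TensorProduct.smul_tmul', TensorProduct.smul_tmul', map_sub, hL₀, hL₀,
        ← mul_smul_comm, sub_eq_zero]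
      exact hR.bal a (c • u) w
    | zero => simp
    | add x y _ _ hx hy => intro c; rw [smul_add, map_add, hx, hy, add_zero]
    | smul d x _ hx => intro c; rw [smul_smul]; exact hx _
  refine ⟨QuotientAddGroup.lift (relA B.η).toAddSubgroup L₀ fun z hz => ?_, fun x y => rfl⟩
  simpa using hker z hz 1

variable (B) in
/-- The value `R(u₍₁₎, u₍₂₎)`. -/
noncomputable def contr (u : U) (R : U → U → M) : M := ∑ j, R (B.sw₁ u j) (B.sw₂ u j)

variable (B) in
theorem isRep_sw (u : U) : IsRep B.η (B.Δ u) (B.sw₁ u) (B.sw₂ u) :=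
  (B.exists_rep u).choose_spec.choose_spec.choose_spec

theorem IsBal.lift_Δ {R : U → U → M} {L : TensA B.η →+ M}
    (hL : ∀ x y, L (tmulA B.η x y) = R x y) (u : U) : L (B.Δ u) = B.contr u R := by
  rw [B.isRep_sw u, map_sum]
  simp only [hL]
  rfl

theorem IsBal.contr_eq {R : U → U → M} (hR : B.IsBal R) {u : U} {n : ℕ} {x y : Fin n → U}
    (h : IsRep B.η (B.Δ u) x y) : B.contr u R = ∑ j, R (x j) (y j) := by
  obtain ⟨L, hL⟩ := hR.exists_lift
  rw [← IsBal.lift_Δ hL, h, map_sum]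
  simp only [hL]

theorem contr_add (u : U) (R R' : U → U → M) :
    (B.contr u fun x y => R x y + R' x y) = B.contr u R + B.contr u R' :=
  Finset.sum_add_distrib

theorem map_contr {N : Type*} [AddCommGroup N] (f : M →+ N) (u : U) (R : U → U → M) :
    f (B.contr u R) = B.contr u fun x y => f (R x y) := map_sum f _ _

theorem contr_mul (u : U) (R : U → U → U) (z : U) :
    B.contr u R * z = B.contr u fun x y => R x y * z := Finset.sum_mul _ _ _

theorem mul_contr (u : U) (R : U → U → U) (z : U) :
    z * B.contr u R = B.contr u fun x y => z * R x y := Finset.mul_sum _ _ _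

theorem contr_comm (u w : U) (R : U → U → U → U → M) :
    (B.contr u fun x y => B.contr w fun x' y' => R x y x' y') =
      B.contr w fun x' y' => B.contr u fun x y => R x y x' y' := Finset.sum_comm

theorem IsBal.add_contr {R : U → U → M} (hR : B.IsBal R) (u w : U) :
    B.contr (u + w) R = B.contr u R + B.contr w R := by
  obtain ⟨L, hL⟩ := hR.exists_lift
  simp only [← IsBal.lift_Δ hL, map_add]

theorem IsBal.contr_s_t_mul {R : U → U → M} (hR : B.IsBal R) (a b : A) (u : U) :
    B.contr (B.s a * B.t b * u) R = B.contr u fun x y => R (B.s a * x) (B.t b * y) :=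
  hR.contr_eq (B.comul_bimod a b u _ _ _ (B.isRep_sw u))

theorem IsBal.contr_s_mul {R : U → U → M} (hR : B.IsBal R) (a : A) (u : U) :
    B.contr (B.s a * u) R = B.contr u fun x y => R (B.s a * x) y := by
  have := hR.contr_s_t_mul a 1 u
  simpa only [t_one, mul_one, one_mul] using this

theorem IsBal.contr_t_mul {R : U → U → M} (hR : B.IsBal R) (a : A) (u : U) :
    B.contr (B.t a * u) R = B.contr u fun x y => R x (B.t a * y) := by
  have := hR.contr_s_t_mul 1 a u
  simpa only [s_one, mul_one, one_mul] using this

theorem IsBal.contr_mul {R : U → U → M} (hR : B.IsBal R) (u w : U) :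
    B.contr (u * w) R = B.contr w fun x' y' => B.contr u fun x y => R (x * x') (y * y') := by
  obtain ⟨L, hL⟩ := hR.exists_lift
  rw [← IsBal.lift_Δ hL, B.comul_mul u w _ _ _ _ _ _ (B.isRep_sw u) (B.isRep_sw w), contr_comm]
  simp only [map_sum, hL]
  rfl

theorem IsBal.contr_one {R : U → U → M} (hR : B.IsBal R) : B.contr 1 R = R 1 1 := by
  obtain ⟨L, hL⟩ := hR.exists_lift
  rw [← IsBal.lift_Δ hL, B.comul_one, hL]

theorem IsBal.contr_s {R : U → U → M} (hR : B.IsBal R) (a : A) : B.contr (B.s a) R = R (B.s a) 1 := by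
  obtain ⟨L, hL⟩ := hR.exists_lift
  have := hR.contr_s_mul a 1
  rw [mul_one] at this
  rw [this, IsBal.contr_one, mul_one]
  refine ⟨fun x x' y => by rw [mul_add, hR.add_left], fun x y y' => hR.add_right _ _ _,
    fun b x y => ?_⟩
  rw [← mul_assoc, s_mul_t, mul_assoc, hR.bal]

theorem IsBal.contr_mul_t {R : U → U → M} (hR : B.IsBal R) (u : U) (a : A) :
    B.contr (u * B.t a) R = B.contr u fun x y => R x (y * B.t a) := by
  obtain ⟨L, hL⟩ := hR.exists_lift
  have h1 : IsRep B.η (B.Δ 1) (fun _ : Fin 1 => 1) (fun _ => 1) := by simp [IsRep, B.comul_one]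
  have h2 := B.comul_bimod 1 a 1 1 _ _ h1
  have hs : srcMap B.η (1 : A) = 1 := B.s_one
  simp only [hs, one_mul, mul_one] at h2
  rw [← IsBal.lift_Δ hL]
  change L (B.Δ (u * tgtMap B.η a)) = _
  rw [B.comul_mul u _ _ _ _ _ _ _ (B.isRep_sw u) h2]
  simp only [map_sum, hL, Finset.univ_unique, Finset.sum_singleton, mul_one]
  rfl

theorem IsBal.contr_mul_s {R : U → U → M} (hR : B.IsBal R) (u : U) (a : A) :
    B.contr (u * B.s a) R = B.contr u fun x y => R (x * B.s a) y := by
  obtain ⟨L, hL⟩ := hR.exists_lift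
  have h1 : IsRep B.η (B.Δ 1) (fun _ : Fin 1 => 1) (fun _ => 1) := by simp [IsRep, B.comul_one]
  have h2 := B.comul_bimod a 1 1 1 _ _ h1
  have hs : tgtMap B.η (1 : A) = 1 := B.t_one
  simp only [hs, one_mul, mul_one] at h2
  rw [← IsBal.lift_Δ hL]
  change L (B.Δ (u * srcMap B.η a)) = _
  rw [B.comul_mul u _ _ _ _ _ _ _ (B.isRep_sw u) h2]
  simp only [map_sum, hL, Finset.univ_unique, Finset.sum_singleton, mul_one]
  rfl

theorem IsBal.takeuchi {R : U → U → M} (hR : B.IsBal R) (u : U) (a : A) :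
    (B.contr u fun x y => R (x * B.t a) y) = B.contr u fun x y => R x (y * B.s a) := by
  obtain ⟨L, hL⟩ := hR.exists_lift
  have := congrArg L (B.takeuchi u a _ _ _ (B.isRep_sw u))
  simp only [map_sum, hL] at this
  exact this

theorem IsBal.contr_contr {R : U → U → M} (hR : B.IsBal R) (u : U) (R' : U → U → U) :
    B.contr (B.contr u R') R = B.contr u fun x y => B.contr (R' x y) R :=
  map_contr (AddMonoidHom.mk' (fun w => B.contr w R) hR.add_contr) u R'

theorem contr_counit_right (u : U) : (B.contr u fun x y => B.t (B.ε y) * x) = u :=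
  B.counit_right u _ _ _ (B.isRep_sw u)

theorem contr_counit_left (u : U) : (B.contr u fun x y => B.s (B.ε x) * y) = u :=
  B.counit_left u _ _ _ (B.isRep_sw u)

variable (B) in
/-- A triadditive map which factors over `U ⊗_A U ⊗_A U`. -/
structure IsBal₃ (T : U → U → U → M) : Prop where
  add₁ : ∀ x x' y z, T (x + x') y z = T x y z + T x' y z
  add₂ : ∀ x y y' z, T x (y + y') z = T x y z + T x y' z
  add₃ : ∀ x y z z', T x y (z + z') = T x y z + T x y z'
  bal₁ : ∀ a x y z, T (B.t a * x) y z = T x (B.s a * y) z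
  bal₂ : ∀ a x y z, T x (B.t a * y) z = T x y (B.s a * z)

theorem IsBal₃.exists_lift {T : U → U → U → M} (hT : B.IsBal₃ T) :
    ∃ L : ((U ⊗[k] (U ⊗[k] U)) ⧸ relAA B.η) →+ M,
      ∀ x y z, L (tmulAA B.η x y z) = T x y z := by
  let F : U →+ U →+ U →+ M := AddMonoidHom.mk' (fun x => AddMonoidHom.mk' (fun y =>
    AddMonoidHom.mk' (T x y) (hT.add₃ x y)) fun y y' => by ext z; exact hT.add₂ x y y' z)
    fun x x' => by ext y z; exact hT.add₁ x x' y z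
  let L₁ : U →+ (U ⊗[k] U) →+ M := AddMonoidHom.mk' (fun x => TensorProduct.liftAddHom (F x)
      fun c y z => by
        change T x (c • y) z = T x y (c • z)
        rw [B.smul_eq_t_mul, B.smul_eq_s_mul, hT.bal₂])
    fun x x' => by
      ext z
      induction z using TensorProduct.induction_on with
      | zero => simp
      | tmul y z => exact hT.add₁ x x' y z
      | add z z' h h' =>
        exact (map_add _ z z').trans ((congrArg₂ (· + ·) h h').trans (map_add _ z z').symm)
  have hL₁ : ∀ x y z, L₁ x (y ⊗ₜ z) = T x y z := fun x y z => rfl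
  let L₀ : U ⊗[k] (U ⊗[k] U) →+ M := TensorProduct.liftAddHom L₁ fun c x z => by
    induction z using TensorProduct.induction_on with
    | zero => simp
    | tmul y z =>
      rw [TensorProduct.smul_tmul', hL₁, hL₁, B.smul_eq_t_mul, B.smul_eq_s_mul, hT.bal₁]
    | add z z' h h' => rw [smul_add, map_add, map_add, h, h']
  have hL₀ : ∀ x y z, L₀ (x ⊗ₜ (y ⊗ₜ z)) = T x y z := fun x y z => rfl
  have hker : ∀ z ∈ relAA B.η, ∀ c : k, L₀ (c • z) = 0 := by
    intro z hz
    induction hz using Submodule.span_induction with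
    | mem z h =>
      intro c
      rcases h with ⟨a, u, w, r, rfl⟩ | ⟨a, u, w, r, rfl⟩
      · rw [smul_sub, TensorProduct.smul_tmul', TensorProduct.smul_tmul', map_sub, hL₀, hL₀,
          ← mul_smul_comm, sub_eq_zero]
        exact hT.bal₁ a (c • u) w r
      · rw [smul_sub, TensorProduct.smul_tmul', TensorProduct.smul_tmul', map_sub, hL₀, hL₀,
          sub_eq_zero]
        exact hT.bal₂ a (c • u) w r
    | zero => simp
    | add x y _ _ hx hy => intro c; rw [smul_add, map_add, hx, hy, add_zero]
    | smul d x _ hx => intro c; rw [smul_smul]; exact hx _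
  refine ⟨QuotientAddGroup.lift (relAA B.η).toAddSubgroup L₀ fun z hz => ?_, fun x y z => rfl⟩
  simpa using hker z hz 1

theorem IsBal₃.coassoc {T : U → U → U → M} (hT : B.IsBal₃ T) (u : U) :
    (B.contr u fun x z => B.contr x fun x' y => T x' y z) =
      B.contr u fun x y => B.contr y fun y' z => T x y' z := by
  obtain ⟨L, hL⟩ := hT.exists_lift
  have := congrArg L (B.coassoc u _ _ _ (B.isRep_sw u) _ _ _ _ _ _ (fun j => B.isRep_sw _)
    (fun j => B.isRep_sw _))
  simp only [map_sum, hL] at this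
  exact this

end Contr

/-! ### Cochains with values in `U` -/

/-- A balanced function on lists with values in `U` such that `Ψ(t(a)x, …) = Ψ(x, …)s(a)`. -/
structure IsUCochain (Ψ : List U → U) : Prop where
  add : MultiAdd Ψ
  bal : ∀ p x y l a, Ψ (p ++ (x * B.t a) :: y :: l) = Ψ (p ++ x :: (B.t a * y) :: l)
  first : ∀ a x l, Ψ (B.t a * x :: l) = Ψ (x :: l) * B.s a

/-- The function `l ↦ Ψ(u₍₁₎, l) u₍₂₎`. -/
noncomputable def peel (u : U) (Ψ : List U → U) (l : List U) : U :=
  B.contr u fun x y => Ψ (x :: l) * y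

/-- The sum `Ψ(u¹₍₁₎, …, uⁿ₍₁₎) u¹₍₂₎ ⋯ uⁿ₍₂₎`. -/
noncomputable def expand (Ψ : List U → U) : List U → U
  | [] => Ψ []
  | u :: w => expand (B.peel u Ψ) w

variable {B}

theorem IsUCochain.isBal {Ψ : List U → U} (h : B.IsUCochain Ψ) (l : List U) :
    B.IsBal fun x y => Ψ (x :: l) * y where
  add_left x x' y := by rw [← add_mul]; congr 1; exact h.add [] l x x'
  add_right x y y' := mul_add _ _ _
  bal a x y := by rw [h.first, mul_assoc]

/-- The Takeuchi condition makes the expansion iterable: a factor `s(a)` to the right of `u₍₂₎`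
becomes `t(a)` to the right of `u₍₁₎`, and the balancing of `Ψ` passes it to the next argument. -/
theorem IsUCochain.peel {Ψ : List U → U} (h : B.IsUCochain Ψ) (u : U) :
    B.IsUCochain (B.peel u Ψ) where
  add a c x y := by
    simp only [LeftBialgebroid.peel, ← contr_add, ← add_mul]
    congr 1; funext x' y'; congr 1
    exact h.add (x' :: a) c x y
  bal p x y l a := by
    simp only [LeftBialgebroid.peel]
    congr 1; funext x' y'; congr 1
    exact h.bal (x' :: p) x y l a
  first a x l := by
    simp only [LeftBialgebroid.peel, contr_mul, mul_assoc]
    rw [← (h.isBal (x :: l)).takeuchi u a]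
    congr 1; funext x' y'; congr 1
    exact (h.bal [] x' x l a).symm

theorem expand_congr {Ψ Ψ' : List U → U} {w : List U}
    (h : ∀ l, l.length = w.length → Ψ l = Ψ' l) : B.expand Ψ w = B.expand Ψ' w := by
  induction w generalizing Ψ Ψ' with
  | nil => exact h _ rfl
  | cons u w ih =>
    refine ih fun l hl => ?_
    simp only [peel]
    congr 1; funext x y
    rw [h _ (by simp [hl])]

theorem expand_add (Ψ Ψ' : List U → U) (w : List U) :
    B.expand (fun l => Ψ l + Ψ' l) w = B.expand Ψ w + B.expand Ψ' w := by
  induction w generalizing Ψ Ψ' with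
  | nil => rfl
  | cons u w ih =>
    simp only [expand, ← ih]
    congr 1; funext l
    simp only [peel, add_mul, contr_add]

variable (B) in
/-- `expand` as an additive map of its first argument. -/
noncomputable def expandHom (w : List U) : (List U → U) →+ U :=
  AddMonoidHom.mk' (fun Ψ => B.expand Ψ w) fun Ψ Ψ' => expand_add Ψ Ψ' w

theorem expand_zero (w : List U) : B.expand (fun _ => 0) w = 0 := (B.expandHom w).map_zero

theorem expand_zsmul (n : ℤ) (Ψ : List U → U) (w : List U) :
    B.expand (fun l => n • Ψ l) w = n • B.expand Ψ w := (B.expandHom w).map_zsmul n Ψ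

theorem expand_contr (R : List U → U → U → U) (u : U) (w : List U) :
    B.expand (fun l => B.contr u (R l)) w = B.contr u fun x y => B.expand (fun l => R l x y) w := by
  have := map_sum (B.expandHom w) (fun j l => R l (B.sw₁ u j) (B.sw₂ u j)) Finset.univ
  refine Eq.trans (congrArg (B.expandHom w) ?_) this
  funext l
  simp [contr]

theorem mul_expand (z : U) (Ψ : List U → U) (w : List U) :
    z * B.expand Ψ w = B.expand (fun l => z * Ψ l) w := by
  induction w generalizing Ψ with
  | nil => rfl
  | cons u w ih =>
    rw [expand, ih, expand]
    congr 1; funext l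
    simp only [peel, mul_contr, mul_assoc]

theorem expand_append (Ψ : List U → U) (a w : List U) :
    B.expand Ψ (a ++ w) = B.expand (fun l => B.expand (fun a' => Ψ (a' ++ l)) a) w := by
  induction a generalizing Ψ with
  | nil => rfl
  | cons u a ih =>
    rw [List.cons_append, expand, ih]
    rfl

theorem expand_append_singleton (Ψ : List U → U) (b : List U) (u : U) :
    B.expand Ψ (b ++ [u]) = B.contr u fun x y => B.expand (fun b' => Ψ (b' ++ [x])) b * y :=
  expand_append Ψ b [u]

theorem IsUCochain.expand {Ψ : List U → U} (h : B.IsUCochain Ψ) (b : List U) :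
    B.IsUCochain fun l => B.expand (fun b' => Ψ (b' ++ l)) b := by
  induction b generalizing Ψ with
  | nil => exact h
  | cons u b ih => exact ih (h.peel u)

theorem contr_splitSum {M : Type*} [AddCommGroup M] (u : U) (w : List U)
    (F : List U → List U → U → U → M) :
    (B.contr u fun x y => splitSum w fun a b => F a b x y) =
      splitSum w fun a b => B.contr u (F a b) := by
  induction w generalizing F with
  | nil => rfl
  | cons z w ih => simp only [splitSum_cons, contr_add, ih]

theorem expand_splitSum (F : List U → List U → U) (w : List U) :
    B.expand (fun w' => splitSum w' F) w =
      splitSum w fun a r => B.expand (fun r' => B.expand (fun a' => F a' r') a) r := by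
  induction w generalizing F with
  | nil => rfl
  | cons u w ih =>
    have h : B.peel u (fun w' => splitSum w' F) = fun l =>
        B.peel u (fun w' => F [] w') l + splitSum l fun a b => B.contr u fun x y => F (x :: a) b * y := by
      funext l
      simp only [peel, ← contr_splitSum, ← contr_add, splitSum_cons, add_mul, splitSum_mul]
    rw [LeftBialgebroid.expand, h, expand_add, ih, splitSum_cons]
    rfl

theorem expand_splitSum_comm (r : List U) (F : List U → List U → List U → U) (a : List U) :
    B.expand (fun a' => splitSum r (F a')) a = splitSum r fun b c => B.expand (fun a' => F a' b c) a := by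
  induction r generalizing F with
  | nil => rfl
  | cons u r ih => simp only [splitSum_cons, expand_add, ih]

variable (B) in
theorem s_splitSum (w : List U) (F : List U → List U → A) :
    B.s (splitSum w F) = splitSum w fun a b => B.s (F a b) :=
  map_splitSum (AddMonoidHom.mk' B.s B.s_add) w F

variable (B) in
theorem s_zsmul (n : ℤ) (a : A) : B.s (n • a) = n • B.s a :=
  (AddMonoidHom.mk' B.s B.s_add).map_zsmul n a

/-! ### The operator `D` -/

variable (B) in
/-- A balanced function on lists with values in `A` such that `φ(t(a)x, …) = φ(x, …)a`. -/
structure IsLCochain (φ : List U → A) : Prop where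
  add : MultiAdd φ
  bal : ∀ p x y l a, φ (p ++ (x * B.t a) :: y :: l) = φ (p ++ x :: (B.t a * y) :: l)
  first : ∀ a x l, φ (B.t a * x :: l) = φ (x :: l) * a

theorem IsLCochain.isUCochain {φ : List U → A} (h : B.IsLCochain φ) :
    B.IsUCochain fun l => B.s (φ l) where
  add a c x y := by simp only [h.add a c x y, s_add]
  bal p x y l a := by simp only [h.bal]
  first a x l := by rw [h.first, s_mul]

variable (B) in
/-- The operator `D_φ(u¹, …, uᵖ) = φ(u¹₍₁₎, …, uᵖ₍₁₎) ▷ u¹₍₂₎ ⋯ uᵖ₍₂₎` on lists. -/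
noncomputable def lD (φ : List U → A) (w : List U) : U := B.expand (fun l => B.s (φ l)) w

/-- `Δ(D_φ(w)) = D_φ(w₍₁₎) ⊗ w₍₂₎`, in terms of a balanced additive function `P`. -/
theorem IsLCochain.contr_expand {φ : List U → A} (hφ : B.IsLCochain φ) {P : U → U}
    (hP : ∀ x y, P (x + y) = P x + P y) (hP' : ∀ a x, P (B.t a * x) = P x * B.s a)
    (b l : List U) (v : U) :
    (B.contr (B.expand (fun l' => B.s (φ (l' ++ l))) b) fun x y => P (x * v) * y) =
      B.expand (fun b' => P (B.expand (fun l' => B.s (φ (l' ++ l))) b' * v)) b := by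
  have hPb : ∀ v, B.IsBal fun x y => P (x * v) * y := fun v =>
    ⟨fun x x' y => by rw [add_mul, hP, add_mul], fun x y y' => mul_add _ _ _,
      fun a x y => by rw [mul_assoc, hP', mul_assoc]⟩
  have hU := fun b => hφ.isUCochain.expand b
  -- Entries are removed from the right, since the second leg of the last entry is the last factor.
  -- The list `l` keeps the first legs of the removed entries, and `v` the factor which follows
  -- inside `P`.
  induction b using List.reverseRecOn generalizing l v with
  | nil =>
    change B.contr (B.s (φ l)) _ = P (B.s (φ l) * v)
    rw [(hPb v).contr_s, mul_one]
  | append_singleton b u ih =>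
    have e1 : ∀ (b : List U) (u : U), B.expand (fun l' => B.s (φ (l' ++ l))) (b ++ [u]) =
        B.contr u fun x y => B.expand (fun l' => B.s (φ (l' ++ x :: l))) b * y := by
      intro b u
      rw [expand_append_singleton]
      simp
    -- The three legs of `u` go to an argument of `φ`, into `P`, and to the right-hand factor.
    -- Balancing of the first two legs uses `Δ(z s(a)) = z₍₁₎ s(a) ⊗ z₍₂₎`, that of the last two the
    -- Takeuchi condition.
    have hT : B.IsBal₃ fun x x' y' =>
        (B.contr (B.expand (fun l' => B.s (φ (l' ++ x :: l))) b)
          fun p q => P (p * (x' * v)) * q) * y' := by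
      refine ⟨fun x x' y z => ?_, fun x y y' z => ?_, fun x y z z' => mul_add _ _ _,
        fun a x y z => ?_, fun a x y z => ?_⟩
      · rw [← add_mul, ← (hPb (y * v)).add_contr]
        congr 2
        exact (hU b).add [] l x x'
      · simp only [add_mul, mul_add, hP, contr_add]
      · congr 1
        have := (hPb (y * v)).contr_mul_s (B.expand (fun l' => B.s (φ (l' ++ x :: l))) b) a
        rw [(hU b).first a x l, this]
        simp only [mul_assoc]
      · rw [← mul_assoc _ (B.s a) z]
        congr 1
        rw [contr_mul]
        have := (hPb (y * v)).takeuchi (B.expand (fun l' => B.s (φ (l' ++ x :: l))) b) a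
        simp only [mul_assoc] at this ⊢
        exact this
    have e2 := hT.coassoc u
    rw [e1, (hPb v).contr_contr]
    have e3 : ∀ x y, (B.contr (B.expand (fun l' => B.s (φ (l' ++ x :: l))) b * y)
        fun p q => P (p * v) * q) = B.contr y fun x' y' =>
          (B.contr (B.expand (fun l' => B.s (φ (l' ++ x :: l))) b)
            fun p q => P (p * (x' * v)) * q) * y' := by
      intro x y
      rw [(hPb v).contr_mul]
      simp only [contr_mul, mul_assoc]
    simp only [e3]
    rw [← e2, expand_append_singleton]
    congr 1; funext x z
    rw [← contr_mul]
    congr 1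
    simp only [ih, e1, contr_mul]
    rw [← expand_contr]
    congr 1; funext b'
    exact ((map_contr (AddMonoidHom.mk' P hP) x _).trans (by simp only [mul_assoc]; rfl)).symm

/-- One has `ε(Ψ(x, …) y) = ε(Ψ(x, …) s(ε(y))) = ε(Ψ(t(ε(y)) x, …))`, and the right counit axiom
recombines `t(ε(u₍₂₎)) u₍₁₎` to `u`. -/
theorem IsUCochain.ε_expand {Ψ : List U → U} (h : B.IsUCochain Ψ) (w : List U) :
    B.ε (B.expand Ψ w) = B.ε (Ψ w) := by
  induction w generalizing Ψ with
  | nil => rfl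
  | cons u w ih =>
    rw [LeftBialgebroid.expand, ih (h.peel u), LeftBialgebroid.peel]
    have h1 : ∀ x y, B.ε (Ψ (x :: w) * y) = B.ε (Ψ (B.t (B.ε y) * x :: w)) := fun x y => by
      rw [ε_mul, ← ε_mul_s, h.first]
    have h2 := map_contr (B := B) B.ε.toAddMonoidHom u fun x y => Ψ (x :: w) * y
    refine h2.trans ?_
    change (B.contr u fun x y => B.ε (Ψ (x :: w) * y)) = _
    simp only [h1]
    have h3 := map_contr (B := B) (B.ε.toAddMonoidHom.comp (h.add.hom [] w)) u fun x y => B.t (B.ε y) * x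
    rw [contr_counit_right] at h3
    exact h3.symm

theorem IsUCochain.multiAdd_expand {Ψ : List U → U} (h : B.IsUCochain Ψ) :
    MultiAdd (B.expand Ψ) := by
  intro a c x y
  induction a generalizing Ψ with
  | nil =>
    simp only [List.nil_append, LeftBialgebroid.expand, ← expand_add]
    congr 1; funext l
    exact (h.isBal l).add_contr x y
  | cons u a ih => exact ih (h.peel u)

/-- As `Δ(x t(a)) = x₍₁₎ ⊗ x₍₂₎ t(a)` and `Δ(t(a) y) = y₍₁₎ ⊗ t(a) y₍₂₎`, on both sides `t(a)`
stands between the second legs of `x` and `y`. -/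
theorem IsUCochain.expand_bal {Ψ : List U → U} (h : B.IsUCochain Ψ) (p : List U) (x y : U)
    (l : List U) (a : A) :
    B.expand Ψ (p ++ (x * B.t a) :: y :: l) = B.expand Ψ (p ++ x :: (B.t a * y) :: l) := by
  induction p generalizing Ψ with
  | nil =>
    simp only [List.nil_append, LeftBialgebroid.expand]
    congr 1; funext l
    have h1 : ∀ l, B.peel (x * B.t a) Ψ l = B.peel x Ψ l * B.t a := fun l => by
      simp only [LeftBialgebroid.peel]
      rw [IsBal.contr_mul_t (h.isBal _), contr_mul]
      simp only [mul_assoc]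
    have h2 : B.peel (B.t a * y) (B.peel x Ψ) l =
        B.contr y fun x' y' => B.peel x Ψ (x' :: l) * (B.t a * y') :=
      IsBal.contr_t_mul ((h.peel x).isBal l) a y
    rw [h2, LeftBialgebroid.peel]
    simp only [h1, mul_assoc]
  | cons u p ih => exact ih (h.peel u)

namespace IsLCochain

variable {φ ψ : List U → A}

theorem multiAdd_lD (h : B.IsLCochain φ) : MultiAdd (B.lD φ) := h.isUCochain.multiAdd_expand

theorem ε_lD (h : B.IsLCochain φ) (w : List U) : B.ε (B.lD φ w) = φ w := by
  rw [lD, h.isUCochain.ε_expand, ε_s]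

theorem lD_bal (h : B.IsLCochain φ) (p : List U) (x y : U) (l : List U) (a : A) :
    B.lD φ (p ++ (x * B.t a) :: y :: l) = B.lD φ (p ++ x :: (B.t a * y) :: l) :=
  h.isUCochain.expand_bal p x y l a

/-- In the expansion `t(a)` stands directly behind the value of `s`, with which it commutes. -/
theorem lD_first (h : B.IsLCochain φ) (a : A) (x : U) (l : List U) :
    B.lD φ (B.t a * x :: l) = B.t a * B.lD φ (x :: l) := by
  rw [lD, lD, expand, expand, mul_expand]
  congr 1; funext l
  simp only [peel]
  rw [IsBal.contr_t_mul (h.isUCochain.isBal l), mul_contr]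
  congr 1; funext x y
  rw [← mul_assoc, ← mul_assoc, s_mul_t]

theorem lD_last (h : B.IsLCochain φ) (a : A) (x : U) (l : List U) :
    B.lD φ (l ++ [x * B.t a]) = B.lD φ (l ++ [x]) * B.t a := by
  rw [lD, lD, expand_append_singleton, expand_append_singleton, contr_mul,
    IsBal.contr_mul_t ((h.isUCochain.expand l).isBal [])]
  simp only [mul_assoc]

theorem lD_nil_comm (φ : List U → A) (a : A) : B.lD φ [] * B.t a = B.t a * B.lD φ [] :=
  s_mul_t B _ _

/-- Since `D_ψ` lets `t(a)` pass out of its first and last arguments, balancing carries over across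
the ends of the inserted block. If `ψ` has degree zero, the inserted entry `D_ψ []` is a value of
`s` and commutes with `t(a)`. -/
theorem wcirc (hφ : B.IsLCochain φ) (hψ : B.IsLCochain ψ) (θ : ℕ → ℤ) :
    B.IsLCochain (wcirc θ φ (B.lD ψ)) where
  add p l x y := by
    simp only [_root_.wcirc, splitSum_append_cons]
    simp only [List.append_assoc, List.cons_append, List.length_append, List.length_cons,
      splitSum_add, hφ.add _ _ x y, (hφ.add.tail _ _) _ _ x y, hψ.multiAdd_lD _ _ x y,
      hφ.add _ _ (B.lD ψ _) (B.lD ψ _), smul_add]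
    abel
  bal p x y l a := by
    have h1 := fun p' z p => (hφ.bal (p' ++ z :: p) x y l a)
    have h2 := hφ.bal (p ++ [x]) (B.lD ψ []) y l a
    simp only [_root_.wcirc, splitSum_append_cons, splitSum_cons, List.append_assoc,
      List.cons_append, List.length_append, List.length_cons, List.nil_append] at h1 h2 ⊢
    simp only [h1, hφ.bal p x y _ a, hψ.lD_bal _ x y _ a, hψ.lD_last, hφ.bal _ (B.lD ψ _) y l a,
      hφ.bal p x (B.lD ψ _) _ a, ← hψ.lD_first, ← lD_nil_comm, h2]
  first a x l := by
    have h1 : φ (B.lD ψ [] :: B.t a * x :: l) = φ (B.lD ψ [] :: x :: l) * a := by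
      rw [← hφ.first, ← lD_nil_comm]
      exact (hφ.bal [] _ _ _ _).symm
    simp only [_root_.wcirc, splitSum_cons, List.nil_append, List.cons_append, List.length_cons,
      List.length_nil, add_mul, splitSum_mul, smul_mul_assoc, hφ.first, hψ.lD_first, h1]

/-- Expansion of a function in which the value of `D_ψ` is inserted. -/
theorem expand_insert (hψ : B.IsLCochain ψ) {Ψ : List U → U} (hΨ : B.IsUCochain Ψ)
    (a b c : List U) :
    B.expand (fun c' => B.expand (fun b' => B.expand (fun a' => Ψ (a' ++ B.lD ψ b' :: c')) a) b) c =
      B.expand Ψ (a ++ B.lD ψ b :: c) := by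
  rw [expand_append, expand]
  congr 1; funext c'
  have h := hΨ.expand a
  have := hψ.contr_expand (P := fun z => B.expand (fun a' => Ψ (a' ++ z :: c')) a)
    (fun x y => h.add [] c' x y) (fun α x => h.first α x c') b [] 1
  simp only [mul_one, List.append_nil] at this
  exact this.symm

/-- Expanding the block inserted into `φ` is, by the formula for `Δ(D_ψ(b))`, the same as expanding
the single entry `D_ψ(b)`. The weight `θ` is arbitrary, so that each `∘ᵢ` and the signed sum are
covered at once. -/
theorem lD_wcirc (hφ : B.IsLCochain φ) (hψ : B.IsLCochain ψ) (θ : ℕ → ℤ) :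
    B.lD (_root_.wcirc θ φ (B.lD ψ)) = _root_.wcirc θ (B.lD φ) (B.lD ψ) := by
  funext w
  simp only [lD, _root_.wcirc, s_splitSum, s_zsmul]
  simp only [expand_splitSum, expand_splitSum_comm]
  refine splitSum_congr fun a _ _ => splitSum_congr fun b c _ => ?_
  refine Eq.trans ?_ (congrArg (θ a.length • ·) (hψ.expand_insert hφ.isUCochain a b c))
  simp only [← expand_zsmul]
  exact expand_congr fun c' _ => expand_congr fun b' _ => expand_congr fun a' ha => by rw [ha]; rfl

theorem lD_brace₂ {χ : List U → A} (hφ : B.IsLCochain φ) (hψ : B.IsLCochain ψ)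
    (hχ : B.IsLCochain χ) (d e : ℤ) :
    B.lD (_root_.brace₂ φ d (B.lD ψ) e (B.lD χ)) = _root_.brace₂ (B.lD φ) d (B.lD ψ) e (B.lD χ) := by
  funext w
  simp only [lD, _root_.brace₂, s_splitSum, s_zsmul]
  simp only [expand_splitSum, expand_splitSum_comm]
  refine splitSum_congr fun a _ _ => splitSum_congr fun b _ _ => splitSum_congr fun c _ _ =>
    splitSum_congr fun b₂ c₂ _ => ?_
  -- The first insertion amounts to peeling off the entry `D_ψ(b)`. The result is again balanced, so
  -- the second insertion is an instance of `expand_insert`.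
  have h1 : (fun l => B.expand (fun b' => B.expand (fun a' =>
      B.s (φ (a' ++ B.lD ψ b' :: l))) a) b) =
      B.peel (B.lD ψ b) fun l => B.expand (fun a' => B.s (φ (a' ++ l))) a := by
    funext l
    have h := hφ.isUCochain.expand a
    have := hψ.contr_expand (P := fun z => B.expand (fun a' => B.s (φ (a' ++ z :: l))) a)
      (fun x y => h.add [] l x y) (fun α x => h.first α x l) b [] 1
    simp only [mul_one, List.append_nil] at this
    exact this.symm
  have hU := (hφ.isUCochain.expand a).peel (B.lD ψ b)
  rw [← h1] at hU
  have h3 := hχ.expand_insert hU c b₂ c₂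
  rw [h1] at h3
  have h4 : B.expand (fun l => B.s (φ l)) (a ++ B.lD ψ b :: (c ++ B.lD χ b₂ :: c₂)) =
      B.expand (B.peel (B.lD ψ b) fun l => B.expand (fun a' => B.s (φ (a' ++ l))) a)
        (c ++ B.lD χ b₂ :: c₂) := by
    rw [expand_append, expand]
  refine Eq.trans ?_ (congrArg (sgn _ • ·) (h4.trans h3.symm).symm)
  simp only [← expand_zsmul]
  exact expand_congr fun c₂' _ => expand_congr fun b₂' _ => expand_congr fun c' hc =>
    expand_congr fun b' hb => expand_congr fun a' ha => by rw [ha, hb, hc]; rfl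

theorem brace₂ {χ : List U → A} (hφ : B.IsLCochain φ) (hψ : B.IsLCochain ψ)
    (hχ : B.IsLCochain χ) (d e : ℤ) :
    B.IsLCochain (_root_.brace₂ φ d (B.lD ψ) e (B.lD χ)) where
  add p l x y := by
    have e1 : ∀ a g b x y c, φ (a ++ g :: (b ++ (x + y) :: c)) =
        φ (a ++ g :: (b ++ x :: c)) + φ (a ++ g :: (b ++ y :: c)) :=
      fun a g b x y c => hφ.add.tail a g b c x y
    have e2 : ∀ a g b h c x y l, φ (a ++ g :: (b ++ h :: (c ++ (x + y) :: l))) =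
        φ (a ++ g :: (b ++ h :: (c ++ x :: l))) + φ (a ++ g :: (b ++ h :: (c ++ y :: l))) :=
      fun a g b h c x y l => by simpa using hφ.add.tail (a ++ g :: b) h c l x y
    simp only [_root_.brace₂, splitSum_append_cons]
    simp only [List.append_assoc, List.cons_append, List.length_append, List.length_cons,
      splitSum_add, hφ.add _ _ _ _, e1, e2, hψ.multiAdd_lD _ _ x y, hχ.multiAdd_lD _ _ x y, smul_add]
    abel
  bal p x y l a := by
    have b1 := fun p' z p x y l => hφ.bal (p' ++ z :: p) x y l a
    have b2 := fun p' z p z' q x y l => hφ.bal (p' ++ z :: (p ++ z' :: q)) x y l a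
    -- The following instances serve the entries `D_ψ []` and `D_χ []` of degree-zero cochains,
    -- which may come between `x` and `y` and commute with `t(a)`.
    have b3 := fun p x' x y l => hφ.bal (p ++ [x']) x y l a
    have b4 := fun p x₁ x₂ x y l => hφ.bal (p ++ [x₁, x₂]) x y l a
    have b5 := fun p' z p x' x y l => hφ.bal (p' ++ z :: (p ++ [x'])) x y l a
    simp only [_root_.brace₂, splitSum_append_cons, splitSum_cons, List.append_assoc,
      List.cons_append, List.length_append, List.length_cons, List.nil_append] at b1 b2 b3 b4 b5 ⊢
    simp only [b1, b2, b3, b4, b5, hφ.bal, hψ.lD_bal _ x y _ a, hχ.lD_bal _ x y _ a, hψ.lD_last, hχ.lD_last,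
      ← hψ.lD_first, ← hχ.lD_first, ← lD_nil_comm]
  first a x l := by
    have h0 : ∀ (z : U) (l : List U), z * B.t a = B.t a * z → ∀ y, φ (z :: B.t a * y :: l) = φ (z :: y :: l) * a := by
      intro z l hz y
      rw [← hφ.first, ← hz]
      exact (hφ.bal [] _ _ _ _).symm
    have h1 := fun l => h0 (B.lD ψ []) l (lD_nil_comm ψ a)
    have h2 : φ (B.lD ψ [] :: B.lD χ [] :: B.t a * x :: l) =
        φ (B.lD ψ [] :: B.lD χ [] :: x :: l) * a := by
      rw [← h1, ← lD_nil_comm]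
      exact (hφ.bal [_] _ _ _ _).symm
    simp only [_root_.brace₂, splitSum_cons, List.nil_append, List.cons_append, List.length_cons,
      List.length_nil, add_mul, splitSum_mul, smul_mul_assoc, hφ.first, hψ.lD_first, hχ.lD_first,
      h1, h2]
end IsLCochain

end LeftBialgebroid

theorem Homog.brace₂ {V M : Type*} [AddCommGroup V] [AddCommGroup M] {f : List V → M} {m d e : ℤ}
    (hf : Homog m f) (hfa : MultiAdd f) (n : ℤ) {g : List V → V} (hg : Homog d g) (n' : ℤ)
    {h : List V → V} (hh : Homog e h) : Homog (m + d + e) (brace₂ f n g n' h) := by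
  intro w hw
  refine splitSum_eq_zero fun a r h₁ => splitSum_eq_zero fun b r₂ h₂ => splitSum_eq_zero
    fun c r₃ h₃ => splitSum_eq_zero fun b' c' h₄ => ?_
  subst h₄ h₃ h₂ h₁
  by_cases hb : (b.length : ℤ) = d + 1
  · by_cases hb' : (b'.length : ℤ) = e + 1
    · rw [hf, smul_zero]
      simp at hw ⊢
      omega
    · rw [hh b' hb', (hfa.tail a (g b)).map_zero c c', smul_zero]
  · rw [hg b hb, hfa.map_zero, smul_zero]

namespace LeftBialgebroid

variable {k : Type v} {A U : Type u} [CommRing k] [Ring A] [Algebra k A] [Ring U] [Algebra k U]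
  {B : LeftBialgebroid k A U}

namespace IsLCochain

variable {φ ψ : List U → A}

theorem zero : B.IsLCochain (0 : List U → A) :=
  ⟨fun _ _ _ _ => by simp, fun _ _ _ _ _ => rfl, fun _ _ _ => by simp⟩

theorem add' (hφ : B.IsLCochain φ) (hψ : B.IsLCochain ψ) : B.IsLCochain (φ + ψ) where
  add a c x y := by simp only [Pi.add_apply, hφ.add a c x y, hψ.add a c x y]; abel
  bal p x y l a := by simp only [Pi.add_apply, hφ.bal, hψ.bal]
  first a x l := by simp only [Pi.add_apply, hφ.first, hψ.first, add_mul]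

theorem zsmul (hφ : B.IsLCochain φ) (n : ℤ) : B.IsLCochain (n • φ) where
  add a c x y := by simp only [Pi.smul_apply, hφ.add a c x y, smul_add]
  bal p x y l a := by simp only [Pi.smul_apply, hφ.bal]
  first a x l := by simp only [Pi.smul_apply, hφ.first, smul_mul_assoc]

theorem lD_add (φ ψ : List U → A) : B.lD (φ + ψ) = B.lD φ + B.lD ψ := by
  funext w
  simp only [lD, Pi.add_apply, s_add, expand_add]

theorem lD_zsmul (n : ℤ) (φ : List U → A) : B.lD (n • φ) = n • B.lD φ := by
  funext w
  simp only [lD, Pi.smul_apply, s_zsmul, expand_zsmul]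

theorem _root_.Homog.lD {d : ℤ} (h : Homog d φ) : Homog d (B.lD φ) := by
  intro w hw
  rw [LeftBialgebroid.lD, ← B.expand_zero w]
  exact expand_congr fun l hl => by rw [h l (by rwa [hl]), s_zero]

theorem ε_lid : B.IsLCochain fun w => B.ε (lid w) where
  add a c x y := by simp only [multiAdd_lid a c x y, map_add]
  bal p x y l a := by
    rw [homog_lid _ (by simp; omega), homog_lid _ (by simp; omega)]
  first a x l := by
    cases l with
    | nil => exact B.ε_t_mul a x
    | cons y l => rw [homog_lid _ (by simp; omega), homog_lid _ (by simp; omega)]; simp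

/-- The left counit axiom says that `D_ε` is the identity of `U`. Hence the multiplication of `U`, a
product of two identities, also lies in the image of `D`. -/
theorem lD_lid : B.lD (fun w => B.ε (lid w)) = lid := by
  funext w
  match w with
  | [] => exact ((congrArg B.s (map_zero B.ε)).trans B.s_zero)
  | [x] => exact contr_counit_left x
  | x :: y :: l =>
    have : Homog 0 fun w => B.ε (lid w) := fun w hw => by simp only [homog_lid w hw, map_zero]
    rw [this.lD _ (by simp; omega), homog_lid _ (by simp; omega)]

theorem lcup (hφ : B.IsLCochain φ) (hψ : B.IsLCochain ψ) :
    B.IsLCochain fun w => B.ε (lcup (B.lD φ) (B.lD ψ) w) where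
  add a c x y := by simp only [hφ.multiAdd_lD.lcup hψ.multiAdd_lD a c x y, map_add]
  bal p x y l a := by
    congr 1
    simp only [_root_.lcup, splitSum_append_cons, splitSum_cons, hφ.lD_bal _ x y _ a,
      hψ.lD_bal _ x y _ a, hφ.lD_last, hψ.lD_first, mul_assoc]
  first a x l := by
    have : ∀ z : U, B.lD φ [] * (B.t a * z) = B.t a * (B.lD φ [] * z) := fun z => by
      rw [← mul_assoc, lD_nil_comm, mul_assoc]
    rw [← ε_t_mul]
    congr 1
    simp only [_root_.lcup, splitSum_cons, hφ.lD_first, hψ.lD_first, mul_splitSum, mul_add,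
      mul_assoc, this]

/-- For `z = D_φ(a) D_ψ(b)`, multiplicativity of `Δ` and the coproduct formulas for both factors
turn the expansion into `ε(z₍₁₎) ▷ z₍₂₎`, which is `z`. -/
theorem lD_lcup (hφ : B.IsLCochain φ) (hψ : B.IsLCochain ψ) :
    B.lD (fun w => B.ε (_root_.lcup (B.lD φ) (B.lD ψ) w)) = _root_.lcup (B.lD φ) (B.lD ψ) := by
  funext w
  have h0 : ∀ v, B.IsBal fun x y => B.s (B.ε (x * v)) * y := fun v =>
    ⟨fun x x' y => by rw [add_mul, map_add, s_add, add_mul], fun x y y' => mul_add _ _ _,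
      fun a x y => by rw [mul_assoc, ε_t_mul, s_mul, mul_assoc]⟩
  simp only [lD, _root_.lcup]
  have h1 : ∀ w : List U, B.s (B.ε (splitSum w fun a b => B.lD φ a * B.lD ψ b)) =
      splitSum w fun a b => B.s (B.ε (B.lD φ a * B.lD ψ b)) := fun w =>
    map_splitSum ((AddMonoidHom.mk' B.s B.s_add).comp B.ε.toAddMonoidHom) w _
  change B.expand (fun w => B.s (B.ε (splitSum w fun a b => B.lD φ a * B.lD ψ b))) w = _
  simp only [h1, expand_splitSum]
  refine splitSum_congr fun a b _ => ?_
  have h2 := fun v => hφ.contr_expand (P := fun z => B.s (B.ε z)) (fun x y => by rw [map_add, s_add])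
    (fun α x => by rw [ε_t_mul, s_mul]) a [] v
  simp only [List.append_nil] at h2
  have h3 := hψ.contr_expand (P := fun z => B.contr (B.lD φ a) fun x y => B.s (B.ε (x * z)) * y)
    (fun x y => by simp only [mul_add, map_add, s_add, add_mul, contr_add])
    (fun α x => by
      have := (h0 x).takeuchi (B.lD φ a) α
      simp only [mul_assoc] at this
      rw [this, contr_mul]
      simp only [mul_assoc]) b [] 1
  simp only [List.append_nil, mul_one] at h3
  have h4 := IsBal.contr_mul (h0 1) (B.lD φ a) (B.lD ψ b)
  simp only [mul_one] at h4
  rw [contr_counit_left] at h4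
  refine Eq.trans ?_ h4.symm
  refine Eq.trans (congrArg (fun f => B.expand f b) (funext fun b' => (h2 _).symm)) (h3.symm.trans ?_)
  simp only [contr_mul, mul_assoc, lD]

end IsLCochain

variable (B) in
/-- The operators `D_φ` for cochains `φ` of degree `d`. -/
def IsD (d : ℤ) (F : List U → U) : Prop :=
  ∃ φ : List U → A, B.IsLCochain φ ∧ Homog d φ ∧ B.lD φ = F

namespace IsD

variable {d e m : ℤ} {F G H : List U → U}

theorem multiAdd (h : B.IsD d F) : MultiAdd F := by
  obtain ⟨φ, h1, _, rfl⟩ := h; exact h1.multiAdd_lD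

theorem homog (h : B.IsD d F) : Homog d F := by
  obtain ⟨φ, _, h2, rfl⟩ := h; exact h2.lD

theorem isLCochain_ε (h : B.IsD d F) : B.IsLCochain fun w => B.ε (F w) := by
  obtain ⟨φ, h1, _, rfl⟩ := h
  simpa only [h1.ε_lD] using h1

theorem lD_ε (h : B.IsD d F) : B.lD (fun w => B.ε (F w)) = F := by
  obtain ⟨φ, h1, _, rfl⟩ := h
  simp only [h1.ε_lD]

theorem zero : B.IsD d (0 : List U → U) :=
  ⟨0, .zero, fun _ _ => rfl, by simpa using IsLCochain.lD_zsmul (B := B) 0 0⟩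

theorem add (h : B.IsD d F) (h' : B.IsD d G) : B.IsD d (F + G) := by
  obtain ⟨φ, h1, h2, rfl⟩ := h
  obtain ⟨ψ, h1', h2', rfl⟩ := h'
  exact ⟨_, h1.add' h1', h2.add h2', IsLCochain.lD_add _ _⟩

theorem zsmul (h : B.IsD d F) (n : ℤ) : B.IsD d (n • F) := by
  obtain ⟨φ, h1, h2, rfl⟩ := h
  exact ⟨_, h1.zsmul n, h2.zsmul n, IsLCochain.lD_zsmul _ _⟩

theorem sub (h : B.IsD d F) (h' : B.IsD d G) : B.IsD d (F - G) := by
  have := h.add (h'.zsmul (-1))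
  rwa [neg_one_smul, ← sub_eq_add_neg] at this

theorem wcirc (h : B.IsD d F) (h' : B.IsD e G) (θ : ℕ → ℤ) : B.IsD (d + e) (wcirc θ F G) := by
  obtain ⟨φ, h1, h2, rfl⟩ := h
  obtain ⟨ψ, h1', h2', rfl⟩ := h'
  exact ⟨_, h1.wcirc h1' θ, Homog.wcirc θ h1.add h2 h2'.lD, h1.lD_wcirc h1' θ⟩

theorem gcirc (h : B.IsD d F) (h' : B.IsD e G) (n : ℤ) : B.IsD (d + e) (gcirc F n G) :=
  h.wcirc h' _

theorem gbr (h : B.IsD d F) (h' : B.IsD e G) : B.IsD (d + e) (gbr d F e G) := by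
  refine ((h.gcirc h' e).zsmul _).sub ?_
  rw [add_comm]
  exact h'.gcirc h d

theorem brace₂ (h : B.IsD m H) (h' : B.IsD d F) (h'' : B.IsD e G) (n n' : ℤ) :
    B.IsD (m + d + e) (brace₂ H n F n' G) := by
  obtain ⟨φ, h1, h2, rfl⟩ := h
  obtain ⟨ψ, h1', h2', rfl⟩ := h'
  obtain ⟨χ, h1'', h2'', rfl⟩ := h''
  exact ⟨_, h1.brace₂ h1' h1'' n n', h2.brace₂ h1.add n h2'.lD n' h2''.lD, h1.lD_brace₂ h1' h1'' n n'⟩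

theorem lid : B.IsD 0 (lid : List U → U) :=
  ⟨_, .ε_lid, fun w hw => by simp only [homog_lid w hw, map_zero], IsLCochain.lD_lid⟩

theorem lcup (h : B.IsD d F) (h' : B.IsD e G) : B.IsD (d + e + 1) (lcup F G) := by
  obtain ⟨φ, h1, h2, rfl⟩ := h
  obtain ⟨ψ, h1', h2', rfl⟩ := h'
  exact ⟨_, h1.lcup h1', fun w hw => by simp only [h2.lD.lcup h2'.lD w hw, map_zero], h1.lD_lcup h1'⟩

theorem lmul : B.IsD 1 (lmul : List U → U) := lid.lcup lid

theorem hdelta (h : B.IsD d F) : B.IsD (d + 1) (hdelta d F) := by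
  rw [hdelta_eq_gbr, add_comm]
  · exact lmul.gbr h

end IsD

/-- The value of `D` does not depend on the expressions chosen for the coproducts. -/
theorem IsUCochain.expand_ofFn {Ψ : List U → U} (h : B.IsUCochain Ψ) {p : ℕ} (u : Fin p → U)
    (n : Fin p → ℕ) (x y : ∀ i, Fin (n i) → U) (hxy : ∀ i, IsRep B.η (B.Δ (u i)) (x i) (y i)) :
    B.expand Ψ (List.ofFn u) = ∑ j : (∀ i, Fin (n i)),
      Ψ (List.ofFn fun i => x i (j i)) * (List.ofFn fun i => y i (j i)).prod := by
  induction p generalizing Ψ with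
  | zero => simp [LeftBialgebroid.expand]
  | succ p ih =>
    rw [List.ofFn_succ, LeftBialgebroid.expand,
      ih (h.peel _) _ (fun i => n i.succ) (fun i => x i.succ) (fun i => y i.succ)
        fun i => hxy i.succ, ← (Fin.consEquiv fun i => Fin (n i)).sum_comp, Fintype.sum_prod_type,
      Finset.sum_comm]
    refine Finset.sum_congr rfl fun j _ => ?_
    rw [LeftBialgebroid.peel, (h.isBal _).contr_eq (hxy 0), Finset.sum_mul]
    refine Finset.sum_congr rfl fun i _ => ?_
    simp [Fin.consEquiv, List.ofFn_succ, mul_assoc]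

end LeftBialgebroid

/-! ### Cochains on families versus functions on lists. -/

theorem splitSum_eq_sum {V M : Type*} [AddCommGroup M] (w : List V) (F : List V → List V → M) :
    splitSum w F = ∑ n ∈ Finset.range (w.length + 1), F (w.take n) (w.drop n) := by
  induction w generalizing F with
  | nil => simp
  | cons x w ih =>
    rw [splitSum_cons, ih, List.length_cons, Finset.sum_range_succ' _ (w.length + 1), add_comm]
    simp

theorem splitSum_append {V M : Type*} [AddCommGroup M] (a b : List V) (F : List V → List V → M)
    (h : ∀ a' b', a' ++ b' = a ++ b → a'.length ≠ a.length → F a' b' = 0) :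
    splitSum (a ++ b) F = F a b := by
  rw [splitSum_eq_sum, Finset.sum_eq_single a.length]
  · simp
  · intro n hn hna
    refine h _ _ (List.take_append_drop _ _) ?_
    simp at hn ⊢
    omega
  · intro hn
    simp at hn

theorem wcirc_eq_sum {V M : Type*} [AddCommGroup V] [AddCommGroup M] {p q : ℕ} {f : List V → M}
    (hf : MultiAdd f) (hfp : Homog ((p : ℤ) - 1) f) {g : List V → V} (hg : Homog ((q : ℤ) - 1) g)
    (θ : ℕ → ℤ) (w : List V) (hw : w.length = p + q - 1) :
    wcirc θ f g w = ∑ i ∈ Finset.range p,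
      θ i • f (w.take i ++ g ((w.drop i).take q) :: w.drop (i + q)) := by
  -- For `p = q = 0` the truncated length `p + q - 1` is `0`; then `f` is supported on the empty
  -- list and vanishes on `[g []]`.
  rcases Nat.eq_zero_or_pos (p + q) with h0 | h0
  · obtain ⟨rfl, rfl⟩ : p = 0 ∧ q = 0 := by omega
    obtain rfl : w = [] := by simpa using hw
    have := hfp [g []] (by simp)
    simp [wcirc, this]
  have hz : ∀ (a b c : List V) (n : ℤ), b.length ≠ q → n • f (a ++ g b :: c) = 0 := by
    intro a b c n h
    rw [hg b (by omega), hf.map_zero, smul_zero]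
  rw [wcirc, splitSum_eq_sum, ← Finset.sum_subset (s₁ := Finset.range p)]
  · refine Finset.sum_congr rfl fun i hi => ?_
    have hi := Finset.mem_range.1 hi
    have hl : (w.take i).length = i := by simp; omega
    rw [← List.take_append_drop q (w.drop i), splitSum_append, hl, List.take_append_drop,
      List.drop_drop]
    intro b c _ hb
    refine hz _ _ _ _ ?_
    have : ((w.drop i).take q).length = q := by simp; omega
    omega
  · intro i hi
    simp at hi ⊢
    omega
  · intro i hi hi'
    simp at hi hi'
    refine splitSum_eq_zero fun b c hbc => hz _ _ _ _ ?_
    have := congrArg List.length hbc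
    simp at this
    omega

theorem ofFn_update' {V : Type*} {p : ℕ} (u : Fin p → V) (i : Fin p) (x : V) :
    List.ofFn (Function.update u i x) = (List.ofFn u).set i x := by
  refine List.ext_getElem (by simp) fun n h _ => ?_
  simp only [List.getElem_ofFn, List.getElem_set, Function.update_apply, Fin.ext_iff, eq_comm]

namespace LeftBialgebroid

variable {k : Type v} {A U : Type u} [CommRing k] [Ring A] [Algebra k A] [Ring U] [Algebra k U]
  {B : LeftBialgebroid k A U} {p q : ℕ}

/-- The function on lists which extends a function on families by zero. -/
def onList (f : (Fin p → U) → A) (w : List U) : A :=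
  if h : w.length = p then f fun i => w[i] else 0

theorem onList_ofFn (f : (Fin p → U) → A) (u : Fin p → U) : onList f (List.ofFn u) = f u := by
  simp [onList]

theorem onList_of_length {f : (Fin p → U) → A} {w : List U} (h : w.length = p) :
    onList f w = f fun i => w[i] := dif_pos h

theorem homog_onList (f : (Fin p → U) → A) : Homog ((p : ℤ) - 1) (onList f) := by
  intro w hw
  exact dif_neg (by omega)

theorem onList_set {f : (Fin p → U) → A} {w : List U} (h : w.length = p) (i : Fin p) (x : U) :
    onList f (w.set i x) = f (Function.update (fun i => w[i]) i x) := by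
  rw [← onList_ofFn f, ofFn_update']
  congr 2
  exact (List.ext_getElem (by simp [h]) (by simp))

theorem onList_append_cons {f : (Fin p → U) → A} {a c : List U} (z : U)
    (h : (a ++ z :: c).length = p) (x : U) :
    onList f (a ++ x :: c) = f (Function.update (fun i => (a ++ z :: c)[i])
      ⟨a.length, by simp at h; omega⟩ x) := by
  refine Eq.trans ?_ (onList_set (f := f) h ⟨a.length, by simp at h; omega⟩ x)
  simp

theorem IsCochain.isLCochain {f : (Fin p → U) → A} (hf : B.IsCochain f) :
    B.IsLCochain (onList f) where
  add a c x y := by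
    by_cases h : (a ++ x :: c).length = p
    · rw [onList_append_cons x h, onList_append_cons x h, onList_append_cons x h, hf.map_add]
    · rw [homog_onList f _ (by simp at h ⊢; omega), homog_onList f _ (by simp at h ⊢; omega),
        homog_onList f _ (by simp at h ⊢; omega), add_zero]
  bal a x y l α := by
    by_cases h : (a ++ x :: y :: l).length = p
    · have h' : ((a ++ [x]) ++ y :: l).length = p := by simpa using h
      have e := onList_append_cons (f := f) (a := a ++ [x]) y h' (B.t α * y)
      rw [List.append_assoc, List.singleton_append] at e
      rw [onList_append_cons x h, e]
      have := hf.balanced (fun i => (a ++ x :: y :: l)[i]) ⟨a.length, by simp at h; omega⟩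
        ⟨(a ++ [x]).length, by simp at h ⊢; omega⟩ α (by simp)
      simpa using this
    · rw [homog_onList f _ (by simp at h ⊢; omega), homog_onList f _ (by simp at h ⊢; omega)]
  first α x l := by
    by_cases h : (x :: l).length = p
    · have e := onList_append_cons (f := f) (a := []) x h (B.t α * x)
      have := hf.map_right (fun i => (x :: l)[i]) ⟨0, by simp at h; omega⟩ α rfl
      rw [onList_of_length h, ← this]
      simpa using e
    · rw [homog_onList f _ (by simp at h ⊢; omega), homog_onList f _ (by simp at h ⊢; omega),
        zero_mul]

/-- As `c • x = t(c • 1) x`, balancing moves the scalar leftwards to the first argument, where it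
comes out. This is why `IsLCochain` asks for additivity only. -/
theorem IsLCochain.map_smul {φ : List U → A} (h : B.IsLCochain φ) (c : k) (a : List U) (x : U)
    (l : List U) : φ (a ++ (c • x) :: l) = c • φ (a ++ x :: l) := by
  induction a using List.reverseRecOn generalizing x l with
  | nil => rw [B.smul_eq_t_mul, List.nil_append, h.first, mul_smul_comm, mul_one, List.nil_append]
  | append_singleton a z ih =>
    rw [List.append_assoc, List.append_assoc, List.singleton_append, List.singleton_append,
      B.smul_eq_t_mul, ← h.bal, t_smul, t_one, mul_smul_comm, mul_one, ih]

theorem IsLCochain.isCochain {φ : List U → A} (h : B.IsLCochain φ) :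
    B.IsCochain fun u : Fin p → U => φ (List.ofFn u) where
  map_add u i x y := by
    simp only [ofFn_update', List.set_eq_take_append_cons_drop, List.length_ofFn, i.2, if_true]
    exact h.add _ _ _ _
  map_smul u i c x := by
    simp only [ofFn_update', List.set_eq_take_append_cons_drop, List.length_ofFn, i.2, if_true]
    exact h.map_smul _ _ _ _
  balanced u i j a hij := by
    have hj : (i : ℕ) + 1 < p := by omega
    obtain rfl : j = ⟨i + 1, hj⟩ := Fin.ext hij
    have e1 : List.ofFn (Function.update u i (u i * B.t a)) = (List.ofFn u).take i ++
        (u i * B.t a) :: u ⟨i + 1, hj⟩ :: (List.ofFn u).drop (i + 2) := by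
      rw [ofFn_update', List.set_eq_take_append_cons_drop, if_pos (by simp),
        List.drop_eq_getElem_cons (by simpa)]
      simp
    have e2 : List.ofFn (Function.update u ⟨i + 1, hj⟩ (B.t a * u ⟨i + 1, hj⟩)) =
        (List.ofFn u).take i ++ u i :: (B.t a * u ⟨i + 1, hj⟩) :: (List.ofFn u).drop (i + 2) := by
      rw [ofFn_update', List.set_eq_take_append_cons_drop, if_pos (by simpa),
        List.take_succ_eq_append_getElem (by simp)]
      simp
    simp only [e1, e2]
    exact h.bal _ _ _ _ _
  map_right u i a hi := by
    have hp : 0 < p := by omega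
    obtain rfl : i = ⟨0, hp⟩ := Fin.ext hi
    obtain ⟨p, rfl⟩ := Nat.exists_eq_succ_of_ne_zero hp.ne'
    simp only [ofFn_update', List.ofFn_succ, List.set_cons_zero]
    exact h.first _ _ _

variable (B) in
/-- The operator `D_φ` on lists for a cochain `φ`. -/
noncomputable def opL (f : (Fin p → U) → A) : List U → U := B.lD (onList f)

variable (B) in
/-- The function `u ↦ ε(F(u))` on families. -/
def ev (p : ℕ) (F : List U → U) (u : Fin p → U) : A := B.ε (F (List.ofFn u))

theorem IsCochain.isD {f : (Fin p → U) → A} (hf : B.IsCochain f) : B.IsD ((p : ℤ) - 1) (B.opL f) :=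
  ⟨_, hf.isLCochain, homog_onList f, rfl⟩

theorem IsCochain.ε_opL {f : (Fin p → U) → A} (hf : B.IsCochain f) (w : List U) :
    B.ε (B.opL f w) = onList f w := hf.isLCochain.ε_lD w

theorem IsCochain.ev_opL {f : (Fin p → U) → A} (hf : B.IsCochain f) : B.ev p (B.opL f) = f := by
  funext u
  rw [ev, hf.ε_opL, onList_ofFn]

theorem IsD.isCochain_ev {d : ℤ} {F : List U → U} (hF : B.IsD d F) (p : ℕ) :
    B.IsCochain (B.ev p F) := hF.isLCochain_ε.isCochain

/-- With `IsCochain.ev_opL` this makes `p`-cochains and operators of degree `p - 1` correspond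
bijectively. -/
theorem IsD.opL_ev {F : List U → U} (hF : B.IsD ((p : ℤ) - 1) F) : B.opL (B.ev p F) = F := by
  have : onList (B.ev p F) = fun w => B.ε (F w) := by
    funext w
    by_cases h : w.length = p
    · rw [onList_of_length h, ev]
      subst h
      simp
    · rw [homog_onList _ _ (by omega), hF.homog _ (by omega), map_zero]
  rw [opL, this, hF.lD_ε]

theorem IsCochain.opD_eq {f : (Fin p → U) → A} (hf : B.IsCochain f) (u : Fin p → U)
    (n : Fin p → ℕ) (x y : ∀ i, Fin (n i) → U) (h : ∀ i, IsRep B.η (B.Δ (u i)) (x i) (y i)) :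
    B.opDAux f n x y = B.opL f (List.ofFn u) := by
  rw [opL, lD, hf.isLCochain.isUCochain.expand_ofFn u n x y h]
  simp only [onList_ofFn, opDAux]

theorem IsCochain.opD_eq_opL {f : (Fin p → U) → A} (hf : B.IsCochain f) (u : Fin p → U) :
    B.opD f u = B.opL f (List.ofFn u) := hf.opD_eq u _ _ _ fun _ => B.isRep_sw _

/-- The factor `t(a)` is absorbed by the last argument of `D_φ`. For `p = 0` one gets `ε(s(φ) t(a))
= φ a`, in agreement with the convention for `lastAct`. -/
theorem IsCochain.lastAct_eq {f : (Fin p → U) → A} (hf : B.IsCochain f) (u : Fin p → U) (a : A) :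
    B.lastAct p f u a = B.ε (B.opL f (List.ofFn u) * B.t a) := by
  cases p with
  | zero =>
    rw [lastAct, List.ofFn_zero]
    change _ = B.ε (B.s (onList f []) * B.t a)
    rw [ε_s_mul, ε_t]
    exact congrArg (f · * a) (Subsingleton.elim _ _)
  | succ p =>
    rw [lastAct, List.ofFn_succ', List.concat_eq_append, opL, ← hf.isLCochain.lD_last, hf.isLCochain.ε_lD,
      ← onList_ofFn f, List.ofFn_succ', List.concat_eq_append]
    simp

/-- This is `ε(x y) = ε(x t(ε(y)))` with `x`, `y` values of `D_φ`, `D_ψ`, together with `ε(D_ψ) =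
ψ`. -/
theorem IsCochain.cup_eq {f : (Fin p → U) → A} (hf : B.IsCochain f) {g : (Fin q → U) → A}
    (hg : B.IsCochain g) : B.cup f g = B.ev (p + q) (lcup (B.opL f) (B.opL g)) := by
  funext u
  rw [cup, hf.lastAct_eq, ev]
  have : List.ofFn u = List.ofFn (fun i => u (Fin.castAdd q i)) ++
      List.ofFn fun i => u (Fin.natAdd p i) := by
    rw [← List.ofFn_fin_append, Fin.append_castAdd_natAdd]
  rw [this, lcup, splitSum_append, ε_mul (B := B) (B.opL f _) (B.opL g _), hg.ε_opL, onList_ofFn]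
  intro a b _ h
  rw [hf.isD.homog a (by simp at h; omega), zero_mul]

theorem ε_wcirc {F : List U → U} (G : List U → U) (θ : ℕ → ℤ) (w : List U) :
    B.ε (wcirc θ F G w) = wcirc θ (fun w => B.ε (F w)) G w := by
  have := map_splitSum B.ε.toAddMonoidHom w fun a r => splitSum r fun b c => θ a.length • F (a ++ G b :: c)
  refine this.trans (splitSum_congr fun a r _ => ?_)
  refine (map_splitSum B.ε.toAddMonoidHom r _).trans (splitSum_congr fun b c _ => ?_)
  exact map_zsmul _ _ _


theorem IsCochain.gcirc_eq_sum {f : (Fin p → U) → A} (hf : B.IsCochain f) {g : List U → U}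
    (hg : Homog ((q : ℤ) - 1) g) (θ : ℕ → ℤ) (u : Fin (p + q - 1) → U) :
    B.ev (p + q - 1) (wcirc θ (B.opL f) g) u = ∑ i ∈ Finset.range p, θ i •
      onList f ((List.ofFn u).take i ++ g (((List.ofFn u).drop i).take q) ::
        (List.ofFn u).drop (i + q)) := by
  rw [ev, ε_wcirc]
  simp only [hf.ε_opL]
  exact wcirc_eq_sum hf.isLCochain.add (homog_onList f) hg θ _ (by simp)

theorem IsCochain.circ_apply {f : (Fin p → U) → A} {g : (Fin q → U) → A}
    (hg : B.IsCochain g) (i : Fin p) (u : Fin (p + q - 1) → U) :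
    B.circ i f g u = onList f ((List.ofFn u).take i ++
      B.opL g (((List.ofFn u).drop i).take q) :: (List.ofFn u).drop (i + q)) := by
  have hi := i.2
  have e : (List.ofFn fun l : Fin q => u ⟨i + l, by omega⟩) = ((List.ofFn u).drop i).take q :=
    List.ext_getElem (by simp; omega) fun n h1 h2 => by simp
  rw [onList_of_length (by simp; omega), circ]
  congr 1
  funext j
  split_ifs with h h'
  · rw [Fin.lt_def] at h
    simp only [Fin.getElem_fin]
    rw [List.getElem_append_left (by simp; omega)]
    simp
  · subst h'
    rw [hg.opD_eq_opL, e]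
    simp only [Fin.getElem_fin]
    rw [List.getElem_append_right (by simp), List.getElem_cons, dif_pos (by simp; omega)]
  · have hij : (i : ℕ) < j := by
      rw [Fin.lt_def] at h
      have := fun h => h' (Fin.ext h)
      omega
    simp only [Fin.getElem_fin]
    rw [List.getElem_append_right (by simp; omega), List.getElem_cons, dif_neg (by simp; omega)]
    simp only [List.getElem_drop, List.getElem_ofFn]
    congr 2
    simp
    omega

/-- The indicator of position `i` as weight selects the single term `∘ᵢ`. -/
theorem IsCochain.circ_eq {f : (Fin p → U) → A} (hf : B.IsCochain f) {g : (Fin q → U) → A}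
    (hg : B.IsCochain g) (i : Fin p) :
    B.circ i f g = B.ev (p + q - 1)
      (wcirc (fun n => if n = i then 1 else 0) (B.opL f) (B.opL g)) := by
  funext u
  rw [hf.gcirc_eq_sum hg.isD.homog, hg.circ_apply, Finset.sum_eq_single (i : ℕ)]
  · simp
  · intro j _ hj
    simp [hj]
  · intro h
    simp at h

theorem ev_sub (F G : List U → U) : B.ev p (F - G) = B.ev p F - B.ev p G := by
  funext u; simp [ev]

theorem ev_add (F G : List U → U) : B.ev p (F + G) = B.ev p F + B.ev p G := by
  funext u; simp [ev]

theorem ev_zsmul (n : ℤ) (F : List U → U) : B.ev p (n • F) = n • B.ev p F :=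
  funext fun u => map_zsmul B.ε n (F (List.ofFn u))

theorem IsCochain.circBar_eq {f : (Fin p → U) → A} (hf : B.IsCochain f) {g : (Fin q → U) → A}
    (hg : B.IsCochain g) : B.circBar f g = B.ev (p + q - 1)
      (sgn (((p : ℤ) - 1) * ((q : ℤ) - 1)) • gcirc (B.opL f) ((q : ℤ) - 1) (B.opL g)) := by
  funext u
  rw [circBar, ev_zsmul, gcirc, Pi.smul_apply, Pi.smul_apply, hf.gcirc_eq_sum hg.isD.homog,
    Finset.sum_apply]
  simp only [Pi.smul_apply, hg.circ_apply]
  rw [Finset.sum_range]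

theorem IsCochain.bracket_eq {f : (Fin p → U) → A} (hf : B.IsCochain f) {g : (Fin q → U) → A}
    (hg : B.IsCochain g) : B.bracket f g = B.ev (p + q - 1)
      (gbr ((p : ℤ) - 1) (B.opL f) ((q : ℤ) - 1) (B.opL g)) := by
  funext u
  have e : (List.ofFn fun j => u (Fin.cast (by omega : q + p - 1 = p + q - 1) j)) = List.ofFn u :=
    List.ext_getElem (by simp; omega) fun n h1 h2 => by simp
  rw [gbr, ev_sub, bracket, hf.circBar_eq hg, hg.circBar_eq hf, Pi.sub_apply, Pi.sub_apply,
    Pi.smul_apply, ev_zsmul _ (gcirc (B.opL g) _ _), Pi.smul_apply, smul_smul, mul_comm ((q : ℤ) - 1),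
    sgn_mul_self, one_smul]
  congr 1
  exact congrArg (fun l => B.ε (gcirc (B.opL g) _ (B.opL f) l)) e

/-- The outer terms are `ε(u D_φ(…)) = u · φ(…)` and `ε(D_φ(…) u) = ε(D_φ(…) t(ε(u)))`; the inner
ones are the insertions of the multiplication. -/
theorem IsCochain.δ_eq {f : (Fin p → U) → A} (hf : B.IsCochain f) :
    B.δ p f = B.ev (p + 1) (hdelta ((p : ℤ) - 1) (B.opL f)) := by
  funext u
  have e1 : B.ev (p + 1) (lcup lid (B.opL f)) u = B.act (u 0) (f (Fin.tail u)) := by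
    have : List.ofFn u = [u 0] ++ List.ofFn (Fin.tail u) := by rw [List.ofFn_succ]; rfl
    rw [ev, this, lcup, splitSum_append, lid, ε_mul_eq_act, hf.ε_opL, onList_ofFn]
    intro a b _ h
    rw [homog_lid a (by simp at h; omega), zero_mul]
  have e2 : B.ev (p + 1) (lcup (B.opL f) lid) u =
      B.lastAct p f (Fin.init u) (B.ε (u (Fin.last p))) := by
    have : List.ofFn u = List.ofFn (Fin.init u) ++ [u (Fin.last p)] := by
      rw [List.ofFn_succ', List.concat_eq_append]; rfl
    rw [ev, this, lcup, splitSum_append, hf.lastAct_eq, lid, ε_mul]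
    intro a b _ h
    rw [hf.isD.homog a (by simp at h; omega), zero_mul]
  have e3 : B.ev (p + 1) (gcirc (B.opL f) 1 lmul) u =
      ∑ i : Fin p, sgn i • f (Fin.contractNth i.castSucc (· * ·) u) := by
    refine (hf.gcirc_eq_sum (q := 2) (g := lmul) homog_lmul _ u).trans ?_
    rw [Finset.sum_range]
    refine Finset.sum_congr rfl fun i _ => ?_
    rw [one_mul]
    congr 1
    rw [onList_of_length (by simp; omega)]
    congr 1
    funext j
    have hi := i.2
    have hj := j.2
    have e : ((List.ofFn u).drop i).take 2 = [u i.castSucc, u i.succ] :=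
      List.ext_getElem (by simp; omega) fun n h1 h2 => by
        have : n < 2 := h2
        interval_cases n <;> simp [-List.ofFn_succ] <;> congr
    rw [Fin.contractNth]
    simp only [Fin.getElem_fin, e]
    rcases lt_trichotomy (j : ℕ) (i : ℕ) with h | h | h
    · rw [List.getElem_append_left (by simp; omega), if_pos (by simpa)]
      simp [-List.ofFn_succ]
      rfl
    · rw [List.getElem_append_right (by simp; omega), if_neg (by simp; omega), if_pos (by simpa),
        List.getElem_cons, dif_pos (by simp; omega)]
      obtain rfl : j = i := Fin.ext h
      simp [lmul, lcup, splitSum_cons, lid]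
    · rw [List.getElem_append_right (by simp; omega), if_neg (by simp; omega),
        if_neg (by simp; omega), List.getElem_cons, dif_neg (by simp; omega)]
      simp only [List.getElem_drop, List.getElem_ofFn]
      congr 1
      ext
      simp
      omega
  rw [hdelta, ev_sub, ev_add, ev_zsmul, Pi.sub_apply, Pi.add_apply, Pi.smul_apply, e1, e2, e3]
  have s1 : ∀ n : ℤ, sgn (n + 1) = -sgn n := fun n => by
    rw [sgn_add, sgn_one, mul_neg_one]
  have s2 : sgn ((p : ℤ) + 1) = sgn ((p : ℤ) - 1) := sgn_congr (by ring_nf; decide)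
  simp only [δ, LinearMap.coe_mk, AddHom.coe_mk, s2]
  simp only [s1, neg_smul, Finset.sum_neg_distrib]
  abel

end LeftBialgebroid

/-! ### Cocycles and the induced operations on cohomology. -/

namespace LeftBialgebroid

variable {k : Type v} {A U : Type u} [CommRing k] [Ring A] [Algebra k A] [Ring U] [Algebra k U]
  {B : LeftBialgebroid k A U} {p q : ℕ}

/-! ### Linearity over the ground ring -/

section Scalars

theorem ev_smul (c : k) (F : List U → U) : B.ev p (c • F) = c • B.ev p F :=
  funext fun u => B.ε.map_smul c (F (List.ofFn u))

theorem smul_splitSum' {M : Type*} [AddCommGroup M] [Module k M] (c : k) {V : Type*} (w : List V)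
    (F : List V → List V → M) : c • splitSum w F = splitSum w fun a b => c • F a b :=
  map_splitSum (DistribSMul.toAddMonoidHom M c) w F

theorem lcup_smul_left' (c : k) (F G : List U → U) : lcup (c • F) G = c • lcup F G := by
  funext w
  simp only [lcup, Pi.smul_apply, smul_splitSum' (M := U) c, smul_mul_assoc]

theorem lcup_smul_right' (c : k) (F G : List U → U) : lcup F (c • G) = c • lcup F G := by
  funext w
  simp only [lcup, Pi.smul_apply, smul_splitSum' (M := U) c, mul_smul_comm]

theorem gcirc_smul_left' (c : k) (F : List U → U) (d : ℤ) (G : List U → U) :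
    gcirc (c • F) d G = c • gcirc F d G := by
  funext w
  simp only [gcirc_apply, Pi.smul_apply, smul_splitSum' (M := U) c, smul_comm c]

theorem IsD.ev_gcirc_smul {d : ℤ} {F : List U → U} (hF : B.IsD d F) (c : k) (e : ℤ)
    (G : List U → U) : B.ev p (_root_.gcirc F e (c • G)) = c • B.ev p (_root_.gcirc F e G) := by
  funext u
  rw [Pi.smul_apply, ev, ev, _root_.gcirc, _root_.gcirc, ε_wcirc (B := B), ε_wcirc (B := B)]
  simp only [_root_.wcirc, Pi.smul_apply, smul_splitSum' (M := A) c, smul_comm c]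
  refine splitSum_congr fun a r _ => splitSum_congr fun b l _ => ?_
  congr 1
  exact hF.isLCochain_ε.map_smul c a (G b) l

theorem IsD.ev_gbr_smul_left {d e : ℤ} {F G : List U → U} (hG : B.IsD e G) (c : k) :
    B.ev p (_root_.gbr d (c • F) e G) = c • B.ev p (_root_.gbr d F e G) := by
  rw [_root_.gbr, _root_.gbr, ev_sub, ev_sub, hG.ev_gcirc_smul, gcirc_smul_left', ev_zsmul, ev_zsmul, ev_smul,
    smul_sub, smul_comm c]

theorem IsD.ev_gbr_smul_right {d e : ℤ} {F G : List U → U} (hF : B.IsD d F) (c : k) :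
    B.ev p (_root_.gbr d F e (c • G)) = c • B.ev p (_root_.gbr d F e G) := by
  rw [_root_.gbr, _root_.gbr, ev_sub, ev_sub, ev_zsmul, ev_zsmul, hF.ev_gcirc_smul, gcirc_smul_left', ev_smul,
    smul_sub, smul_comm c]

theorem opL_add (f g : (Fin p → U) → A) : B.opL (f + g) = B.opL f + B.opL g := by
  rw [opL, opL, opL, ← IsLCochain.lD_add]
  congr 1
  funext w
  rw [Pi.add_apply]
  simp only [onList]
  split_ifs <;> simp

theorem opL_smul (c : k) (f : (Fin p → U) → A) : B.opL (c • f) = c • B.opL f := by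
  funext w
  rw [Pi.smul_apply, B.smul_eq_s_mul, opL, opL, lD, lD, mul_expand]
  congr 1
  funext w
  simp only [onList]
  split_ifs <;> simp [s_smul, s_one, s_zero]

theorem opL_zero : B.opL (0 : (Fin p → U) → A) = 0 := by
  have := B.opL_smul (0 : k) (0 : (Fin p → U) → A)
  simpa using this

end Scalars

theorem gbr_zero_left {d : ℤ} {R : Type*} [AddCommGroup R] {G : List R → R} (hG : MultiAdd G) (e : ℤ) :
    gbr d 0 e G = 0 := by
  rw [gbr, gcirc_zero_left, gcirc_zero_right hG, smul_zero, sub_zero]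

theorem gbr_zero_right {d : ℤ} {R : Type*} [AddCommGroup R] {G : List R → R} (hG : MultiAdd G) (e : ℤ) :
    gbr d G e 0 = 0 := by
  rw [gbr, gcirc_zero_left, gcirc_zero_right hG, smul_zero, sub_zero]

theorem IsD.ev_injective {F : List U → U} (hF : B.IsD ((p : ℤ) - 1) F) (h : B.ev p F = 0) :
    F = 0 := by
  rw [← hF.opL_ev, h, opL_zero]

theorem IsD.ev_eq_zero {m : ℤ} {F : List U → U} (hF : B.IsD m F) (h : m + 1 ≠ p) :
    B.ev p F = 0 := by
  funext u
  rw [ev, hF.homog _ (by simp; omega), map_zero]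
  rfl

theorem IsD.δ_ev {F : List U → U} (hF : B.IsD ((p : ℤ) - 1) F) :
    B.δ p (B.ev p F) = B.ev (p + 1) (_root_.hdelta ((p : ℤ) - 1) F) := by
  rw [(hF.isCochain_ev p).δ_eq, hF.opL_ev]

/-! ### Cocycles on lists -/

variable (B) in
/-- `F` is an operator `D_φ` for a cocycle `φ` of degree `m = p - 1`; the operator `0` is allowed
in all degrees. -/
structure IsZ (p : ℕ) (m : ℤ) (F : List U → U) : Prop where
  isD : B.IsD m F
  hdelta : hdelta m F = 0
  deg : m + 1 = p ∨ F = 0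

namespace IsZ

variable {m n l : ℤ} {r : ℕ} {F G K : List U → U}

theorem mem_cocycles (h : B.IsZ p m F) : B.ev p F ∈ B.cocycles p := by
  refine ⟨h.isD.isCochain_ev p, ?_⟩
  rcases h.deg with h' | h'
  · obtain rfl : m = p - 1 := by omega
    change B.δ p (B.ev p F) = 0
    rw [h.isD.δ_ev, h.hdelta]
    funext u; simp [ev]
  · have : B.ev p F = 0 := by rw [h']; funext u; simp [ev]
    rw [this]
    exact zero_mem _

theorem of_mem {f : (Fin p → U) → A} (h : f ∈ B.cocycles p) : B.IsZ p (p - 1) (B.opL f) := by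
  have hf : B.IsCochain f := h.1
  refine ⟨hf.isD, ?_, Or.inl (by omega)⟩
  have h1 : B.IsD (((p + 1 : ℕ) : ℤ) - 1) (_root_.hdelta ((p : ℤ) - 1) (B.opL f)) := by
    have := hf.isD.hdelta
    rwa [show ((p + 1 : ℕ) : ℤ) - 1 = (p : ℤ) - 1 + 1 by push_cast; ring]
  refine h1.ev_injective ?_
  rw [← hf.δ_eq]
  exact h.2

theorem zero : B.IsZ p m 0 := ⟨.zero, hdelta_zero m, Or.inr rfl⟩

theorem add (h : B.IsZ p m F) (h' : B.IsZ p m G) : B.IsZ p m (F + G) := by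
  refine ⟨h.isD.add h'.isD, by rw [hdelta_add, h.hdelta, h'.hdelta, add_zero], ?_⟩
  rcases h.deg with h1 | h1
  · exact Or.inl h1
  · rcases h'.deg with h2 | h2
    · exact Or.inl h2
    · right; rw [h1, h2, add_zero]

theorem zsmul (h : B.IsZ p m F) (a : ℤ) : B.IsZ p m (a • F) := by
  refine ⟨h.isD.zsmul a, by rw [hdelta_smul, h.hdelta, smul_zero], ?_⟩
  exact h.deg.imp_right fun h => by rw [h, smul_zero]

theorem lcup (h : B.IsZ p m F) (h' : B.IsZ q n G) : B.IsZ (p + q) (m + n + 1) (lcup F G) := by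
  refine ⟨h.isD.lcup h'.isD, ?_, ?_⟩
  · rw [hdelta_lcup h.isD.homog, h.hdelta, h'.hdelta, lcup_zero_left, lcup_zero_right, smul_zero,
      add_zero]
  · rcases h.deg with h1 | rfl
    · rcases h'.deg with h2 | rfl
      · left; push_cast; omega
      · right; rw [lcup_zero_right]
    · right; rw [lcup_zero_left]

theorem gbr (h : B.IsZ p m F) (h' : B.IsZ q n G) : B.IsZ (p + q - 1) (m + n) (gbr m F n G) := by
  have h0 := h.isD.gbr h'.isD
  refine ⟨h0, ?_, ?_⟩
  · rw [hdelta_gbr h.isD.multiAdd h'.isD.multiAdd h.isD.homog h'.isD.homog, h.hdelta, h'.hdelta,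
      gbr_zero_left h'.isD.multiAdd, gbr_zero_right h.isD.multiAdd, smul_zero, add_zero]
  · rcases h.deg with h1 | rfl
    · rcases h'.deg with h2 | rfl
      -- For `p = q = 0` the true degree is `-2` while `p + q - 1` is truncated to `0`; the bracket
      -- is then zero.
      · by_cases hpq : p + q = 0
        · right
          exact h0.homog.eq_zero (by omega)
        · left; omega
      · right; rw [gbr_zero_right h.isD.multiAdd]
    · right; rw [gbr_zero_left h'.isD.multiAdd]

end IsZ

/-- No relation between `m` and `p` is needed: if `p ≠ m + 2`, the evaluation vanishes by
homogeneity. -/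
theorem IsD.ev_hdelta_mem {m : ℤ} {G : List U → U} (hG : B.IsD m G) :
    B.ev p (_root_.hdelta m G) ∈ B.coboundaries p := by
  by_cases hp : m + 1 + 1 = p
  · cases p with
    | zero =>
      have : G = 0 := hG.homog.eq_zero (by push_cast at hp; omega)
      have : B.ev 0 (_root_.hdelta m G) = 0 := by
        rw [this, hdelta_zero]; funext u; simp [ev]
      rw [this]
      exact zero_mem _
    | succ p =>
      obtain rfl : m = p - 1 := by push_cast at hp; omega
      exact ⟨_, hG.isCochain_ev p, hG.δ_ev⟩
  · rw [hG.hdelta.ev_eq_zero hp]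
    exact zero_mem _

theorem exists_hdelta_of_mem {f : (Fin p → U) → A} (h : f ∈ B.coboundaries p) :
    ∃ G, B.IsD ((p : ℤ) - 1 - 1) G ∧ B.opL f = hdelta ((p : ℤ) - 1 - 1) G := by
  cases p with
  | zero =>
    obtain rfl : f = 0 := h
    exact ⟨0, .zero, by rw [opL_zero, hdelta_zero]⟩
  | succ p =>
    obtain ⟨g, hg, rfl⟩ := h
    have hg : B.IsCochain g := hg
    have e : ((p + 1 : ℕ) : ℤ) - 1 - 1 = p - 1 := by push_cast; ring
    rw [e]
    refine ⟨B.opL g, hg.isD, ?_⟩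
    rw [hg.δ_eq]
    refine IsD.opL_ev ?_
    have := hg.isD.hdelta
    rwa [show ((p + 1 : ℕ) : ℤ) - 1 = (p : ℤ) - 1 + 1 by push_cast; ring]

/-! ### Operations on cohomology -/

variable (B) in
/-- The cup product of cocycles, with values in the cohomology. -/
def cupZ (p q : ℕ) : B.cocycles p →ₗ[k] B.cocycles q →ₗ[k] B.H (p + q) :=
  LinearMap.mk₂ k (fun f g => B.cls (B.cup f.1 g.1) (by
      rw [IsCochain.cup_eq f.2.1 g.2.1]
      exact ((IsZ.of_mem f.2).lcup (IsZ.of_mem g.2)).mem_cocycles))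
    (fun f f' g => congrArg _ (Subtype.ext (by
      change B.cup (f.1 + f'.1) g.1 = B.cup f.1 g.1 + B.cup f'.1 g.1
      rw [IsCochain.cup_eq (f := f.1 + f'.1) (f + f').2.1 g.2.1, IsCochain.cup_eq f.2.1 g.2.1,
        IsCochain.cup_eq f'.2.1 g.2.1, opL_add, lcup_add_left, ev_add])))
    (fun c f g => congrArg _ (Subtype.ext (by
      change B.cup (c • f.1) g.1 = c • B.cup f.1 g.1
      rw [IsCochain.cup_eq (f := c • f.1) (c • f).2.1 g.2.1, IsCochain.cup_eq f.2.1 g.2.1, opL_smul,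
        lcup_smul_left', ev_smul])))
    (fun f g g' => congrArg _ (Subtype.ext (by
      change B.cup f.1 (g.1 + g'.1) = B.cup f.1 g.1 + B.cup f.1 g'.1
      rw [IsCochain.cup_eq f.2.1 (g := g.1 + g'.1) (g + g').2.1, IsCochain.cup_eq f.2.1 g.2.1,
        IsCochain.cup_eq f.2.1 g'.2.1, opL_add, lcup_add_right, ev_add])))
    (fun c f g => congrArg _ (Subtype.ext (by
      change B.cup f.1 (c • g.1) = c • B.cup f.1 g.1
      rw [IsCochain.cup_eq f.2.1 (g := c • g.1) (c • g).2.1, IsCochain.cup_eq f.2.1 g.2.1, opL_smul,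
        lcup_smul_right', ev_smul])))

theorem cls_eq_zero {f : (Fin p → U) → A} (hf : f ∈ B.cocycles p) (h : f ∈ B.coboundaries p) :
    B.cls f hf = 0 := (Submodule.Quotient.mk_eq_zero _).2 h

variable (B) in
/-- The cup product on cohomology. -/
def cupH (p q : ℕ) : B.H p →ₗ[k] B.H q →ₗ[k] B.H (p + q) :=
  (B.cupZ p q).liftQ₂ _ _
    (fun f hf => LinearMap.ext fun g => cls_eq_zero _ (by
      obtain ⟨G, hG, hG'⟩ := exists_hdelta_of_mem hf
      have h := hdelta_lcup (e := (q : ℤ) - 1) (g := B.opL g.1) hG.homog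
      rw [(IsZ.of_mem g.2).hdelta, lcup_zero_right, smul_zero, add_zero, ← hG'] at h
      change _ = lcup (B.opL f.1) (B.opL g.1) at h
      rw [IsCochain.cup_eq f.2.1 g.2.1, ← h]
      exact (hG.lcup (IsZ.of_mem g.2).isD).ev_hdelta_mem))
    (fun g hg => LinearMap.ext fun f => cls_eq_zero _ (by
      obtain ⟨G, hG, hG'⟩ := exists_hdelta_of_mem hg
      have h := hdelta_lcup (e := (q : ℤ) - 1 - 1) (g := G) (IsZ.of_mem f.2).isD.homog
      rw [(IsZ.of_mem f.2).hdelta, lcup_zero_left, zero_add, ← hG'] at h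
      have h' := congrArg (sgn ((p : ℤ) - 1 + 1) • ·) h
      simp only [smul_smul, sgn_mul_self, one_smul, ← hdelta_smul] at h'
      change _ = lcup (B.opL f.1) (B.opL g.1) at h'
      rw [IsCochain.cup_eq f.2.1 g.2.1, ← h']
      exact (((IsZ.of_mem f.2).isD.lcup hG).zsmul _).ev_hdelta_mem))

end LeftBialgebroid

/-! ### The bracket on cohomology and the Gerstenhaber axioms. -/

theorem gbr_add_left {R : Type*} [AddCommGroup R] (d : ℤ) (F F' : List R → R) (e : ℤ)
    {G : List R → R} (hG : MultiAdd G) : gbr d (F + F') e G = gbr d F e G + gbr d F' e G := by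
  rw [gbr, gbr, gbr, gcirc_add_left, gcirc_add_right hG, smul_add]
  abel

theorem gbr_add_right {R : Type*} [AddCommGroup R] (d : ℤ) {F : List R → R} (hF : MultiAdd F) (e : ℤ)
    (G G' : List R → R) : gbr d F e (G + G') = gbr d F e G + gbr d F e G' := by
  rw [gbr, gbr, gbr, gcirc_add_left, gcirc_add_right hF, smul_add]
  abel

namespace LeftBialgebroid

variable {k : Type v} {A U : Type u} [CommRing k] [Ring A] [Algebra k A] [Ring U] [Algebra k U]
  {B : LeftBialgebroid k A U} {p q r : ℕ}

variable (B) in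
/-- The bracket of cocycles, with values in the cohomology. -/
noncomputable def bracketZ (p q : ℕ) :
    B.cocycles p →ₗ[k] B.cocycles q →ₗ[k] B.H (p + q - 1) :=
  LinearMap.mk₂ k (fun f g => B.cls (B.bracket f.1 g.1) (by
      rw [IsCochain.bracket_eq f.2.1 g.2.1]
      exact ((IsZ.of_mem f.2).gbr (IsZ.of_mem g.2)).mem_cocycles))
    (fun f f' g => congrArg _ (Subtype.ext (by
      change B.bracket (f.1 + f'.1) g.1 = B.bracket f.1 g.1 + B.bracket f'.1 g.1
      rw [IsCochain.bracket_eq (f := f.1 + f'.1) (f + f').2.1 g.2.1, IsCochain.bracket_eq f.2.1 g.2.1,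
        IsCochain.bracket_eq f'.2.1 g.2.1, opL_add, gbr_add_left _ _ _ _ (IsZ.of_mem g.2).isD.multiAdd,
        ev_add])))
    (fun c f g => congrArg _ (Subtype.ext (by
      change B.bracket (c • f.1) g.1 = c • B.bracket f.1 g.1
      rw [IsCochain.bracket_eq (f := c • f.1) (c • f).2.1 g.2.1, IsCochain.bracket_eq f.2.1 g.2.1,
        opL_smul, (IsZ.of_mem g.2).isD.ev_gbr_smul_left])))
    (fun f g g' => congrArg _ (Subtype.ext (by
      change B.bracket f.1 (g.1 + g'.1) = B.bracket f.1 g.1 + B.bracket f.1 g'.1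
      rw [IsCochain.bracket_eq f.2.1 (g := g.1 + g'.1) (g + g').2.1, IsCochain.bracket_eq f.2.1 g.2.1,
        IsCochain.bracket_eq f.2.1 g'.2.1, opL_add,
        gbr_add_right _ (IsZ.of_mem f.2).isD.multiAdd, ev_add])))
    (fun c f g => congrArg _ (Subtype.ext (by
      change B.bracket f.1 (c • g.1) = c • B.bracket f.1 g.1
      rw [IsCochain.bracket_eq f.2.1 (g := c • g.1) (c • g).2.1, IsCochain.bracket_eq f.2.1 g.2.1,
        opL_smul, (IsZ.of_mem f.2).isD.ev_gbr_smul_right])))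

variable (B) in
/-- The Gerstenhaber bracket on cohomology. -/
noncomputable def bracketH (p q : ℕ) : B.H p →ₗ[k] B.H q →ₗ[k] B.H (p + q - 1) :=
  (B.bracketZ p q).liftQ₂ _ _
    (fun f hf => LinearMap.ext fun g => cls_eq_zero _ (by
      obtain ⟨G, hG, hG'⟩ := exists_hdelta_of_mem hf
      have hg := IsZ.of_mem g.2
      have h := hdelta_gbr hG.multiAdd hg.isD.multiAdd hG.homog hg.isD.homog
      rw [hg.hdelta, gbr_zero_right hG.multiAdd, smul_zero, add_zero, ← hG', sub_add_cancel] at h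
      change _ = gbr _ (B.opL f.1) _ (B.opL g.1) at h
      rw [IsCochain.bracket_eq f.2.1 g.2.1, ← h]
      exact (hG.gbr hg.isD).ev_hdelta_mem))
    (fun g hg => LinearMap.ext fun f => cls_eq_zero _ (by
      obtain ⟨G, hG, hG'⟩ := exists_hdelta_of_mem hg
      have hf := IsZ.of_mem f.2
      have h := hdelta_gbr hf.isD.multiAdd hG.multiAdd hf.isD.homog hG.homog
      rw [hf.hdelta, gbr_zero_left hG.multiAdd, zero_add, ← hG', sub_add_cancel] at h
      have h' := congrArg (sgn ((p : ℤ) - 1) • ·) h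
      simp only [smul_smul, sgn_mul_self, one_smul, ← hdelta_smul] at h'
      change _ = gbr _ (B.opL f.1) _ (B.opL g.1) at h'
      rw [IsCochain.bracket_eq f.2.1 g.2.1, ← h']
      exact ((hf.isD.gbr hG).zsmul _).ev_hdelta_mem))

/-- The direct sum of a family of abelian groups. -/
abbrev _root_.GradedSum (V : ℕ → Type*) [∀ n, AddCommGroup (V n)] : Type _ := DirectSum ℕ V

/-- The inclusion of a homogeneous component. -/
abbrev _root_.GradedSum.of (V : ℕ → Type*) [∀ n, AddCommGroup (V n)] (n : ℕ) :
    V n →+ GradedSum V := DirectSum.of V n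

open Classical in
variable (B) in
/-- The cohomology class of `ε ∘ F`. -/
noncomputable def hcls (p : ℕ) (F : List U → U) : B.H p :=
  if h : B.ev p F ∈ B.cocycles p then B.cls (B.ev p F) h else 0

variable (B) in
/-- The cohomology class of `ε ∘ F` in degree `m + 1`, as an element of the direct sum. -/
noncomputable def dcls (m : ℤ) (F : List U → U) : GradedSum B.H :=
  GradedSum.of B.H (m + 1).toNat (B.hcls (m + 1).toNat F)

theorem hcls_opL {f : (Fin p → U) → A} (hf : f ∈ B.cocycles p) :
    B.hcls p (B.opL f) = B.cls f hf := by
  have h : B.ev p (B.opL f) = f := IsCochain.ev_opL hf.1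
  rw [hcls, dif_pos (by rwa [h])]
  exact congrArg _ (Subtype.ext h)

theorem exists_hcls (a : B.H p) : ∃ F, B.IsZ p (p - 1) F ∧ B.hcls p F = a := by
  obtain ⟨⟨f, hf⟩, rfl⟩ := Submodule.Quotient.mk_surjective _ a
  exact ⟨_, IsZ.of_mem hf, hcls_opL hf⟩

namespace IsZ

variable {m n l : ℤ} {F G K : List U → U}

theorem hcls_eq (h : B.IsZ p m F) : B.hcls p F = B.cls (B.ev p F) h.mem_cocycles :=
  dif_pos _

theorem opL_ev (h : B.IsZ p m F) : B.opL (B.ev p F) = F := by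
  rcases h.deg with h1 | rfl
  · obtain rfl : m = p - 1 := by omega
    exact h.isD.opL_ev
  · exact (congrArg B.opL (show B.ev p 0 = 0 by funext u; simp [ev])).trans opL_zero

theorem eq_or (h : B.IsZ p m F) : m = p - 1 ∨ F = 0 := h.deg.imp_left fun h => by omega

theorem cupH_hcls (h : B.IsZ p m F) (h' : B.IsZ q n G) :
    B.cupH p q (B.hcls p F) (B.hcls q G) = B.hcls (p + q) (_root_.lcup F G) := by
  rw [h.hcls_eq, h'.hcls_eq, (h.lcup h').hcls_eq]
  refine congrArg _ (Subtype.ext ?_)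
  change B.cup (B.ev p F) (B.ev q G) = _
  rw [IsCochain.cup_eq h.mem_cocycles.1 h'.mem_cocycles.1, h.opL_ev, h'.opL_ev]

theorem bracketH_hcls (h : B.IsZ p m F) (h' : B.IsZ q n G) :
    B.bracketH p q (B.hcls p F) (B.hcls q G) = B.hcls (p + q - 1) (_root_.gbr m F n G) := by
  rw [h.hcls_eq, h'.hcls_eq, (h.gbr h').hcls_eq]
  refine congrArg _ (Subtype.ext ?_)
  change B.bracket (B.ev p F) (B.ev q G) = _
  rw [IsCochain.bracket_eq h.mem_cocycles.1 h'.mem_cocycles.1, h.opL_ev, h'.opL_ev]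
  congr 1
  rcases h.eq_or with rfl | rfl
  · rcases h'.eq_or with rfl | rfl
    · rfl
    · rw [gbr_zero_right h.isD.multiAdd, gbr_zero_right h.isD.multiAdd]
  · rw [gbr_zero_left h'.isD.multiAdd, gbr_zero_left h'.isD.multiAdd]

theorem hcls_add (h : B.IsZ p m F) (h' : B.IsZ p m G) :
    B.hcls p (F + G) = B.hcls p F + B.hcls p G := by
  rw [(h.add h').hcls_eq, h.hcls_eq, h'.hcls_eq]
  exact congrArg _ (Subtype.ext (ev_add _ _))

theorem hcls_zero : B.hcls p 0 = 0 := by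
  have h : B.IsZ p 0 0 := .zero
  have := h.hcls_add h
  rwa [add_zero, left_eq_add] at this

theorem hcls_zsmul (h : B.IsZ p m F) (a : ℤ) : B.hcls p (a • F) = a • B.hcls p F := by
  rw [(h.zsmul a).hcls_eq, h.hcls_eq]
  exact congrArg _ (Subtype.ext (ev_zsmul _ _))

theorem of_hcls (h : B.IsZ p m F) : GradedSum.of B.H p (B.hcls p F) = B.dcls m F := by
  rcases h.eq_or with rfl | rfl
  · rw [dcls]
    have : ((p : ℤ) - 1 + 1).toNat = p := by omega
    rw [this]
  · rw [dcls, hcls_zero, hcls_zero, map_zero, map_zero]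

theorem toNat (h : B.IsZ p m F) : B.IsZ (m + 1).toNat m F := by
  refine ⟨h.isD, h.hdelta, ?_⟩
  rcases h.deg with h1 | h1
  · left; omega
  · exact Or.inr h1

theorem dcls_add (h : B.IsZ p m F) (h' : B.IsZ q m G) :
    B.dcls m (F + G) = B.dcls m F + B.dcls m G := by
  rw [dcls, h.toNat.hcls_add h'.toNat, map_add]
  rfl

theorem dcls_zsmul (h : B.IsZ p m F) (a : ℤ) : B.dcls m (a • F) = a • B.dcls m F := by
  rw [dcls, h.toNat.hcls_zsmul, map_zsmul]
  rfl

/-- Homotopic operators are compared by their integer degree in the direct sum, which avoids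
transport between the groups `B.H p` and `B.H q`. -/
theorem dcls_eq (h : B.IsZ p m F) (h' : B.IsZ q m G) (hK : B.IsD n K) (hn : n + 1 = m)
    (e : _root_.hdelta n K = F - G) : B.dcls m F = B.dcls m G := by
  subst hn
  have h1 : B.IsZ (n + 1 + 1).toNat (n + 1) (F - G) := by
    rw [sub_eq_add_neg, ← neg_one_smul ℤ]
    exact h.toNat.add (h'.toNat.zsmul _)
  have h2 : B.dcls (n + 1) (F - G) = 0 := by
    rw [dcls, h1.hcls_eq, cls_eq_zero, map_zero]
    rw [← e]
    exact hK.ev_hdelta_mem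
  have h3 := h1.dcls_add h'
  rwa [sub_add_cancel, h2, zero_add] at h3

end IsZ

/-! ### The Gerstenhaber algebra -/

variable (B) in
theorem one_mem_cocycles : (fun _ => 1 : (Fin 0 → U) → A) ∈ B.cocycles 0 := by
  have h : B.IsCochain (fun _ => 1 : (Fin 0 → U) → A) :=
    ⟨fun _ i => i.elim0, fun _ i => i.elim0, fun _ i => i.elim0, fun _ i => i.elim0⟩
  refine ⟨h, ?_⟩
  change B.δ 0 _ = 0
  funext u
  simp [δ, act, s_one, lastAct, sgn_one]

theorem opL_one : B.opL (fun _ => 1 : (Fin 0 → U) → A) = fun w => if w = [] then 1 else 0 := by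
  funext w
  cases w with
  | nil => exact B.s_one
  | cons x w => exact (IsZ.of_mem B.one_mem_cocycles).isD.homog _ (by simp; omega)

theorem lcup_opL_one_left (F : List U → U) : lcup (B.opL (fun _ => 1 : (Fin 0 → U) → A)) F = F := by
  rw [opL_one]
  funext w
  refine (splitSum_append [] w _ fun a b _ h => ?_).trans (one_mul _)
  beta_reduce
  rw [if_neg fun h' => h (by rw [h']), zero_mul]

theorem lcup_opL_one_right (F : List U → U) : lcup F (B.opL (fun _ => 1 : (Fin 0 → U) → A)) = F := by
  rw [opL_one]
  funext w
  refine (congrArg (lcup F _) (List.append_nil w).symm).trans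
    ((splitSum_append w [] _ fun a b h h' => ?_).trans (mul_one _))
  beta_reduce
  rw [if_neg, mul_zero]
  rintro rfl
  simp at h
  exact h' (by rw [h])

variable (B) in
/-- The Gerstenhaber algebra `H(U, A)`. -/
noncomputable def gerstenhaber : GerstenhaberAlgebra k B.H where
  one := B.cls _ B.one_mem_cocycles
  cup := B.cupH
  bracket := B.bracketH
  cup_assoc p q r a b c := by
    obtain ⟨F, hF, rfl⟩ := exists_hcls a
    obtain ⟨G, hG, rfl⟩ := exists_hcls b
    obtain ⟨K, hK, rfl⟩ := exists_hcls c
    rw [hF.cupH_hcls hG, hG.cupH_hcls hK, (hF.lcup hG).cupH_hcls hK, hF.cupH_hcls (hG.lcup hK),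
      ((hF.lcup hG).lcup hK).of_hcls, (hF.lcup (hG.lcup hK)).of_hcls, lcup_assoc]
    congr 1
    ring
  one_cup p a := by
    obtain ⟨F, hF, rfl⟩ := exists_hcls a
    have h := IsZ.of_mem B.one_mem_cocycles
    rw [← hcls_opL B.one_mem_cocycles, h.cupH_hcls hF, (h.lcup hF).of_hcls, lcup_opL_one_left,
      hF.of_hcls]
    congr 1
    push_cast; ring
  cup_one p a := by
    obtain ⟨F, hF, rfl⟩ := exists_hcls a
    have h := IsZ.of_mem B.one_mem_cocycles
    rw [← hcls_opL B.one_mem_cocycles, hF.cupH_hcls h, (hF.lcup h).of_hcls, lcup_opL_one_right,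
      hF.of_hcls]
    congr 1
    push_cast; ring
  cup_comm p q a b := by
    obtain ⟨F, hF, rfl⟩ := exists_hcls a
    obtain ⟨G, hG, rfl⟩ := exists_hcls b
    have h1 := hF.lcup hG
    have h2 := hG.lcup hF
    rw [show ((q : ℤ) - 1) + (p - 1) + 1 = p - 1 + (q - 1) + 1 by ring] at h2
    rw [hF.cupH_hcls hG, hG.cupH_hcls hF, h1.of_hcls, h2.of_hcls, ← h2.dcls_zsmul]
    -- The homotopy is `G ∘ F`, rescaled so that the coefficient of `lcup F G` becomes `1`.
    have h := hdelta_gcirc hG.isD.multiAdd hG.isD.homog hF.isD.homog hG.hdelta hF.hdelta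
    refine h1.dcls_eq (h2.zsmul _) ((hG.isD.gcirc hF.isD ((p : ℤ) - 1)).zsmul
      (-sgn ((p : ℤ) - 1))) (by ring) ?_
    have s1 : -sgn ((p : ℤ) * q) = sgn ((q : ℤ) - 1 + (p - 1) * (q - 1 + 1)) := by
      rw [← neg_one_mul, ← sgn_one, ← sgn_add]
      exact sgn_congr ⟨1, by ring⟩
    rw [hdelta_smul, h, neg_smul, smul_neg, neg_neg, smul_smul, sgn_mul_self, one_smul,
      ← s1, neg_smul, ← sub_eq_add_neg]
  bracket_zero_zero := by
    refine LinearMap.ext fun a => LinearMap.ext fun b => ?_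
    obtain ⟨F, hF, rfl⟩ := exists_hcls a
    obtain ⟨G, hG, rfl⟩ := exists_hcls b
    rw [hF.bracketH_hcls hG, (hF.gbr hG).isD.homog.eq_zero (by simp)]
    exact IsZ.hcls_zero
  bracket_antisymm p q a b := by
    obtain ⟨F, hF, rfl⟩ := exists_hcls a
    obtain ⟨G, hG, rfl⟩ := exists_hcls b
    have h1 := hF.gbr hG
    have h2 := hG.gbr hF
    rw [add_comm ((q : ℤ) - 1)] at h2
    rw [hF.bracketH_hcls hG, hG.bracketH_hcls hF, h1.of_hcls, h2.of_hcls, ← neg_smul,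
      ← h2.dcls_zsmul, neg_smul, ← gbr_antisymm]
  jacobi p q r a b c := by
    obtain ⟨F, hF, rfl⟩ := exists_hcls a
    obtain ⟨G, hG, rfl⟩ := exists_hcls b
    obtain ⟨K, hK, rfl⟩ := exists_hcls c
    have h1 := hF.gbr (hG.gbr hK)
    have h2 := (hF.gbr hG).gbr hK
    have h3 := hG.gbr (hF.gbr hK)
    have h := gbr_jacobi hF.isD.multiAdd hG.isD.multiAdd hK.isD.multiAdd hF.isD.homog hG.isD.homog
      hK.isD.homog
    rw [hF.bracketH_hcls hG, hG.bracketH_hcls hK, hF.bracketH_hcls hK,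
      hF.bracketH_hcls (hG.gbr hK), (hF.gbr hG).bracketH_hcls hK, hG.bracketH_hcls (hF.gbr hK),
      h1.of_hcls, h2.of_hcls, h3.of_hcls, h]
    rw [← add_assoc] at h1 ⊢
    rw [show (q : ℤ) - 1 + (p - 1 + (r - 1)) = p - 1 + (q - 1) + (r - 1) by ring] at h3 ⊢
    rw [h2.dcls_add (h3.zsmul _), h3.dcls_zsmul]
  bracket_self p a hp := by
    obtain ⟨F, hF, rfl⟩ := exists_hcls a
    rw [hF.bracketH_hcls hF, gbr_self, IsZ.hcls_zero]
    have : Odd (p : ℤ) := by exact_mod_cast hp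
    exact this.sub_odd odd_one
  jacobi_self p a hp := by
    obtain ⟨F, hF, rfl⟩ := exists_hcls a
    rw [hF.bracketH_hcls hF, hF.bracketH_hcls (hF.gbr hF), gbr_gbr_self _ hF.isD.multiAdd hF.isD.homog,
      IsZ.hcls_zero]
    have : Even (p : ℤ) := by exact_mod_cast hp
    exact this.sub_odd odd_one
  leibniz r p q c a b := by
    obtain ⟨F, hF, rfl⟩ := exists_hcls a
    obtain ⟨G, hG, rfl⟩ := exists_hcls b
    obtain ⟨K, hK, rfl⟩ := exists_hcls c
    have h1 := hK.gbr (hF.lcup hG)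
    have h2 := (hK.gbr hF).lcup hG
    have h3 := hF.lcup (hK.gbr hG)
    rw [hF.cupH_hcls hG, hK.bracketH_hcls hF, hK.bracketH_hcls hG, hK.bracketH_hcls (hF.lcup hG),
      (hK.gbr hF).cupH_hcls hG, hF.cupH_hcls (hK.gbr hG), h1.of_hcls, h2.of_hcls, h3.of_hcls]
    have e1 : (r : ℤ) - 1 + (p - 1 + (q - 1) + 1) = r - 1 + (p - 1) + (q - 1) + 1 := by ring
    have e2 : (p : ℤ) - 1 + (r - 1 + (q - 1)) + 1 = r - 1 + (p - 1) + (q - 1) + 1 := by ring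
    rw [e1] at h1 ⊢
    rw [e2] at h3 ⊢
    have h := hdelta_brace₂ hK.isD.multiAdd hF.isD.multiAdd hK.isD.homog hF.isD.homog hG.isD.homog
      hK.hdelta hF.hdelta hG.hdelta
    rw [← h3.dcls_zsmul, ← h2.dcls_add (h3.zsmul _)]
    -- The homotopy is the brace `K{F, G}`; its sign normalises the term `K ∘ (F ⌣ G)`. The other
    -- half of the bracket, `(F ⌣ G) ∘ K`, obeys the Leibniz rule strictly.
    refine h1.dcls_eq (h2.toNat.add (h3.toNat.zsmul _)) ((hK.isD.brace₂ hF.isD hG.isD (p - 1) (q - 1)).zsmul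
      (sgn (((r : ℤ) - 1) * (p - 1 + (q - 1) + 1)) *
        sgn ((p : ℤ) - 1 + (q - 1) + (q - 1) * (p - 1 + 1)))) rfl ?_
    rw [hdelta_smul, h, smul_smul, mul_assoc, sgn_mul_self, mul_one]
    simp only [gbr, gcirc_lcup hF.isD.homog, lcup_sub_left, lcup_sub_right, lcup_smul_left,
      lcup_smul_right, smul_sub, smul_smul, ← sgn_add]
    have s1 : sgn (((r : ℤ) - 1) * (p - 1 + (q - 1) + 1) + (r - 1) * (q - 1 + 1)) =
      sgn (((r : ℤ) - 1) * (p - 1)) := sgn_congr ⟨(r - 1) * q, by ring⟩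
    have s2 : sgn (((r : ℤ) - 1) * p + (r - 1) * (q - 1)) =
      sgn (((r : ℤ) - 1) * (p - 1 + (q - 1) + 1)) := sgn_congr ⟨0, by ring⟩
    rw [s1, s2, sub_add_cancel]
    abel

end LeftBialgebroid

/-! ### Induced modules and the bar resolution of `A`. -/

namespace LeftBialgebroid

variable {k : Type v} {A U : Type u} [CommRing k] [Ring A] [Algebra k A] [Ring U] [Algebra k U]
  (B : LeftBialgebroid k A U)

/-! ### Induced modules -/

section Ind

variable (N : Type u) [AddCommGroup N] [Module U N]

/-- The relations `u t(a) ⊗ n = u ⊗ t(a) n` which define `▸U ⊗_{Aᵒᵖ} N`. -/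
def indRel : Submodule U (U ⊗[ℤ] N) :=
  Submodule.span U {z | ∃ (a : A) (u : U) (n : N), z = (u * B.t a) ⊗ₜ[ℤ] n - u ⊗ₜ[ℤ] (B.t a • n)}

/-- The induced module `▸U ⊗_{Aᵒᵖ} N`. -/
abbrev Ind : Type u := (U ⊗[ℤ] N) ⧸ B.indRel N

variable {N}

/-- The class of `u ⊗ n`. -/
def indMk (u : U) (n : N) : B.Ind N := (B.indRel N).mkQ (u ⊗ₜ[ℤ] n)

theorem indMk_add_left (u w : U) (n : N) : B.indMk (u + w) n = B.indMk u n + B.indMk w n := by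
  simp [indMk, TensorProduct.add_tmul]

theorem indMk_add_right (u : U) (n m : N) : B.indMk u (n + m) = B.indMk u n + B.indMk u m := by
  simp [indMk, TensorProduct.tmul_add]

theorem smul_indMk (u w : U) (n : N) : u • B.indMk w n = B.indMk (u * w) n := rfl

theorem indMk_mul_t (u : U) (a : A) (n : N) : B.indMk (u * B.t a) n = B.indMk u (B.t a • n) :=
  (Submodule.Quotient.eq _).2 (Submodule.subset_span ⟨a, u, n, rfl⟩)

/-- `indMk` as a biadditive map. -/
def indHom : U →+ N →+ B.Ind N :=
  AddMonoidHom.mk' (fun u => AddMonoidHom.mk' (B.indMk u) (B.indMk_add_right u))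
    fun u w => by ext n; exact B.indMk_add_left u w n

theorem indHom_apply (u : U) (n : N) : B.indHom u n = B.indMk u n := rfl

variable {B}

theorem ind_induction {P : B.Ind N → Prop} (x : B.Ind N) (mk : ∀ u n, P (B.indMk u n))
    (add : ∀ x y, P x → P y → P (x + y)) : P x := by
  obtain ⟨x, rfl⟩ := Submodule.mkQ_surjective _ x
  induction x using TensorProduct.induction_on with
  | zero => simpa [indMk] using mk 0 0
  | tmul u n => exact mk u n
  | add x y hx hy => rw [map_add]; exact add _ _ hx hy

theorem exists_indLiftAdd {P : Type*} [AddCommGroup P] (F : U →+ N →+ P)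
    (hF : ∀ a u n, F (u * B.t a) n = F u (B.t a • n)) :
    ∃ f : B.Ind N →+ P, ∀ u n, f (B.indMk u n) = F u n := by
  let L : U ⊗[ℤ] N →+ P := TensorProduct.liftAddHom F fun c u n => by
    rw [map_zsmul, map_zsmul, AddMonoidHom.zsmul_apply]
  have hL : ∀ u n, L (u ⊗ₜ n) = F u n := fun _ _ => rfl
  have hker : ∀ z ∈ B.indRel N, ∀ c : U, L (c • z) = 0 := by
    intro z hz
    induction hz using Submodule.span_induction with
    | mem z h =>
      obtain ⟨a, u, n, rfl⟩ := h
      intro c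
      rw [smul_sub, TensorProduct.smul_tmul', TensorProduct.smul_tmul', map_sub, hL, hL, smul_eq_mul,
        smul_eq_mul, ← mul_assoc, hF, sub_self]
    | zero => simp
    | add x y _ _ hx hy => intro c; rw [smul_add, map_add, hx, hy, add_zero]
    | smul d x _ hx => intro c; rw [smul_smul]; exact hx _
  refine ⟨QuotientAddGroup.lift (B.indRel N).toAddSubgroup L fun z hz => ?_, fun x y => rfl⟩
  simpa using hker z hz 1

variable (B) in
/-- Additive maps which are compatible with the target map. -/
def IsTLin {N M : Type*} [AddCommGroup N] [Module U N] [AddCommGroup M] [Module U M]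
    (f : N →+ M) : Prop := ∀ a n, f (B.t a • n) = B.t a • f n

variable {M : Type*} [AddCommGroup M] [Module U M]

theorem exists_indLift {f : N →+ M} (hf : B.IsTLin f) :
    ∃ g : B.Ind N →ₗ[U] M, ∀ u n, g (B.indMk u n) = u • f n := by
  obtain ⟨g, hg⟩ := exists_indLiftAdd (B := B) (AddMonoidHom.mk' (fun u => (smulAddHom U M u).comp f)
    fun u w => by ext n; exact add_smul u w (f n)) fun a u n => by
      change (u * B.t a) • f n = u • f (B.t a • n)
      rw [hf, mul_smul]
  refine ⟨{ g with map_smul' := fun c x => ?_ }, hg⟩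
  change g (c • x) = c • g x
  induction x using ind_induction with
  | mk u n =>
    rw [smul_indMk, hg, hg]
    exact mul_smul c u (f n)
  | add x y hx hy => rw [smul_add, map_add, hx, hy, map_add, smul_add]

/-- The `U`-linear map `u ⊗ n ↦ u • f n`. -/
noncomputable def indLift {f : N →+ M} (hf : B.IsTLin f) : B.Ind N →ₗ[U] M := (exists_indLift hf).choose

@[simp] theorem indLift_mk {f : N →+ M} (hf : B.IsTLin f) (u : U) (n : N) :
    indLift hf (B.indMk u n) = u • f n := (exists_indLift hf).choose_spec u n

theorem ind_hom_ext {f g : B.Ind N →ₗ[U] M} (h : ∀ n, f (B.indMk 1 n) = g (B.indMk 1 n)) : f = g := by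
  refine LinearMap.ext fun x => ?_
  induction x using ind_induction with
  | mk u n =>
    rw [← mul_one u, ← smul_indMk, map_smul, map_smul, h]
  | add x y hx hy => rw [map_add, map_add, hx, hy]

theorem isTLin_indHom_one : B.IsTLin (B.indHom 1 : N →+ B.Ind N) := fun a n => by
  rw [indHom_apply, indHom_apply, smul_indMk, mul_one, ← indMk_mul_t, one_mul]

theorem isTLin_of_linear (f : N →ₗ[U] M) : B.IsTLin f.toAddMonoidHom := fun _ _ => f.map_smul _ _

theorem IsTLin.comp {K : Type*} [AddCommGroup K] [Module U K] {f : N →+ M} {g : M →+ K}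
    (hg : B.IsTLin g) (hf : B.IsTLin f) : B.IsTLin (g.comp f) := fun a n => by
  rw [AddMonoidHom.comp_apply, hf, hg]; rfl

theorem IsTLin.sub {f g : N →+ M} (hf : B.IsTLin f) (hg : B.IsTLin g) : B.IsTLin (f - g) :=
  fun a n => by rw [AddMonoidHom.sub_apply, hf, hg, AddMonoidHom.sub_apply, smul_sub]

theorem isTLin_step (d : B.Ind N →ₗ[U] N) :
    B.IsTLin (AddMonoidHom.id (B.Ind N) - (B.indHom 1).comp d.toAddMonoidHom) :=
  (isTLin_of_linear LinearMap.id).sub (isTLin_indHom_one.comp (isTLin_of_linear d))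

end Ind

/-! ### The resolution -/

/-- The iterated induced modules `U ⊗_{Aᵒᵖ} ⋯ ⊗_{Aᵒᵖ} U ⊗_{Aᵒᵖ} A`. -/
def Q : ℕ → ModuleCat.{u} U
  | 0 => B.unitObj
  | n + 1 => ModuleCat.of U (B.Ind (Q n))

/-- The differential of the resolution. -/
noncomputable def dQ : (n : ℕ) → (B.Q (n + 1) →ₗ[U] B.Q n)
  | 0 => indLift (isTLin_of_linear (LinearMap.id (R := U) (M := B.Q 0)))
  -- The value `q - 1 ⊗ d q` on `1 ⊗ q` is forced by the requirement `d h + h d = 1` for `h q = 1 ⊗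
  -- q`.
  | n + 1 => indLift (isTLin_step (N := B.Q n) (dQ n))

/-- The class of `1 ⊗ q`. -/
def hQ (n : ℕ) : B.Q n →+ B.Q (n + 1) := B.indHom 1

/-- The class of `u ⊗ q`. -/
def mkQ (n : ℕ) (u : U) (q : B.Q n) : B.Q (n + 1) := B.indMk u q

/-- The identification of `A` with the zeroth module. -/
def baseEquiv : A ≃+ B.Q 0 := AddEquiv.refl A

/-- The element `u¹ ⊗ ⋯ ⊗ uⁿ ⊗ a`. -/
def tauA : (n : ℕ) → List U → A → B.Q n
  | 0, [], a => B.baseEquiv a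
  | n + 1, u :: l, a => B.mkQ n u (tauA n l a)
  | 0, _ :: _, _ => 0
  | _ + 1, [], _ => 0

/-- The element `u¹ ⊗ ⋯ ⊗ uⁿ ⊗ 1`. -/
abbrev tau (n : ℕ) (l : List U) : B.Q n := B.tauA n l 1

variable {B} {n : ℕ}

theorem mkQ_eq (u : U) (q : B.Q n) : B.mkQ n u q = u • B.hQ n q := by
  refine Eq.trans ?_ (smul_indMk B u 1 q).symm
  rw [mul_one]; rfl

theorem isTLin_hQ : B.IsTLin (B.hQ n) := isTLin_indHom_one

theorem dQ_zero (q : B.Q 0) : B.dQ 0 (B.hQ 0 q) = q :=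
  (indLift_mk (isTLin_of_linear (LinearMap.id (R := U) (M := B.Q 0))) 1 q).trans (one_smul _ _)

theorem dQ_succ (q : B.Q (n + 1)) : B.dQ (n + 1) (B.hQ (n + 1) q) = q - B.hQ n (B.dQ n q) :=
  (indLift_mk (isTLin_step (N := B.Q n) (B.dQ n)) 1 q).trans (one_smul _ _)

theorem Q_hom_ext {M : Type*} [AddCommGroup M] [Module U M] {f g : B.Q (n + 1) →ₗ[U] M}
    (h : ∀ q, f (B.hQ n q) = g (B.hQ n q)) : f = g := ind_hom_ext (N := B.Q n) h

/-- By `U`-linearity it suffices to evaluate on `h q`, where `d d h = d - (d h) d = h d d`, and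
induction applies; in the lowest degree `d h = 1`. -/
theorem dQ_comp_dQ : ∀ n, (B.dQ n).comp (B.dQ (n + 1)) = 0
  | 0 => Q_hom_ext fun q => by
    rw [LinearMap.comp_apply, dQ_succ, map_sub, LinearMap.zero_apply, dQ_zero, sub_self]
  | n + 1 => Q_hom_ext fun q => by
    have h : B.dQ n (B.dQ (n + 1) q) = 0 := LinearMap.congr_fun (dQ_comp_dQ n) q
    rw [LinearMap.comp_apply, dQ_succ, map_sub, LinearMap.zero_apply, dQ_succ, h, map_zero,
      sub_zero, sub_self]

theorem dQ_dQ (q : B.Q (n + 2)) : B.dQ n (B.dQ (n + 1) q) = 0 :=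
  LinearMap.congr_fun (dQ_comp_dQ n) q

theorem exists_of_dQ_eq_zero {q : B.Q (n + 1)} (h : B.dQ n q = 0) : B.dQ (n + 1) (B.hQ (n + 1) q) = q := by
  rw [dQ_succ, h, map_zero, sub_zero]

/-- The `U`-linear map with given restriction. -/
noncomputable def liftQ {M : Type*} [AddCommGroup M] [Module U M] {f : B.Q n →+ M} (hf : B.IsTLin f) :
    B.Q (n + 1) →ₗ[U] M := indLift (N := B.Q n) hf

theorem liftQ_hQ {M : Type*} [AddCommGroup M] [Module U M] {f : B.Q n →+ M} (hf : B.IsTLin f)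
    (q : B.Q n) : liftQ hf (B.hQ n q) = f q :=
  (indLift_mk (N := B.Q n) hf 1 q).trans (one_smul _ _)

theorem Q_induction {P : B.Q (n + 1) → Prop} (x : B.Q (n + 1)) (mk : ∀ u q, P (B.mkQ n u q))
    (add : ∀ x y, P x → P y → P (x + y)) : P x := ind_induction (N := B.Q n) x mk add

theorem smul_baseEquiv (u : U) (b : A) : u • B.baseEquiv b = B.baseEquiv (B.act u b) := rfl

theorem t_smul_baseEquiv (a b : A) : B.t a • B.baseEquiv b = B.baseEquiv (b * a) := by
  rw [smul_baseEquiv, act, ε_t_mul, ε_s]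

theorem mkQ_t (u : U) (a : A) (q : B.Q n) : B.mkQ n (u * B.t a) q = B.mkQ n u (B.t a • q) :=
  indMk_mul_t B u a q

theorem smul_mkQ (u w : U) (q : B.Q n) : u • B.mkQ n w q = B.mkQ n (u * w) q := rfl

theorem mkQ_add (u : U) (q q' : B.Q n) : B.mkQ n u (q + q') = B.mkQ n u q + B.mkQ n u q' :=
  indMk_add_right B u q q'

theorem mkQ_zero (u : U) : B.mkQ n u 0 = 0 := (B.indHom u : B.Q n →+ B.Ind (B.Q n)).map_zero

/-- The elements `t(a) (u¹ ⊗ ⋯ ⊗ uⁿ ⊗ 1)` generate `Q n`. -/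
theorem tau_induction {P : B.Q n → Prop} (x : B.Q n)
    (mk : ∀ (a : A) (l : List U), l.length = n → P (B.t a • B.tau n l))
    (add : ∀ x y, P x → P y → P (x + y)) : P x := by
  induction n with
  | zero =>
    obtain ⟨a, rfl⟩ := B.baseEquiv.surjective x
    have := mk a [] rfl
    rwa [tau, tauA, t_smul_baseEquiv, one_mul] at this
  | succ n ih =>
    induction x using Q_induction with
    | mk u q =>
      refine ih (P := fun q => P (B.mkQ n u q)) q (fun a l hl => ?_) fun x y hx hy => ?_
      · have := mk 1 ((u * B.t a) :: l) (by simp [hl])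
        rw [t_one, one_smul, tau, tauA, mkQ_t] at this
        exact this
      · rw [mkQ_add]; exact add _ _ hx hy
    | add x y hx hy => exact add _ _ hx hy

/-- The universal property of `Q n`. -/
theorem exists_of_balanced (n : ℕ) {N : Type u} [AddCommGroup N] (ρ : A → N →+ N) (ρ_one : ∀ x, ρ 1 x = x)
    (ρ_add : ∀ a b x, ρ (a + b) x = ρ a x + ρ b x) (ρ_mul : ∀ a b x, ρ (a * b) x = ρ b (ρ a x))
    {φ : List U → N} (hφ : MultiAdd φ)
    (bal : ∀ p x y l a, φ (p ++ (x * B.t a) :: y :: l) = φ (p ++ x :: (B.t a * y) :: l))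
    (last : n = 0 ∨ ∀ a x l, φ (B.t a * x :: l) = ρ a (φ (x :: l))) :
    ∃ f : B.Q n →+ N, (∀ a q, f (B.t a • q) = ρ a (f q)) ∧
      ∀ l, l.length = n → f (B.tau n l) = φ l := by
  induction n generalizing N with
  | zero =>
    refine ⟨AddMonoidHom.mk' (fun b => ρ (B.baseEquiv.symm b) (φ [])) fun b b' => by
      rw [map_add, ρ_add], fun a q => ?_, fun l hl => ?_⟩
    · obtain ⟨b, rfl⟩ := B.baseEquiv.surjective q
      simp only [AddMonoidHom.mk'_apply, t_smul_baseEquiv, AddEquiv.symm_apply_apply, ρ_mul]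
    · obtain rfl := List.eq_nil_of_length_eq_zero hl
      simp only [AddMonoidHom.mk'_apply, tau, tauA, AddEquiv.symm_apply_apply, ρ_one]
  | succ n ih =>
    have last := last.resolve_left n.succ_ne_zero
    -- The first argument is curried: `A` acts on `U →+ N` through right multiplication by `t(a)`,
    -- and the balancing between the first two arguments becomes the new condition on the first
    -- argument.
    obtain ⟨F, hF, hF'⟩ := ih (N := U →+ N)
      (fun a => AddMonoidHom.mk' (fun h => h.comp (AddMonoidHom.mulRight (B.t a))) fun h h' => rfl)
      (fun h => by ext u; simp [t_one]) (fun a b h => by ext u; simp [t_add, mul_add])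
      (fun a b h => by ext u; simp [t_mul, mul_assoc])
      (φ := fun l => AddMonoidHom.mk' (fun u => φ (u :: l)) (hφ [] l))
      (fun a c x y => by ext u; exact hφ (u :: a) c x y)
      (fun p x y l a => by ext u; exact bal (u :: p) x y l a)
      (Or.inr fun a x l => by ext u; exact (bal [] u x l a).symm)
    obtain ⟨f, hf'⟩ : ∃ f : B.Q (n + 1) →+ N, ∀ u q, f (B.mkQ n u q) = F q u :=
      exists_indLiftAdd (B := B) (N := B.Q n) F.flip fun a u q => by
        rw [AddMonoidHom.flip_apply, AddMonoidHom.flip_apply, hF]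
        rfl
    refine ⟨f, fun a x => ?_, fun l hl => ?_⟩
    · induction x using Q_induction with
      | mk u q =>
        rw [smul_mkQ, hf', hf']
        induction q using tau_induction with
        | mk b l hl =>
          rw [hF, hF' l hl]
          change φ ((B.t a * u) * B.t b :: l) = ρ a (φ (u * B.t b :: l))
          rw [mul_assoc, last]
        | add x y hx hy => rw [map_add, AddMonoidHom.add_apply, AddMonoidHom.add_apply, map_add, hx, hy]
      | add x y hx hy => rw [smul_add, map_add, map_add, map_add, hx, hy]
    · cases l with
      | nil => simp at hl
      | cons u l =>
        rw [tau, tauA, hf', hF' l (by simpa using hl)]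
        rfl

end LeftBialgebroid

/-! ### Projectivity, syzygies and dimension shifting. -/

namespace LeftBialgebroid

variable {k : Type v} {A U : Type u} [CommRing k] [Ring A] [Algebra k A] [Ring U] [Algebra k U]
  (B : LeftBialgebroid k A U)

/-! ### Projectivity of the resolution -/

/-- Maps out of `N` which are compatible with the target map lift along surjective `U`-linear
maps. -/
def TLift (N : Type u) [AddCommGroup N] [Module U N] : Prop :=
  ∀ (E M : Type u) [AddCommGroup E] [Module U E] [AddCommGroup M] [Module U M] (g : E →ₗ[U] M)
    (f : N →+ M), Function.Surjective g → B.IsTLin f →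
    ∃ f' : N →+ E, B.IsTLin f' ∧ ∀ n, g (f' n) = f n

variable {B}

theorem IsRightProjective.tLift (h : B.IsRightProjective) : B.TLift U := by
  intro E M _ _ _ _ g f hg hf
  let : Module Aᵐᵒᵖ U := Module.compHom U B.tgtHom
  let : Module Aᵐᵒᵖ E := Module.compHom E B.tgtHom
  let : Module Aᵐᵒᵖ M := Module.compHom M B.tgtHom
  have : Module.Projective Aᵐᵒᵖ U := h
  obtain ⟨f', hf'⟩ := Module.projective_lifting_property
    (⟨g.toAddHom, fun a x => g.map_smul (B.tgtHom a) x⟩ : E →ₗ[Aᵐᵒᵖ] M)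
    (⟨f.toAddHom, fun a x => hf a.unop x⟩ : U →ₗ[Aᵐᵒᵖ] M) hg
  exact ⟨f'.toAddMonoidHom, fun a n => f'.map_smul (MulOpposite.op a) n,
    fun n => LinearMap.congr_fun hf' n⟩

/-- As a right `A`-module, `A` is free on `1`. -/
theorem tLift_base : B.TLift (B.Q 0) := by
  intro E M _ _ _ _ g f hg hf
  obtain ⟨e, he⟩ := hg (f (B.baseEquiv 1))
  refine ⟨AddMonoidHom.mk' (fun b => B.t (B.baseEquiv.symm b) • e) fun b b' => ?_, fun a b => ?_,
    fun b => ?_⟩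
  · rw [map_add, t_add, add_smul]
  · obtain ⟨b, rfl⟩ := B.baseEquiv.surjective b
    simp only [AddMonoidHom.mk'_apply, t_smul_baseEquiv, AddEquiv.symm_apply_apply, t_mul, mul_smul]
  · obtain ⟨b, rfl⟩ := B.baseEquiv.surjective b
    rw [AddMonoidHom.mk'_apply, AddEquiv.symm_apply_apply, map_smul, he, ← hf, t_smul_baseEquiv,
      one_mul]

/-- Induction is left adjoint to restriction along the target map. -/
theorem TLift.projective_ind {N : Type u} [AddCommGroup N] [Module U N] (h : B.TLift N) :
    Module.Projective U (B.Ind N) := by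
  refine .of_lifting_property'' fun g hg => ?_
  obtain ⟨f', hf', e⟩ := h _ _ g _ hg isTLin_indHom_one
  refine ⟨indLift hf', ind_hom_ext fun n => ?_⟩
  rw [LinearMap.comp_apply, indLift_mk, one_smul, e]
  rfl

/-- A projective `U`-module is a summand of a free one, and free modules inherit the lifting
property from `U`. Together with `TLift.projective_ind` this drives the induction for all `B.Q n`.
-/
theorem TLift.of_projective (h : B.TLift U) {P : Type u} [AddCommGroup P] [Module U P]
    [Module.Projective U P] : B.TLift P := by
  intro E M _ _ _ _ g f hg hf
  obtain ⟨s, hs⟩ := Module.projective_def'.1 (inferInstance : Module.Projective U P)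
  choose f' hf' e using fun p : P => h E M g (f.comp (LinearMap.toSpanSingleton U P p).toAddMonoidHom)
    hg (hf.comp (isTLin_of_linear _))
  let F : (P →₀ U) →+ E := Finsupp.liftAddHom f'
  have h1 : ∀ x, g (F x) = f (Finsupp.linearCombination U id x) := by
    intro x
    induction x using Finsupp.induction_linear with
    | zero => simp
    | add x y hx hy => rw [map_add, map_add, map_add, map_add, hx, hy]
    | single p u =>
      rw [Finsupp.liftAddHom_apply_single, e, Finsupp.linearCombination_single]
      rfl
  have h2 : B.IsTLin F := by
    intro a x
    induction x using Finsupp.induction_linear with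
    | zero => simp
    | add x y hx hy => rw [smul_add, map_add, map_add, smul_add, hx, hy]
    | single p u =>
      rw [Finsupp.smul_single, Finsupp.liftAddHom_apply_single, Finsupp.liftAddHom_apply_single, hf']
  refine ⟨F.comp s.toAddMonoidHom, h2.comp (isTLin_of_linear s), fun n => ?_⟩
  exact (h1 _).trans (congrArg f (LinearMap.congr_fun hs n))

theorem tLift_Q (h : B.IsRightProjective) : ∀ n, B.TLift (B.Q n)
  | 0 => tLift_base
  | n + 1 => by
    have := (tLift_Q h n).projective_ind
    exact h.tLift.of_projective (P := B.Ind (B.Q n))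

/-- The index is shifted by one, because `B.Q 0` is the resolved module `A` itself. -/
theorem projective_Q (h : B.IsRightProjective) (n : ℕ) : Projective (B.Q (n + 1)) :=
  have := (tLift_Q h n).projective_ind
  (IsProjective.iff_projective (B.Ind (B.Q n))).1 this

/-! ### Syzygies -/

variable (B) in
/-- The syzygies of the resolution. -/
noncomputable def K : ℕ → ModuleCat.{u} U
  | 0 => B.Q 0
  | n + 1 => ModuleCat.of U (LinearMap.ker (B.dQ n))

variable {n : ℕ}

variable (B) in
/-- The inclusion of a syzygy. -/
noncomputable def ιK (n : ℕ) : B.K (n + 1) →ₗ[U] B.Q (n + 1) := (LinearMap.ker (B.dQ n)).subtype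

theorem ιK_injective : Function.Injective (B.ιK n) := Subtype.val_injective

theorem dQ_ιK (x : B.K (n + 1)) : B.dQ n (B.ιK n x) = 0 := x.2

/-- A map which is killed by the differential factors through the syzygy. -/
noncomputable def liftK {M : Type*} [AddCommGroup M] [Module U M] (f : M →ₗ[U] B.Q (n + 1))
    (hf : ∀ x, B.dQ n (f x) = 0) : M →ₗ[U] B.K (n + 1) := f.codRestrict _ hf

variable (B) in
/-- The projection onto a syzygy. -/
noncomputable def πK : (n : ℕ) → (B.Q (n + 1) →ₗ[U] B.K n)
  | 0 => B.dQ 0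
  | n + 1 => liftK (B.dQ (n + 1)) dQ_dQ

theorem ιK_πK (x : B.Q (n + 2)) : B.ιK n (B.πK (n + 1) x) = B.dQ (n + 1) x := rfl

theorem πK_surjective : ∀ n, Function.Surjective (B.πK n)
  | 0 => fun q => ⟨_, dQ_zero q⟩
  | n + 1 => fun q => ⟨B.hQ (n + 1) (B.ιK n q), ιK_injective
      ((ιK_πK _).trans (exists_of_dQ_eq_zero (dQ_ιK q)))⟩

theorem πK_eq_zero_iff {x : B.Q (n + 1)} : B.πK n x = 0 ↔ B.dQ n x = 0 := by
  cases n with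
  | zero => rfl
  | succ n => rw [← (ιK_injective (B := B)).eq_iff, ιK_πK, map_zero]

theorem πK_ιK (x : B.K (n + 1)) : B.πK n (B.ιK n x) = 0 := πK_eq_zero_iff.2 (dQ_ιK x)

variable (B) in
/-- The inclusion of a syzygy as a morphism. -/
noncomputable def iK (n : ℕ) : B.K (n + 1) ⟶ B.Q (n + 1) :=
  ModuleCat.ofHom (X := B.K (n + 1)) (Y := B.Q (n + 1)) (B.ιK n)

variable (B) in
/-- The projection onto a syzygy as a morphism. -/
noncomputable def pK (n : ℕ) : B.Q (n + 1) ⟶ B.K n :=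
  ModuleCat.ofHom (X := B.Q (n + 1)) (Y := B.K n) (B.πK n)

variable (B) in
/-- The short exact sequences into which the resolution splits. -/
noncomputable def ses (n : ℕ) : ShortComplex (ModuleCat.{u} U) where
  X₁ := B.K (n + 1)
  X₂ := B.Q (n + 1)
  X₃ := B.K n
  f := B.iK n
  g := B.pK n
  zero := by
    ext x
    exact πK_ιK x

variable (B) in
theorem ses_shortExact (n : ℕ) : (B.ses n).ShortExact :=
  ModuleCat.shortComplex_shortExact _
    (fun x => ⟨fun h => ⟨⟨x, πK_eq_zero_iff.1 h⟩, rfl⟩, by rintro ⟨y, rfl⟩; exact πK_ιK y⟩)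
    ιK_injective (πK_surjective n)

open Abelian

variable {Y : ModuleCat.{u} U}

variable (B) in
/-- The class of the `n`-th short exact sequence. -/
noncomputable def eK (n : ℕ) : Ext.{u} (B.K n) (B.K (n + 1)) 1 := (B.ses_shortExact n).extClass

theorem eK_comp_mk₀_ιK (g : B.Q (n + 1) ⟶ Y) :
    (B.eK n).comp (Ext.mk₀ (B.iK n ≫ g)) (add_zero 1) = 0 := by
  rw [← Ext.mk₀_comp_mk₀]
  exact (B.ses_shortExact n).extClass_comp_assoc (Ext.mk₀ g)

theorem exists_of_eK_comp_eq_zero {p d : ℕ} (hd : 1 + p = d) (x : Ext.{u} (B.K (n + 1)) Y p)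
    (hx : (B.eK n).comp x hd = 0) :
    ∃ y : Ext.{u} (B.Q (n + 1)) Y p,
      (Ext.mk₀ (B.iK n)).comp y (zero_add p) = x :=
  Ext.contravariant_sequence_exact₁ (B.ses_shortExact n) Y x hd hx

theorem eK_comp_injective (h : B.IsRightProjective) {p d : ℕ} (hd : 1 + (p + 1) = d)
    (x : Ext.{u} (B.K (n + 1)) Y (p + 1)) (hx : (B.eK n).comp x hd = 0) : x = 0 := by
  obtain ⟨y, rfl⟩ := exists_of_eK_comp_eq_zero hd x hx
  have := projective_Q h n
  rw [Ext.eq_zero_of_projective y, Ext.comp_zero]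

theorem exists_eK_comp (h : B.IsRightProjective) {p : ℕ} (x : Ext.{u} (B.K n) Y (p + 1)) :
    ∃ y : Ext.{u} (B.K (n + 1)) Y p, (B.eK n).comp y (add_comm 1 p) = x := by
  have := projective_Q h n
  exact Ext.contravariant_sequence_exact₃ (B.ses_shortExact n) Y x
    (Ext.eq_zero_of_projective (P := B.Q (n + 1)) _) _

theorem eK_naturality {m n : ℕ} (a : B.K (m + 1) ⟶ B.K (n + 1)) (b : B.Q (m + 1) ⟶ B.Q (n + 1))
    (c : B.K m ⟶ B.K n) (hab : a ≫ B.iK n = B.iK m ≫ b)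
    (hbc : b ≫ B.pK n = B.pK m ≫ c) :
    (B.eK m).comp (Ext.mk₀ a) (add_zero 1) = (Ext.mk₀ c).comp (B.eK n) (zero_add 1) :=
  ShortComplex.ShortExact.extClass_naturality (B.ses_shortExact m) (B.ses_shortExact n)
    ⟨a, b, c, hab, hbc⟩

variable (B) in
/-- The zeroth syzygy. -/
noncomputable def jK : B.Q 0 ≅ B.K 0 := Iso.refl _

variable (B) in
/-- The iterated extension class of the first `n` steps of the resolution. -/
noncomputable def Sh : (n : ℕ) → Ext.{u} (B.Q 0) (B.K n) n
  | 0 => Ext.mk₀ B.jK.hom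
  | n + 1 => (Sh n).comp (B.eK n) rfl

/-- As positive `Ext` groups of the middle terms vanish, every class in positive degree on `K n`
factors through the extension class of the next short exact sequence. -/
theorem exists_Sh_comp (h : B.IsRightProjective) (m : ℕ) {p d : ℕ} (hd : m + p = d)
    (x : Ext.{u} (B.Q 0) Y d) : ∃ y : Ext.{u} (B.K m) Y p, (B.Sh m).comp y hd = x := by
  induction m generalizing p with
  | zero =>
    obtain rfl : p = d := by omega
    refine ⟨(Ext.mk₀ B.jK.inv).comp x (zero_add p), ?_⟩
    rw [Sh, Ext.mk₀_comp_mk₀_assoc, Iso.hom_inv_id, Ext.mk₀_id_comp]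
  | succ m ih =>
    obtain ⟨y, rfl⟩ := ih (p := p + 1) (by omega)
    obtain ⟨z, rfl⟩ := exists_eK_comp h y
    exact ⟨z, Ext.comp_assoc _ _ _ _ _ (by omega)⟩

/-- Shifting is injective only on positive degrees; in degree zero it kills the maps which extend to
the middle term. -/
theorem eq_zero_of_Sh_comp (h : B.IsRightProjective) (m : ℕ) {i d : ℕ} (hd : m + (i + 1) = d)
    (y : Ext.{u} (B.K m) Y (i + 1)) (e : (B.Sh m).comp y hd = 0) : y = 0 := by
  induction m generalizing i with
  | zero =>
    obtain rfl : i + 1 = d := by omega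
    rw [← Ext.mk₀_id_comp y, ← Iso.inv_hom_id B.jK, ← Ext.mk₀_comp_mk₀_assoc]
    rw [Sh] at e
    rw [e, Ext.comp_zero]
  | succ m ih =>
    refine eK_comp_injective h (d := i + 1 + 1) (by omega) y (ih (by omega) _ ?_)
    rwa [Sh, Ext.comp_assoc (a₂₃ := i + 1 + 1) _ _ _ _ (by omega) (by omega)] at e

theorem exists_Sh_mk₀ (h : B.IsRightProjective) {p : ℕ} (x : Ext.{u} (B.Q 0) Y p) :
    ∃ f : B.K p ⟶ Y, (B.Sh p).comp (Ext.mk₀ f) (add_zero p) = x := by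
  obtain ⟨y, rfl⟩ := exists_Sh_comp h p (add_zero p) x
  obtain ⟨f, rfl⟩ := Ext.mk₀_bijective _ _ |>.2 y
  exact ⟨f, rfl⟩

/-- All shifts but the last start from positive degree and are injective, so only the kernel of the
last connecting map matters. -/
theorem Sh_mk₀_eq_zero_iff (h : B.IsRightProjective) {p : ℕ} (f : B.K (p + 1) ⟶ Y) :
    (B.Sh (p + 1)).comp (Ext.mk₀ f) (add_zero (p + 1)) = 0 ↔
      ∃ g : B.Q (p + 1) ⟶ Y, B.iK p ≫ g = f := by
  rw [Sh, Ext.comp_assoc_of_third_deg_zero]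
  constructor
  · intro e
    obtain ⟨z, hz⟩ := exists_of_eK_comp_eq_zero _ _ (eq_zero_of_Sh_comp h p _ _ e)
    obtain ⟨g, rfl⟩ := Ext.mk₀_bijective _ _ |>.2 z
    rw [Ext.mk₀_comp_mk₀] at hz
    exact ⟨g, (Ext.mk₀_bijective _ _).1 hz⟩
  · rintro ⟨g, rfl⟩
    rw [eK_comp_mk₀_ιK, Ext.comp_zero]

theorem Sh_zero_mk₀_eq_zero_iff (f : B.K 0 ⟶ Y) :
    (B.Sh 0).comp (Ext.mk₀ f) (add_zero 0) = 0 ↔ f = 0 := by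
  rw [Sh, Ext.mk₀_comp_mk₀, Ext.mk₀_eq_zero_iff]
  exact ⟨fun h => by rw [← cancel_epi B.jK.hom, h, Limits.comp_zero], fun h => by rw [h, Limits.comp_zero]⟩

end LeftBialgebroid

/-! ### Cochains and cocycles as maps out of the resolution. -/

namespace LeftBialgebroid

variable {k : Type v} {A U : Type u} [CommRing k] [Ring A] [Algebra k A] [Ring U] [Algebra k U]
  {B : LeftBialgebroid k A U} {n p q : ℕ}

/-! ### Cochains as maps out of the resolution -/

theorem tau_add (a c : List U) (x y : U) :
    B.tau n (a ++ (x + y) :: c) = B.tau n (a ++ x :: c) + B.tau n (a ++ y :: c) := by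
  induction a generalizing n with
  | nil =>
    cases n with
    | zero => exact (add_zero _).symm
    | succ n => exact indMk_add_left B _ _ _
  | cons z a ih =>
    cases n with
    | zero => exact (add_zero _).symm
    | succ n => exact (congrArg _ ih).trans (mkQ_add _ _ _)

theorem tau_bal (a c : List U) (x y : U) (b : A) :
    B.tau n (a ++ (x * B.t b) :: y :: c) = B.tau n (a ++ x :: (B.t b * y) :: c) := by
  induction a generalizing n with
  | nil =>
    rcases n with _ | _ | n
    · rfl
    · exact (mkQ_zero _).trans (mkQ_zero _).symm
    · exact mkQ_t _ _ _
  | cons z a ih =>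
    cases n with
    | zero => rfl
    | succ n => exact congrArg (B.mkQ n z) ih

theorem tau_first (c : List U) (x : U) (b : A) :
    B.tau n (B.t b * x :: c) = B.t b • B.tau n (x :: c) := by
  cases n with
  | zero => exact (smul_zero _).symm
  | succ n => rfl

variable (B) in
/-- The cochain which corresponds to a map out of `Q p`. -/
def cochainOf {p : ℕ} (f : B.Q p →+ B.Q 0) (u : Fin p → U) : A :=
  B.baseEquiv.symm (f (B.tau p (List.ofFn u)))

theorem baseEquiv_symm_t_smul (a : A) (x : B.Q 0) :
    B.baseEquiv.symm (B.t a • x) = B.baseEquiv.symm x * a := by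
  obtain ⟨b, rfl⟩ := B.baseEquiv.surjective x
  rw [t_smul_baseEquiv, AddEquiv.symm_apply_apply, AddEquiv.symm_apply_apply]

theorem baseEquiv_symm_smul (u : U) (x : B.Q 0) :
    B.baseEquiv.symm (u • x) = B.act u (B.baseEquiv.symm x) := by
  obtain ⟨b, rfl⟩ := B.baseEquiv.surjective x
  rw [smul_baseEquiv, AddEquiv.symm_apply_apply, AddEquiv.symm_apply_apply]

theorem IsTLin.isLCochain {f : B.Q p →+ B.Q 0} (hf : B.IsTLin f) :
    B.IsLCochain fun l => B.baseEquiv.symm (f (B.tau p l)) where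
  add a c x y := by simp only [tau_add, map_add]
  bal a x y c b := by simp only [tau_bal]
  first b x c := by simp only [tau_first, hf b, baseEquiv_symm_t_smul]

theorem IsTLin.isCochain {f : B.Q p →+ B.Q 0} (hf : B.IsTLin f) : B.IsCochain (B.cochainOf f) :=
  hf.isLCochain.isCochain

theorem exists_cochainOf_eq {φ : (Fin p → U) → A} (hφ : B.IsCochain φ) :
    ∃ f : B.Q p →+ B.Q 0, B.IsTLin f ∧ B.cochainOf f = φ := by
  obtain ⟨f, hf, hf'⟩ := exists_of_balanced (B := B) p (fun a => AddMonoidHom.mulRight a) mul_one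
    (fun a b x => mul_add x a b) (fun a b x => (mul_assoc x a b).symm) hφ.isLCochain.add
    hφ.isLCochain.bal (Or.inr fun a x l => hφ.isLCochain.first a x l)
  refine ⟨B.baseEquiv.toAddMonoidHom.comp f, fun a q => ?_, funext fun u => ?_⟩
  · change B.baseEquiv (f _) = B.t a • B.baseEquiv (f q)
    rw [hf, t_smul_baseEquiv]
    rfl
  · change B.baseEquiv.symm (B.baseEquiv (f _)) = _
    rw [AddEquiv.symm_apply_apply, hf' _ (List.length_ofFn), onList_ofFn]

theorem IsTLin.eq_of_cochainOf_eq {f g : B.Q p →+ B.Q 0} (hf : B.IsTLin f) (hg : B.IsTLin g)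
    (h : B.cochainOf f = B.cochainOf g) : f = g := by
  refine AddMonoidHom.ext fun x => ?_
  induction x using tau_induction with
  | mk a l hl =>
    subst hl
    have := B.baseEquiv.symm.injective (congrFun h fun i => l[i])
    have e : List.ofFn (fun i : Fin l.length => l[i]) = l := List.ofFn_getElem
    rw [e] at this
    rw [hf, hg, this]
  | add x y hx hy => rw [map_add, map_add, hx, hy]

theorem tauA_snoc (l : List U) (x : U) (a : A) (h : l.length + 1 = n) :
    B.tauA n (l ++ [x]) a = B.tau n (l ++ [x * B.t a]) := by
  induction l generalizing n with
  | nil =>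
    obtain rfl : n = 1 := by simpa using h.symm
    change B.mkQ 0 x (B.baseEquiv a) = B.mkQ 0 (x * B.t a) (B.baseEquiv 1)
    rw [mkQ_t, t_smul_baseEquiv, one_mul]
  | cons y l ih =>
    obtain ⟨n, rfl⟩ : ∃ m, n = m + 1 := ⟨l.length + 1, by simpa using h.symm⟩
    exact congrArg _ (ih (by simpa using h))

theorem lastAct_cochainOf {f : B.Q p →+ B.Q 0} (hf : B.IsTLin f) (u : Fin p → U) (a : A) :
    B.lastAct p (B.cochainOf f) u a = B.baseEquiv.symm (f (B.tauA p (List.ofFn u) a)) := by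
  cases p with
  | zero =>
    change B.baseEquiv.symm (f (B.baseEquiv 1)) * a = B.baseEquiv.symm (f (B.baseEquiv a))
    rw [← baseEquiv_symm_t_smul, ← hf, t_smul_baseEquiv, one_mul]
  | succ p =>
    have h : List.ofFn u = List.ofFn (Fin.init u) ++ [u (Fin.last p)] := by
      rw [List.ofFn_succ', List.concat_eq_append]; rfl
    rw [h, tauA_snoc _ _ _ (by simp), lastAct, cochainOf, List.ofFn_succ', List.concat_eq_append]
    congr 4
    · refine congrArg _ (funext fun i => ?_)
      simp [Fin.init, Function.update_apply, Fin.ext_iff, i.2.ne]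
    · simp

theorem contractNth_castSucc_succ {V : Type*} (op : V → V → V) (u : Fin (p + 2) → V) (i : Fin p) :
    Fin.contractNth i.succ.castSucc op u =
      Fin.cons (u 0) (Fin.contractNth i.castSucc op (Fin.tail u)) := by
  funext j
  cases j using Fin.cases with
  | zero => simp [Fin.contractNth]
  | succ j => simp [Fin.contractNth, Fin.tail, Fin.ext_iff]

theorem contractNth_zero {V : Type*} (op : V → V → V) (u : Fin (p + 2) → V) :
    Fin.contractNth 0 op u = Fin.cons (op (u 0) (u 1)) (Fin.tail (Fin.tail u)) := by
  funext j
  cases j using Fin.cases with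
  | zero => simp [Fin.contractNth]
  | succ j => simp [Fin.contractNth, Fin.tail, Fin.ext_iff]

theorem tauA_ofFn_succ (u : Fin (n + 1) → U) (a : A) :
    B.tauA (n + 1) (List.ofFn u) a = B.mkQ n (u 0) (B.tauA n (List.ofFn (Fin.tail u)) a) := by
  rw [List.ofFn_succ]; rfl

theorem dQ_mkQ_zero (u : U) (x : B.Q 0) : B.dQ 0 (B.mkQ 0 u x) = u • x := by
  rw [mkQ_eq, map_smul, dQ_zero]

theorem dQ_mkQ_succ (u : U) (x : B.Q (n + 1)) :
    B.dQ (n + 1) (B.mkQ (n + 1) u x) = u • x - B.mkQ n u (B.dQ n x) := by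
  rw [mkQ_eq, map_smul, dQ_succ, smul_sub, ← mkQ_eq]

/-- The recursive differential is the usual bar differential: each step `u x - u ⊗ d x` multiplies
the first two entries and alternates the signs of the rest. -/
theorem dQ_tau (u : Fin (p + 1) → U) :
    B.dQ p (B.tau (p + 1) (List.ofFn u)) =
      ∑ i : Fin p, sgn i • B.tau p (List.ofFn (Fin.contractNth i.castSucc (· * ·) u)) +
        sgn p • B.tauA p (List.ofFn (Fin.init u)) (B.ε (u (Fin.last p))) := by
  induction p with
  | zero =>
    rw [tau, tauA_ofFn_succ, dQ_mkQ_zero]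
    simp only [List.ofFn_zero, tauA, smul_baseEquiv, Finset.univ_eq_empty, Finset.sum_empty,
      zero_add, Nat.cast_zero, sgn_zero, one_smul, act, s_one, mul_one]
    rfl
  | succ p ih =>
    have e : ∀ x y, B.mkQ p (u 0) (x + y) = B.mkQ p (u 0) x + B.mkQ p (u 0) y := mkQ_add _
    let L : B.Q p →+ B.Q (p + 1) := AddMonoidHom.mk' (B.mkQ p (u 0)) e
    have hL : ∀ x, B.mkQ p (u 0) x = L x := fun _ => rfl
    have hz : ∀ (c : ℤ) x, B.mkQ p (u 0) (c • x) = c • B.mkQ p (u 0) x := fun c x => map_zsmul L c x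
    rw [tau, tauA_ofFn_succ, dQ_mkQ_succ, ih, hL, map_add, map_sum, Fin.sum_univ_succ]
    simp only [← hL, hz, contractNth_castSucc_succ, Fin.castSucc_zero, contractNth_zero,
      Fin.val_zero, Nat.cast_zero, sgn_zero, one_smul, Fin.val_succ, tauA_ofFn_succ, Fin.cons_zero,
      Fin.tail_cons, smul_mkQ, tau, Nat.cast_add, Nat.cast_one, sgn_add, sgn_one, mul_neg, mul_one,
      neg_smul, Finset.sum_neg_distrib]
    change _ = _ + -(sgn p • B.mkQ p (u 0) (B.tauA p (List.ofFn (Fin.init (Fin.tail u)))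
      (B.ε (Fin.tail u (Fin.last p)))))
    rw [show Fin.tail u 0 = u 1 from rfl]
    abel

/-- The coboundary is precomposition with the differential, once `f` is replaced by its `U`-linear
extension to `B.Q (p + 1)`. -/
theorem δ_cochainOf {f : B.Q p →+ B.Q 0} (hf : B.IsTLin f) :
    B.δ p (B.cochainOf f) =
      B.cochainOf (((liftQ hf).comp (B.dQ (p + 1))).toAddMonoidHom.comp (B.hQ (p + 1))) := by
  funext u
  have e : B.cochainOf (((liftQ hf).comp (B.dQ (p + 1))).toAddMonoidHom.comp (B.hQ (p + 1))) u =
      B.baseEquiv.symm (liftQ hf (B.dQ (p + 1) (B.hQ (p + 1) (B.tau (p + 1) (List.ofFn u))))) := rfl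
  rw [e, dQ_succ, map_sub, liftQ_hQ, dQ_tau, tau, tauA_ofFn_succ, mkQ_eq, map_smul, liftQ_hQ, map_sub,
    baseEquiv_symm_smul, map_add, map_add, map_sum, map_sum]
  simp only [map_zsmul]
  rw [← lastAct_cochainOf hf (Fin.init u)]
  change B.act (u 0) (B.cochainOf f (Fin.tail u)) +
    ∑ i : Fin p, sgn (i + 1) • B.cochainOf f (Fin.contractNth i.castSucc (· * ·) u) +
      sgn (p + 1) • B.lastAct p (B.cochainOf f) (Fin.init u) (B.ε (u (Fin.last p))) =
    B.act (u 0) (B.cochainOf f (Fin.tail u)) -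
      (∑ i : Fin p, sgn i • B.cochainOf f (Fin.contractNth i.castSucc (· * ·) u) +
        sgn p • B.lastAct p (B.cochainOf f) (Fin.init u) (B.ε (u (Fin.last p))))
  simp only [sgn_add, sgn_one, mul_neg, mul_one, neg_smul, Finset.sum_neg_distrib]
  abel

theorem isTLin_comp_hQ (F : B.Q (n + 1) →ₗ[U] B.Q p) : B.IsTLin (F.toAddMonoidHom.comp (B.hQ n)) :=
  (isTLin_of_linear F).comp isTLin_hQ

theorem liftQ_comp_hQ (F : B.Q (n + 1) →ₗ[U] B.Q p) : liftQ (isTLin_comp_hQ F) = F :=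
  Q_hom_ext fun q => liftQ_hQ _ q

theorem eq_of_cochainOf_eq {F G : B.Q (p + 1) →ₗ[U] B.Q 0}
    (h : B.cochainOf (F.toAddMonoidHom.comp (B.hQ p)) =
      B.cochainOf (G.toAddMonoidHom.comp (B.hQ p))) : F = G :=
  Q_hom_ext fun q => DFunLike.congr_fun
    ((isTLin_comp_hQ F).eq_of_cochainOf_eq (isTLin_comp_hQ G) h) q

theorem δ_cochainOf_hom (F : B.Q (p + 1) →ₗ[U] B.Q 0) :
    B.δ p (B.cochainOf (F.toAddMonoidHom.comp (B.hQ p))) =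
      B.cochainOf ((F.comp (B.dQ (p + 1))).toAddMonoidHom.comp (B.hQ (p + 1))) := by
  rw [δ_cochainOf (isTLin_comp_hQ F), liftQ_comp_hQ]

theorem exists_hom_cochainOf_eq {φ : (Fin p → U) → A} (hφ : B.IsCochain φ) :
    ∃ F : B.Q (p + 1) →ₗ[U] B.Q 0, B.cochainOf (F.toAddMonoidHom.comp (B.hQ p)) = φ := by
  obtain ⟨f, hf, rfl⟩ := exists_cochainOf_eq hφ
  exact ⟨liftQ hf, congrArg _ (AddMonoidHom.ext fun q => liftQ_hQ hf q)⟩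

/-- The kernel of the projection to the syzygy is the image of the next differential, by the
contraction. -/
theorem exists_descend {M : Type*} [AddCommGroup M] [Module U M] {F : B.Q (p + 1) →ₗ[U] M}
    (hF : F.comp (B.dQ (p + 1)) = 0) : ∃ f : B.K p →ₗ[U] M, f.comp (B.πK p) = F := by
  let e := (B.πK p).quotKerEquivOfSurjective (πK_surjective p)
  have hk : LinearMap.ker (B.πK p) ≤ LinearMap.ker F := fun x hx => by
    have h : B.dQ p x = 0 := πK_eq_zero_iff.1 hx
    rw [LinearMap.mem_ker, ← exists_of_dQ_eq_zero h]
    exact LinearMap.congr_fun hF _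
  refine ⟨((LinearMap.ker (B.πK p)).liftQ F hk).comp e.symm.toLinearMap, LinearMap.ext fun x => ?_⟩
  have : e.symm (B.πK p x) = Submodule.Quotient.mk x := (LinearEquiv.symm_apply_eq e).2 rfl
  change Submodule.liftQ _ F hk (e.symm (B.πK p x)) = F x
  rw [this]
  rfl

theorem πK_dQ (x : B.Q (p + 2)) : B.πK p (B.dQ (p + 1) x) = 0 := πK_eq_zero_iff.2 (dQ_dQ x)


theorem baseEquiv_symm_algebra_smul (c : k) (x : B.Q 0) :
    B.baseEquiv.symm (c • x) = c • B.baseEquiv.symm x := by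
  change B.baseEquiv.symm (algebraMap k U c • x) = _
  rw [baseEquiv_symm_smul, act, ← Algebra.smul_def, map_smul, ε_s]

variable (B) in
/-- The cocycle which corresponds to a map out of a syzygy. -/
noncomputable def cocycleHom (p : ℕ) : (B.K p ⟶ B.Q 0) →ₗ[k] B.cocycles p where
  toFun f := ⟨B.cochainOf ((f.hom.comp (B.πK p)).toAddMonoidHom.comp (B.hQ p)),
    (isTLin_comp_hQ (p := 0) _).isCochain, by
      change B.δ p _ = 0
      rw [δ_cochainOf_hom]
      funext u
      change B.baseEquiv.symm (f.hom (B.πK p (B.dQ (p + 1) _))) = 0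
      rw [πK_dQ, map_zero, map_zero]⟩
  map_add' f g := Subtype.ext (funext fun u => B.baseEquiv.symm.map_add _ _)
  map_smul' c f := Subtype.ext (funext fun u => baseEquiv_symm_algebra_smul c _)

theorem cocycleHom_injective (p : ℕ) : Function.Injective (B.cocycleHom p) := fun f g h => by
  ext x
  obtain ⟨x, rfl⟩ := πK_surjective p x
  exact LinearMap.congr_fun (eq_of_cochainOf_eq (congrArg Subtype.val h)) x

theorem cocycleHom_surjective (p : ℕ) : Function.Surjective (B.cocycleHom p) := fun ⟨φ, hφ⟩ => by
  obtain ⟨F, rfl⟩ := exists_hom_cochainOf_eq hφ.1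
  have h : F.comp (B.dQ (p + 1)) = 0 := by
    refine eq_of_cochainOf_eq ?_
    rw [← δ_cochainOf_hom]
    refine Eq.trans hφ.2 (funext fun u => ?_)
    exact (map_zero B.baseEquiv.symm).symm
  obtain ⟨f, rfl⟩ := exists_descend h
  exact ⟨ModuleCat.ofHom (X := B.K p) (Y := B.Q 0) f, rfl⟩

variable (B) in
/-- Cocycles are maps out of the syzygies. -/
noncomputable def cocycleEquiv (p : ℕ) : (B.K p ⟶ B.Q 0) ≃ₗ[k] B.cocycles p :=
  LinearEquiv.ofBijective (B.cocycleHom p) ⟨cocycleHom_injective p, cocycleHom_surjective p⟩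

/-- Being a coboundary is thus the same extension property as in `Sh_mk₀_eq_zero_iff`; this
identifies cohomology with `Ext`. -/
theorem cocycleHom_mem_coboundaries_iff (f : B.K (p + 1) ⟶ B.Q 0) :
    (B.cocycleHom (p + 1) f : (Fin (p + 1) → U) → A) ∈ B.coboundaries (p + 1) ↔
      ∃ g : B.Q (p + 1) ⟶ B.Q 0, B.iK p ≫ g = f := by
  constructor
  · rintro ⟨φ, hφ, e⟩
    obtain ⟨F, rfl⟩ := exists_hom_cochainOf_eq hφ
    rw [δ_cochainOf_hom] at e
    refine ⟨ModuleCat.ofHom (X := B.Q (p + 1)) (Y := B.Q 0) F, ?_⟩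
    ext x
    obtain ⟨x, rfl⟩ := πK_surjective (p + 1) x
    exact LinearMap.congr_fun (eq_of_cochainOf_eq e) x
  · rintro ⟨g, rfl⟩
    exact ⟨_, (isTLin_comp_hQ g.hom).isCochain, δ_cochainOf_hom g.hom⟩

theorem cocycleHom_mem_coboundaries_zero_iff (f : B.K 0 ⟶ B.Q 0) :
    (B.cocycleHom 0 f : (Fin 0 → U) → A) ∈ B.coboundaries 0 ↔ f = 0 := by
  constructor
  · intro h
    exact cocycleHom_injective 0 ((Subtype.ext ((Submodule.mem_bot k).1 h)).trans (map_zero _).symm)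
  · rintro rfl
    rw [map_zero]
    exact zero_mem _

end LeftBialgebroid

/-! ### Chain maps lifting cocycles, and the Yoneda product. -/

namespace LeftBialgebroid

variable {k : Type v} {A U : Type u} [CommRing k] [Ring A] [Algebra k A] [Ring U] [Algebra k U]
  {B : LeftBialgebroid k A U} {p q : ℕ}

/-! ### Lifting cocycles to chain maps -/

section Lift

variable (f : B.K p ⟶ B.Q 0)

/-- The chain map of degree `-p` which lifts a cocycle. -/
noncomputable def chainQ : (j : ℕ) → {g : B.Q (p + j) →+ B.Q j // B.IsTLin g}
  | 0 => ⟨(f.hom.comp (B.πK p)).toAddMonoidHom.comp (B.hQ p), isTLin_comp_hQ (p := 0) _⟩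
  -- The lift acts as the identity on the first tensor factor. Only the component in degree zero can
  -- fail to be `U`-linear; it is compatible with the target map, which is all the construction
  -- needs.
  | j + 1 => ⟨(liftQ (isTLin_hQ.comp (chainQ j).2)).toAddMonoidHom, isTLin_of_linear _⟩

/-- The `U`-linear components of the chain map which lifts a cocycle. -/
noncomputable def chainHom (j : ℕ) : B.Q (p + j + 1) →ₗ[U] B.Q (j + 1) :=
  liftQ (isTLin_hQ.comp (chainQ f j).2)

theorem chainHom_hQ (j : ℕ) (x : B.Q (p + j)) :
    chainHom f j (B.hQ (p + j) x) = B.hQ j ((chainQ f j).1 x) := liftQ_hQ _ x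

theorem chainHom_mkQ (j : ℕ) (u : U) (x : B.Q (p + j)) :
    chainHom f j (B.mkQ (p + j) u x) = B.mkQ j u ((chainQ f j).1 x) := by
  rw [mkQ_eq, map_smul, chainHom_hQ, ← mkQ_eq]

theorem chainQ_succ (j : ℕ) (x : B.Q (p + j + 1)) : (chainQ f (j + 1)).1 x = chainHom f j x := rfl

theorem chainQ_zero (x : B.Q p) : (chainQ f 0).1 x = f.hom (B.πK p (B.hQ p x)) := rfl

theorem dQ_chainHom_zero (x : B.Q (p + 1)) : B.dQ 0 (chainHom f 0 x) = f.hom (B.πK p x) := by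
  have : (B.dQ 0).comp (chainHom f 0) = f.hom.comp (B.πK p) :=
    Q_hom_ext (n := p) fun q => by
      rw [LinearMap.comp_apply, LinearMap.comp_apply]
      refine (congrArg _ (chainHom_hQ f 0 q)).trans ?_
      rw [dQ_zero, chainQ_zero]
  exact LinearMap.congr_fun this x

/-- Both sides are compared on `1 ⊗ q`, with no signs. The induction starts because `f`, pulled back
to the resolution, kills the image of the differential. -/
theorem dQ_chainHom (j : ℕ) (x : B.Q (p + j + 1)) :
    B.dQ j (chainHom f j x) = (chainQ f j).1 (B.dQ (p + j) x) := by
  induction j with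
  | zero =>
    refine (dQ_chainHom_zero f x).trans ?_
    have h := πK_dQ (B.hQ (p + 1) x)
    rw [dQ_succ, map_sub, sub_eq_zero] at h
    rw [h]
    rfl
  | succ j ih =>
    have : (B.dQ (j + 1)).comp (chainHom f (j + 1)) = (chainHom f j).comp (B.dQ (p + j + 1)) :=
      Q_hom_ext (n := p + j + 1) fun q => by
        rw [LinearMap.comp_apply, LinearMap.comp_apply]
        refine (congrArg _ (chainHom_hQ f (j + 1) q)).trans ?_
        rw [dQ_succ, chainQ_succ, ih, dQ_succ, map_sub, chainHom_hQ]
    exact LinearMap.congr_fun this x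

/-- The maps between syzygies which are induced by a cocycle. -/
noncomputable def chainK : (j : ℕ) → (B.K (p + j) ⟶ B.K j)
  | 0 => f ≫ B.jK.hom
  | j + 1 => ModuleCat.ofHom (X := B.K (p + j + 1)) (Y := B.K (j + 1))
      (liftK (M := B.K (p + j + 1)) ((chainHom f j).comp (B.ιK (p + j))) fun x => by
        change B.dQ j (chainHom f j (B.ιK (p + j) x)) = 0
        rw [dQ_chainHom, dQ_ιK, map_zero])

theorem chainHom_πK (j : ℕ) :
    ModuleCat.ofHom (X := B.Q (p + j + 1)) (Y := B.Q (j + 1)) (chainHom f j) ≫ B.pK j =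
      B.pK (p + j) ≫ chainK f j := by
  ext x
  cases j with
  | zero => exact dQ_chainHom_zero f x
  | succ j => exact ιK_injective (dQ_chainHom f (j + 1) x)

open Abelian

variable (B) in
/-- The iterated extension classes of `n` steps of the resolution, starting with the `m`-th one. -/
noncomputable def ShRel (m : ℕ) : (n : ℕ) → Ext.{u} (B.K m) (B.K (m + n)) n
  | 0 => Ext.mk₀ (𝟙 _)
  | n + 1 => (ShRel m n).comp (B.eK (m + n)) rfl

theorem Sh_comp_ShRel (m n : ℕ) : (B.Sh m).comp (B.ShRel m n) rfl = B.Sh (m + n) := by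
  induction n with
  | zero => exact Ext.comp_mk₀_id _
  | succ n ih =>
    rw [ShRel, ← Ext.comp_assoc _ _ _ rfl _ (by omega), ih]
    rfl

/-- Naturality of the extension class is applied along each short exact sequence crossed by the
chain map. -/
theorem ShRel_comp_chainK (j : ℕ) :
    (B.ShRel p j).comp (Ext.mk₀ (chainK f j)) (add_zero j) =
      (Ext.mk₀ f).comp (B.Sh j) (zero_add j) := by
  induction j with
  | zero =>
    change (Ext.mk₀ (𝟙 (B.K p))).comp (Ext.mk₀ (f ≫ B.jK.hom)) (add_zero 0) =
      (Ext.mk₀ f).comp (Ext.mk₀ B.jK.hom) (zero_add 0)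
    rw [Ext.mk₀_id_comp, Ext.mk₀_comp_mk₀]
  | succ j ih =>
    have h : (B.eK (p + j)).comp (Ext.mk₀ (chainK f (j + 1))) (add_zero 1) =
        (Ext.mk₀ (chainK f j)).comp (B.eK j) (zero_add 1) :=
      eK_naturality _ (ModuleCat.ofHom (X := B.Q (p + j + 1)) (Y := B.Q (j + 1)) (chainHom f j)) _
        rfl (chainHom_πK f j)
    rw [ShRel, Ext.comp_assoc_of_third_deg_zero, h, ← Ext.comp_assoc_of_second_deg_zero, ih, Sh,
      Ext.comp_assoc]
    omega

variable (B) in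
/-- The extension class of a cocycle. -/
noncomputable def toExt (p : ℕ) : (B.K p ⟶ B.Q 0) →ₗ[k] Ext.{u} (B.Q 0) (B.Q 0) p where
  toFun f := (B.Sh p).comp (Ext.mk₀ f) (add_zero p)
  map_add' f g := by rw [Ext.mk₀_add, Ext.comp_add]
  map_smul' c f := by rw [Ext.mk₀_smul, Ext.comp_smul, RingHom.id_apply]

theorem toExt_comp_toExt (g : B.K q ⟶ B.Q 0) :
    (B.toExt p f).comp (B.toExt q g) rfl = B.toExt (p + q) (chainK f q ≫ g) := by
  change ((B.Sh p).comp (Ext.mk₀ f) (add_zero p)).comp ((B.Sh q).comp (Ext.mk₀ g) (add_zero q)) rfl =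
    (B.Sh (p + q)).comp (Ext.mk₀ (chainK f q ≫ g)) (add_zero (p + q))
  rw [Ext.comp_assoc_of_second_deg_zero, ← Ext.comp_assoc _ _ _ (zero_add q) (add_zero q) (by omega),
    ← ShRel_comp_chainK, Ext.comp_assoc_of_third_deg_zero, Ext.mk₀_comp_mk₀, ← Sh_comp_ShRel,
    Ext.comp_assoc_of_third_deg_zero]

end Lift

theorem toExt_surjective (h : B.IsRightProjective) (p : ℕ) : Function.Surjective (B.toExt p) :=
  fun x => exists_Sh_mk₀ h x

theorem toExt_eq_zero_iff (h : B.IsRightProjective) (p : ℕ) (f : B.K p ⟶ B.Q 0) :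
    B.toExt p f = 0 ↔ (B.cocycleHom p f : (Fin p → U) → A) ∈ B.coboundaries p := by
  cases p with
  | zero => exact (Sh_zero_mk₀_eq_zero_iff f).trans (cocycleHom_mem_coboundaries_zero_iff f).symm
  | succ p => exact (Sh_mk₀_eq_zero_iff h f).trans (cocycleHom_mem_coboundaries_iff f).symm

theorem chainQ_tau (f : B.K p ⟶ B.Q 0) {j : ℕ} (v w : List U) (hv : v.length = j) :
    (chainQ f j).1 (B.tau (p + j) (v ++ w)) =
      B.tauA j v (B.baseEquiv.symm (f.hom (B.πK p (B.hQ p (B.tau p w))))) := by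
  subst hv
  induction v with
  | nil => exact (B.baseEquiv.apply_symm_apply _).symm
  | cons x v ih => exact (chainHom_mkQ f v.length x _).trans (congrArg _ ih)

theorem of_cls_eq {φ : (Fin p → U) → A} {ψ : (Fin q → U) → A} (hφ : φ ∈ B.cocycles p)
    (hψ : ψ ∈ B.cocycles q) (hpq : p = q)
    (h : ∀ u : Fin p → U, φ u = ψ fun i => u (Fin.cast hpq.symm i)) :
    DirectSum.of B.H p (B.cls φ hφ) = DirectSum.of B.H q (B.cls ψ hψ) := by
  subst hpq
  obtain rfl : φ = ψ := funext h
  rfl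

/-- The lift of `f` keeps the first `q` entries and evaluates `f` on the last `p`; applying `g` then
gives the cup product in the reversed order. -/
theorem cocycleHom_chainK (f : B.K p ⟶ B.Q 0) (g : B.K q ⟶ B.Q 0) (u : Fin (p + q) → U) :
    (B.cocycleHom (p + q) (chainK f q ≫ g)).1 u =
      B.cup (B.cocycleHom q g).1 (B.cocycleHom p f).1 fun i => u (Fin.cast (add_comm q p) i) := by
  have h : List.ofFn u = List.ofFn (fun i : Fin q => u (Fin.cast (add_comm q p) (Fin.castAdd p i))) ++
      List.ofFn (fun i : Fin p => u (Fin.cast (add_comm q p) (Fin.natAdd q i))) := by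
    rw [List.ofFn_congr (add_comm p q) u, List.ofFn_add]
    rfl
  have h1 : (B.cocycleHom (p + q) (chainK f q ≫ g)).1 u =
      B.baseEquiv.symm (g.hom (B.πK q (B.hQ q ((chainQ f q).1 (B.tau (p + q) (List.ofFn u)))))) := by
    rw [← chainHom_hQ]
    exact congrArg (fun x => B.baseEquiv.symm (g.hom x))
      (ConcreteCategory.congr_hom (chainHom_πK f q) (B.hQ (p + q) (B.tau (p + q) (List.ofFn u)))).symm
  rw [h1, h, chainQ_tau f _ _ (List.length_ofFn)]
  exact (lastAct_cochainOf (isTLin_comp_hQ (p := 0) (g.hom.comp (B.πK q))) _ _).symm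

open Abelian

/-- The sign `(-1)^{p(p-1)/2}`. -/
def yonedaSign : ℕ → ℤ
  | 0 => 1
  | p + 1 => sgn p * yonedaSign p

theorem yonedaSign_mul_self : ∀ p, yonedaSign p * yonedaSign p = 1
  | 0 => rfl
  | p + 1 => by
    rw [yonedaSign, mul_mul_mul_comm, sgn_mul_self, yonedaSign_mul_self, one_mul]

/-- This is `C(p + q, 2) = C(p, 2) + C(q, 2) + p q` in the exponent. -/
theorem yonedaSign_add (p q : ℕ) :
    yonedaSign (p + q) = sgn (p * q) * (yonedaSign p * yonedaSign q) := by
  induction q with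
  | zero => simp [yonedaSign, sgn_zero]
  | succ q ih =>
    rw [← add_assoc, yonedaSign, ih, yonedaSign]
    push_cast
    rw [mul_add, sgn_add, sgn_add, mul_one]
    ring

variable (B) in
/-- The extension class of a cocycle, with the sign which makes it multiplicative. -/
noncomputable def cocycleToExt (p : ℕ) : B.cocycles p →ₗ[k] Ext.{u} (B.Q 0) (B.Q 0) p :=
  yonedaSign p • (B.toExt p).comp (B.cocycleEquiv p).symm.toLinearMap

theorem cocycleToExt_cocycleHom (f : B.K p ⟶ B.Q 0) :
    B.cocycleToExt p (B.cocycleHom p f) = yonedaSign p • B.toExt p f := by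
  have : (B.cocycleEquiv p).symm (B.cocycleHom p f) = f := (B.cocycleEquiv p).symm_apply_apply f
  rw [cocycleToExt, LinearMap.smul_apply, LinearMap.comp_apply, LinearEquiv.coe_coe, this]

theorem cocycleToExt_surjective (h : B.IsRightProjective) (p : ℕ) :
    Function.Surjective (B.cocycleToExt p) := fun x => by
  obtain ⟨f, hf⟩ := toExt_surjective h p (yonedaSign p • x)
  exact ⟨B.cocycleHom p f, by
    rw [cocycleToExt_cocycleHom, hf, smul_smul, yonedaSign_mul_self, one_smul]⟩

theorem ker_cocycleToExt (h : B.IsRightProjective) (p : ℕ) :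
    LinearMap.ker (B.cocycleToExt p) = (B.coboundaries p).submoduleOf (B.cocycles p) := by
  ext x
  obtain ⟨f, rfl⟩ := cocycleHom_surjective p x
  rw [LinearMap.mem_ker, cocycleToExt_cocycleHom]
  refine Iff.trans ⟨fun e => ?_, fun e => by rw [e, smul_zero]⟩ (toExt_eq_zero_iff h p f)
  rw [← one_smul ℤ (B.toExt p f), ← yonedaSign_mul_self p, mul_smul, e, smul_zero]

/-- The comparison of cohomology and `Ext`. -/
noncomputable def extEquiv (h : B.IsRightProjective) (p : ℕ) :
    B.H p ≃ₗ[k] Ext.{u} (B.Q 0) (B.Q 0) p :=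
  (Submodule.quotEquivOfEq _ _ (ker_cocycleToExt h p).symm).trans
    ((B.cocycleToExt p).quotKerEquivOfSurjective (cocycleToExt_surjective h p))

theorem extEquiv_cls (h : B.IsRightProjective) {φ : (Fin p → U) → A} (hφ : φ ∈ B.cocycles p) :
    extEquiv h p (B.cls φ hφ) = B.cocycleToExt p ⟨φ, hφ⟩ := rfl

theorem extEquiv_one (h : B.IsRightProjective) :
    extEquiv h 0 (B.cls _ B.one_mem_cocycles) = Ext.mk₀ (𝟙 (B.Q 0)) := by
  have e : B.cocycleHom 0 B.jK.inv = ⟨_, B.one_mem_cocycles⟩ := by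
    refine Subtype.ext (funext fun u => ?_)
    change B.baseEquiv.symm (B.dQ 0 (B.hQ 0 (B.baseEquiv 1))) = 1
    rw [dQ_zero, AddEquiv.symm_apply_apply]
  rw [extEquiv_cls, ← e, cocycleToExt_cocycleHom, yonedaSign, one_smul]
  change (Ext.mk₀ B.jK.hom).comp (Ext.mk₀ B.jK.inv) (add_zero 0) = _
  rw [Ext.mk₀_comp_mk₀, Iso.hom_inv_id]

theorem extEquiv_cup (h : B.IsRightProjective) (x : B.H p) (y : B.H q) :
    extEquiv h (p + q) (B.gerstenhaber.cup p q x y) =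
      (extEquiv h p x).comp (extEquiv h q y) rfl := by
  obtain ⟨x, rfl⟩ := Submodule.Quotient.mk_surjective _ x
  obtain ⟨y, rfl⟩ := Submodule.Quotient.mk_surjective _ y
  obtain ⟨f, rfl⟩ := cocycleHom_surjective p x
  obtain ⟨g, rfl⟩ := cocycleHom_surjective q y
  have e1 := B.gerstenhaber.cup_comm p q (B.cls _ (B.cocycleHom p f).2) (B.cls _ (B.cocycleHom q g).2)
  obtain ⟨h', e2⟩ : ∃ h', B.gerstenhaber.cup q p (B.cls _ (B.cocycleHom q g).2)
      (B.cls _ (B.cocycleHom p f).2) = B.cls (B.cup _ _) h' := ⟨_, rfl⟩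
  -- Graded commutativity replaces the product by `(-1)^{pq}` times the reversed one, which
  -- represents the Yoneda product; `yonedaSign_add` cancels this sign.
  rw [e2, ← of_cls_eq (B.cocycleHom (p + q) (chainK f q ≫ g)).2 h' (add_comm p q)
    (cocycleHom_chainK f g), ← map_zsmul] at e1
  have e3 := DirectSum.of_injective _ e1
  refine (congrArg (extEquiv h (p + q)) e3).trans ?_
  rw [map_zsmul, extEquiv_cls]
  change _ = (B.cocycleToExt p (B.cocycleHom p f)).comp (B.cocycleToExt q (B.cocycleHom q g)) rfl
  rw [cocycleToExt_cocycleHom, cocycleToExt_cocycleHom]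
  rw [cocycleToExt_cocycleHom, ← toExt_comp_toExt, yonedaSign_add, smul_smul, ← mul_assoc,
    sgn_mul_self, one_mul]
  simp only [← Int.cast_smul_eq_zsmul k, Ext.smul_comp, Ext.comp_smul, smul_smul, Int.cast_mul,
    mul_comm (yonedaSign q : k)]

end LeftBialgebroid

/-! ### The main theorem. -/

theorem mainTheorem5 {k : Type v} {A U : Type u} [CommRing k] [Ring A] [Algebra k A]
    [Ring U] [Algebra k U] (B : LeftBialgebroid k A U) :
    -- the cochain complex and its operations are well defined
    (∀ (p : ℕ), ∀ φ ∈ B.cochains p, B.δ p φ ∈ B.cochains (p + 1) ∧ B.δ (p + 1) (B.δ p φ) = 0) ∧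
    (∀ (p q : ℕ), ∀ φ ∈ B.cochains p, ∀ ψ ∈ B.cochains q, B.cup φ ψ ∈ B.cochains (p + q)) ∧
    (∀ (p : ℕ), ∀ φ ∈ B.cochains p, ∀ (u : Fin p → U) (n : Fin p → ℕ) (x y : ∀ i, Fin (n i) → U),
      (∀ i, IsRep B.η (B.Δ (u i)) (x i) (y i)) → B.opD φ u = B.opDAux φ n x y) ∧
    (∀ (p q : ℕ) (i : Fin p), ∀ φ ∈ B.cochains p, ∀ ψ ∈ B.cochains q,
      B.circ i φ ψ ∈ B.cochains (p + q - 1)) ∧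
    -- they induce a Gerstenhaber algebra structure on cohomology
    ∃ G : GerstenhaberAlgebra k B.H,
      (∃ h : (fun _ => 1) ∈ B.cocycles 0, G.one = B.cls (fun _ => 1) h) ∧
      (∀ (p q : ℕ) (φ : (Fin p → U) → A) (hφ : φ ∈ B.cocycles p)
        (ψ : (Fin q → U) → A) (hψ : ψ ∈ B.cocycles q),
        (∃ h : B.cup φ ψ ∈ B.cocycles (p + q),
          G.cup p q (B.cls φ hφ) (B.cls ψ hψ) = B.cls (B.cup φ ψ) h) ∧
        (∃ h : B.bracket φ ψ ∈ B.cocycles (p + q - 1),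
          G.bracket p q (B.cls φ hφ) (B.cls ψ hψ) = B.cls (B.bracket φ ψ) h)) ∧
      -- in the right projective left Hopf case, the cohomology ring is the `Ext`-algebra
      (B.IsLeftHopf → B.IsRightProjective →
        ∃ e : ∀ p, B.H p ≃ₗ[k] B.ExtAA p,
          e 0 G.one = Abelian.Ext.mk₀ (𝟙 B.unitObj) ∧
          ∀ (p q : ℕ) (x : B.H p) (y : B.H q),
            e (p + q) (G.cup p q x y) = (e p x).comp (e q y) rfl) := by
  refine ⟨fun p φ hφ => ?_, fun p q φ hφ ψ hψ => ?_, fun p φ hφ u n x y h => ?_,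
    fun p q i φ hφ ψ hψ => ?_, B.gerstenhaber, ⟨B.one_mem_cocycles, rfl⟩,
    fun p q φ hφ ψ hψ => ⟨⟨_, rfl⟩, ⟨_, rfl⟩⟩, fun _ h =>
      ⟨LeftBialgebroid.extEquiv h, LeftBialgebroid.extEquiv_one h,
        fun p q x y => LeftBialgebroid.extEquiv_cup h x y⟩⟩
  · have h : B.IsCochain φ := hφ
    have e := LeftBialgebroid.IsD.δ_ev (p := p + 1) (B := B) (F := hdelta ((p : ℤ) - 1) (B.opL φ))
      (by have := h.isD.hdelta; rwa [show (p : ℤ) - 1 + 1 = ((p + 1 : ℕ) : ℤ) - 1 by push_cast; ring] at this)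
    rw [h.δ_eq]
    refine ⟨h.isD.hdelta.isCochain_ev _, e.trans ?_⟩
    rw [show ((p + 1 : ℕ) : ℤ) - 1 = (p : ℤ) - 1 + 1 by push_cast; ring,
      hdelta_hdelta h.isD.multiAdd h.isD.homog]
    exact funext fun u => map_zero B.ε
  · rw [LeftBialgebroid.IsCochain.cup_eq hφ hψ]
    exact ((LeftBialgebroid.IsCochain.isD hφ).lcup (LeftBialgebroid.IsCochain.isD hψ)).isCochain_ev _
  · exact (LeftBialgebroid.IsCochain.opD_eq_opL hφ u).trans
      (LeftBialgebroid.IsCochain.opD_eq hφ u n x y h).symm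
  · rw [LeftBialgebroid.IsCochain.circ_eq hφ hψ]
    exact ((LeftBialgebroid.IsCochain.isD hφ).wcirc (LeftBialgebroid.IsCochain.isD hψ) _).isCochain_ev _
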